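/- **Setting.** Let $\mathcal X,\mathcal Z\subseteq\mathbb R^d$ be finite, $\mathcal X$ spanning $\mathbb R^d$, let $\theta_*,\mu_{*,1},\dots,\mu_{*,m}\in\mathbb R^d$ ($m\ge1$) be unknown, all these vectors (including the elements of $\mathcal X$ and $\mathcal Z$) of Euclidean norm at most $1$, and let $\gamma\in[-1,1]$ be known. A learner plays arms $x_t\in\mathcal X$ (possibly randomized, given the past) and observes $r_t=\theta_*^\top x_t+w^\theta_t$ and $s_{t,i}=\mu_{*,i}^\top x_t+w^\mu_{t,i}$ ($i\in[m]$), where the noise vector at time $t$ is independent of the past and of $x_t$ and has mean-zero $1$-subGaussian coordinates. Write $\mathfrak p(x)=\max\{x,0\}$, $\triangle_{\mathcal X}$ for the probability vectors on $\mathcal X$, $A(\lambda)=\sum_x\lambda_x xx^\top$, $\|v\|^2_{A(\lambda)^{-1}}=v^\top A(\lambda)^{-1}v$ (designs $\lambda$ range over $\lambda\in\triangle_{\mathcal X}$ with $A(\lambda)$ invertible). Let $\Delta^i_{\rm safe}(z)=\gamma-\mu_{*,i}^\top z$, assume that some arm of $\mathcal Z$ is safe (all $\Delta^i_{\rm safe}(z)\ge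 0$), let $z_*$ be a safe arm of $\mathcal Z$ maximizing $\theta_*^\top z$, and for $e>0$ let $$\Delta^{e}(z)=\max\{\theta_*^\top(z'-z): z'\in\mathcal Z,\ \min_i\Delta^i_{\rm safe}(z')\ge e\},\qquad \mathfrak p(\max\emptyset):=0.$$ **The algorithm BESIDE** has positive numerical constants $c_a,c_c,c_f,c_d,c_e,c_y,c_g,c_0$. Logarithms in the numbers of rounds are to base $2$ and rounded up to a natural number; ties are broken by an arbitrary measurable rule. *Designs.* For $S\subseteq\mathcal Z$, vectors $v_z$, numbers $b_z$, $L$ and a threshold $\eta$, "solve the design $(S,v,b,L,\eta)$" means: let $\tau$ be the least power of two with $\tau\ge4L$ for which some design $\lambda$ satisfies $\max_{z\in S}\{-b_z+\sqrt{\|v_z\|^2_{A(\lambda)^{-1}}L/\tau}\}\le\eta$, take any such $\lambda$, and draw $\tau$ fresh independent arms from $\lambda$. *RIPS* $(\mathcal Y,\delta)$ on samples $(x_t,r_t)_{t\le T}$ drawn from $\lambda$: for $y\in\mathcal Y$ let $W^y$ be the root $\zeta$ of $\sum_t\psi(\alpha_y(y^\top A(\lambda)^{-1}x_tr_t-\zeta))=0$,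 where $\psi(u)=\log(1+u+u^2/2)$ for $u\ge0$, $\psi(-u)=-\psi(u)$, and $\alpha_y=\sqrt{2\log(2|\mathcal Y|/\delta)/(2T\|y\|^2_{A(\lambda)^{-1}})}$; return a minimizer $\theta$ of $\max_{y\in\mathcal Y}|\theta^\top y-W^y|/\|y\|_{A(\lambda)^{-1}}$ (where $y=0$ contributes $0$). *RAGE$^\epsilon$* $(S,\mathcal Y,\epsilon,\delta,h)$, for $\mathcal Y\subseteq S\subseteq\mathcal Z$ and $h:\mathcal Z\to[0,\infty)$: if $\mathcal Y=\emptyset$, return $\widehat\Delta=0$. Otherwise start with any $\widehat y_0\in\mathcal Y$, $\widehat\Delta^0=0$. For $\ell=1,\dots,\lceil\log_2(2/(c_f\epsilon))\rceil$ let $\epsilon_\ell=\frac2{c_f}2^{-\ell}$, $L=\log(4|S|^2\ell^2/\delta)$; solve the design with $v_z=z-\widehat y_{\ell-1}$, $b_z=c_a(h(z)+\mathfrak p(\widehat\Delta^{\ell-1}(z))+\epsilon_\ell)$, $\eta=c_c\epsilon_\ell$, giving $\tau,\lambda$; let $\widehat\theta$ be the RIPS estimate from these $(x_t,r_t)$ with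 active set $\{z-z':z,z'\in S\}$ and confidence $\delta/(2\ell^2)$; with $n(z,z')=\sqrt{\|z-z'\|^2_{A(\lambda)^{-1}}L/\tau}$ let $\widehat y_\ell$ maximize $y^\top\widehat\theta-8n(y,\widehat y_{\ell-1})$ over $\mathcal Y$ and $\widehat\Delta^\ell(z)=(\widehat y_\ell-z)^\top\widehat\theta+n(z,\widehat y_\ell)$. Return the last $\widehat\Delta^\ell$. *BESIDE* $(\epsilon,\delta)$: start with $\widehat\Delta^{i,0}_{\rm safe}=0$, $\widehat\Delta^0=0$, $\mathcal Y_0=\emptyset$; put $h^\ell(z)=\max_j\mathfrak p(-\widehat\Delta^{j,\ell}_{\rm safe}(z))$ and $q^\ell(z)=\min_j|\widehat\Delta^{j,\ell}_{\rm safe}(z)|+h^\ell(z)+\mathfrak p(\widehat\Delta^\ell(z))$. For $\ell=1,\dots,\iota=\lceil\log_2(2/(c_0\epsilon))\rceil$ let $\epsilon_\ell=\frac2{c_0}2^{-\ell}$, $L=\log(4m|\mathcal Z|\ell^2/\delta)$; solve the design with $S=\mathcal Z$, $v_z=z$, $b_z=c_d(q^{\ell-1}(z)+\epsilon_\ell)$,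 $\eta=c_e\epsilon_\ell$, giving $\tau,\lambda$; for each $i$ let $\widehat\mu^i$ be the RIPS estimate from $(x_t,s_{t,i})$ with active set $\mathcal Z$ and confidence $\delta/(2m\ell^2)$; let $\widehat\Delta^{i,\ell}_{\rm safe}(z)=\gamma-z^\top\widehat\mu^i+\sqrt{\|z\|^2_{A(\lambda)^{-1}}L/\tau}$, $\mathcal Y_\ell=\mathcal Y_{\ell-1}\cup\{z\in\mathcal Z: c_y(c_dq^{\ell-1}(z)+(c_d+c_e)\epsilon_\ell)\le\widehat\Delta^{i,\ell}_{\rm safe}(z)\ \forall i\}$ and $\widehat\Delta^\ell=$ RAGE$^\epsilon(\mathcal Z,\mathcal Y_\ell,\epsilon_\ell,\delta/(4\ell^2),h^\ell)$. Finally let $\mathcal Y_{\rm end}=\{z\in\mathcal Z: c_y(c_dq^{\iota}(z)+(c_d+c_e)\epsilon)-c_g\epsilon\le\widehat\Delta^{i,\iota}_{\rm safe}(z)\ \forall i\}$, $\widehat\Delta^{\rm end}=$ RAGE$^\epsilon(\mathcal Y_{\rm end},\mathcal Y_{\rm end},\epsilon,\delta,h^\iota)$, and return a minimizer $\widehat z$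 of $\widehat\Delta^{\rm end}$ over $\mathcal Y_{\rm end}$ (any arm if $\mathcal Y_{\rm end}=\emptyset$). **Theorem.** There are universal positive settings of the constants of BESIDE, and universal constants $K>0$, $p\in\mathbb N$, such that for every instance as above, every $\epsilon>0$ and every $\delta\in(0,1)$, BESIDE run with tolerance $\epsilon$ and confidence input $\delta/2$ satisfies the following. With probability at least $1-\delta$ it returns $\widehat z\in\mathcal Z$ with $$\widehat z^\top\theta_*\ge z_*^\top\theta_*-\epsilon,\qquad \min_{i}\Delta^i_{\rm safe}(\widehat z)\ge-\epsilon,$$ and it stops after collecting at most $$C\sup_{\tilde\epsilon\ge\epsilon}\inf_{\lambda\in\triangle_{\mathcal X}}\max_{z\in\mathcal Z}\frac{\|z\|^2_{A(\lambda)^{-1}}\log(2m|\mathcal Z|/\delta)}{\big(\min_j|\Delta^j_{\rm safe}(z)|+\max_j\mathfrak p(-\Delta^j_{\rm safe}(z))+\mathfrak p(\Delta^{\tilde\epsilon}(z))+\tilde\epsilon\big)^2} +C\sup_{\tilde\epsilon\ge\epsilon}\inf_{\lambda\in\triangle_{\mathcal X}}\max_{z\in\mathcal Z}\frac{\|z-z_*\|^2_{A(\lambda)^{-1}}\log(2|\mathcal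 Z|/\delta)}{\big(\max_j\mathfrak p(-\Delta^j_{\rm safe}(z))+\mathfrak p(\Delta^{\tilde\epsilon}(z))+\tilde\epsilon\big)^2}+C_0$$ samples, where $C=K\log^p(2+1/\epsilon)$ and $C_0=K\big(\log(2+1/\epsilon)\,\log(2+m|\mathcal Z|)\big)^p\log(2/\delta)$. -/

import Mathlib

open MeasureTheory ProbabilityTheory

noncomputable section

namespace Beside

/-! ### Linear bandits with safety constraints -/

/-- Euclidean space `ℝ^d`. -/
abbrev Vec (d : ℕ) := EuclideanSpace ℝ (Fin d)

/-- The positive part `𝔭(x) = max {x, 0}`. -/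
def pp (x : ℝ) : ℝ := max x 0

section Design

variable {d : ℕ} (𝒳 : Finset (Vec d))

/-- `A(λ) = ∑_{x ∈ 𝒳} λ_x x xᵀ`. -/
def covMat (lam : 𝒳 → ℝ) : Matrix (Fin d) (Fin d) ℝ :=
  ∑ x : 𝒳, lam x • Matrix.vecMulVec (x : Vec d).ofLp (x : Vec d).ofLp

/-- `λ` is a point of the simplex `△_𝒳` for which `A(λ)⁻¹` exists. -/
def IsDesign (lam : 𝒳 → ℝ) : Prop :=
  lam ∈ stdSimplex ℝ 𝒳 ∧ IsUnit (covMat 𝒳 lam).det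

/-- The bilinear form `uᵀ A(λ)⁻¹ v`. -/
def invForm (lam : 𝒳 → ℝ) (u v : Vec d) : ℝ :=
  u.ofLp ⬝ᵥ ((covMat 𝒳 lam)⁻¹.mulVec v.ofLp)

/-- `‖v‖²_{A(λ)⁻¹}`. -/
def invNormSq (lam : 𝒳 → ℝ) (v : Vec d) : ℝ := invForm 𝒳 lam v v

end Design

section Gaps

variable {d m : ℕ} (𝒵 : Finset (Vec d)) (θ : Vec d) (μ : Fin m → Vec d) (γ : ℝ)

/-- The safety gap `Δ_safe^i(z) = γ - μ_iᵀ z`. -/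
def safetyGap (i : Fin m) (z : Vec d) : ℝ := γ - inner ℝ (μ i) z

/-- `z` is a best safe arm `z_*`. -/
def IsBestSafe (z : Vec d) : Prop :=
  z ∈ 𝒵 ∧ (∀ i, 0 ≤ safetyGap μ γ i z) ∧
    ∀ z' ∈ 𝒵, (∀ i, 0 ≤ safetyGap μ γ i z') → inner ℝ θ z' ≤ inner ℝ θ z

open Classical in
/-- The arms all of whose safety gaps are at least `e`. -/
def safeBy (e : ℝ) : Finset (Vec d) := 𝒵.filter fun z' => ∀ i, e ≤ safetyGap μ γ i z'

open Classical in
/-- `𝔭(Δ^e(z))`, where `Δ^e(z)` is the maximum of `θᵀ (z' - z)` over the arms `z'` all of whose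
safety gaps are at least `e`. The maximum of the empty set is `-∞`, of positive part `0`. -/
def ppEpsGap (e : ℝ) (z : Vec d) : ℝ :=
  if h : (safeBy 𝒵 μ γ e).Nonempty then
    pp ((safeBy 𝒵 μ γ e).sup' h fun z' => inner ℝ θ (z' - z))
  else 0

/-- `min_j |Δ_safe^j(z)|`. -/
def minAbsSafety (z : Vec d) : ℝ := ⨅ j, |safetyGap μ γ j z|

/-- `max_j 𝔭(-Δ_safe^j(z))`. -/
def maxUnsafety (z : Vec d) : ℝ := ⨆ j, pp (-safetyGap μ γ j z)

variable (𝒳 : Finset (Vec d))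

/-- The experimental-design term for safety. -/
def safetyTerm (ε δ : ℝ) : ℝ :=
  ⨆ e : {e : ℝ // ε ≤ e}, ⨅ lam : {lam : 𝒳 → ℝ // IsDesign 𝒳 lam}, ⨆ z : 𝒵,
    invNormSq 𝒳 lam z * Real.log (2 * m * 𝒵.card / δ) /
      (minAbsSafety μ γ z + maxUnsafety μ γ z + ppEpsGap 𝒵 θ μ γ e z + e) ^ 2

/-- The experimental-design term for optimality. -/
def optimalityTerm (zstar : Vec d) (ε δ : ℝ) : ℝ :=
  ⨆ e : {e : ℝ // ε ≤ e}, ⨅ lam : {lam : 𝒳 → ℝ // IsDesign 𝒳 lam}, ⨆ z : 𝒵,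
    invNormSq 𝒳 lam (z - zstar) * Real.log (2 * 𝒵.card / δ) /
      (maxUnsafety μ γ z + ppEpsGap 𝒵 θ μ γ e z + e) ^ 2

end Gaps

/-! ### Catoni's estimator -/

/-- Catoni's influence function. -/
def psi (y : ℝ) : ℝ :=
  if 0 ≤ y then Real.log (1 + y + y ^ 2 / 2) else -Real.log (1 - y + y ^ 2 / 2)

/-- Catoni's estimator with parameter `α` of the mean of `X 0, …, X (T - 1)`: the root of
`z ↦ ∑ t < T, ψ (α (X t - z))`, which is unique when `0 < α` and `0 < T`. -/
def catoni (α : ℝ) (T : ℕ) (X : ℕ → ℝ) : ℝ :=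
  sSup {z : ℝ | ∑ t ∈ Finset.range T, psi (α * (X t - z)) = 0}

/-! ### Solutions of the optimization problems that the algorithm solves -/

section Solver

variable {d : ℕ} (𝒳 𝒵 : Finset (Vec d))

/-- The value at `λ` of the design objective
`max_{z ∈ S} - b(z) + √(s ‖v_z‖²_{A(λ)⁻¹})` is at most `thr`. -/
def Feasible (S : Finset 𝒵) (v : 𝒵 → Vec d) (s thr : ℝ) (b : 𝒵 → ℝ) (lam : 𝒳 → ℝ) : Prop :=
  IsDesign 𝒳 lam ∧ ∀ z ∈ S, -b z + √(s * invNormSq 𝒳 lam (v z)) ≤ thr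

/-- `max_{y ∈ 𝒴} |θᵀ y - W_y| / ‖y‖_{A(λ)⁻¹}`; the vector `y = 0` contributes `0`. -/
def fitError (𝒴 : Finset (Vec d)) (lam : 𝒳 → ℝ) (W : 𝒴 → ℝ) (θ : Vec d) : ℝ :=
  ⨆ y : 𝒴, |inner ℝ θ (y : Vec d) - W y| / √(invNormSq 𝒳 lam y)

/-- A measurable rule that picks one solution of each optimization problem the algorithm meets
(solutions need not be unique, and the rule is arbitrary): designs, least-deviation fits,
maximizers over finite sets of arms, and starting arms. -/
structure Solver where
  /-- a design that achieves the threshold, whenever there is one -/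
  design : Finset 𝒵 → (𝒵 → Vec d) → ℝ → ℝ → (𝒵 → ℝ) → (𝒳 → ℝ)
  design_spec : ∀ S v s thr b, (∃ lam, Feasible 𝒳 𝒵 S v s thr b lam) →
    Feasible 𝒳 𝒵 S v s thr b (design S v s thr b)
  design_meas : ∀ S v s thr, Measurable (design S v s thr)
  /-- a minimizer of `fitError` -/
  fit : (𝒴 : Finset (Vec d)) → (𝒳 → ℝ) → (𝒴 → ℝ) → Vec d
  fit_spec : ∀ (𝒴 : Finset (Vec d)) lam W, IsDesign 𝒳 lam →
    ∀ θ, fitError 𝒳 𝒴 lam W (fit 𝒴 lam W) ≤ fitError 𝒳 𝒴 lam W θ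
  fit_meas : ∀ 𝒴 : Finset (Vec d), Measurable fun p : (𝒳 → ℝ) × (𝒴 → ℝ) => fit 𝒴 p.1 p.2
  /-- a maximizer of a function over a nonempty set of arms -/
  argmax : Finset 𝒵 → (𝒵 → ℝ) → 𝒵
  argmax_spec : ∀ Y f, Y.Nonempty → argmax Y f ∈ Y ∧ ∀ y ∈ Y, f y ≤ f (argmax Y f)
  argmax_meas : ∀ Y, Measurable (argmax Y)
  /-- an element of a nonempty set of arms -/
  start : Finset 𝒵 → 𝒵
  start_spec : ∀ Y, Y.Nonempty → start Y ∈ Y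

open Classical in
/-- The least `τ = 2^j ≥ 4 L` for which some design brings
`max_{z ∈ S} - b(z) + √(‖v_z‖²_{A(λ)⁻¹} L / τ)` down to `thr`. -/
def stageLen (S : Finset 𝒵) (v : 𝒵 → Vec d) (L thr : ℝ) (b : 𝒵 → ℝ) : ℕ :=
  sInf {τ : ℕ | (∃ j : ℕ, τ = 2 ^ j) ∧ 4 * L ≤ τ ∧
    ∃ lam, Feasible 𝒳 𝒵 S v (L / τ) thr b lam}

end Solver

/-! ### The algorithm -/

/-- The numerical constants of the algorithm. -/
structure Consts where
  ca : ℝ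
  cc : ℝ
  cf : ℝ
  cd : ℝ
  ce : ℝ
  cy : ℝ
  cg : ℝ
  c0 : ℝ
  ca_pos : 0 < ca
  cc_pos : 0 < cc
  cf_pos : 0 < cf
  cd_pos : 0 < cd
  ce_pos : 0 < ce
  cy_pos : 0 < cy
  cg_pos : 0 < cg
  c0_pos : 0 < c0

/-- An observation `(x_t, r_t, (s_{t,i})_i)`. -/
abbrev Sample {d : ℕ} (𝒳 : Finset (Vec d)) (m : ℕ) := 𝒳 × ℝ × (Fin m → ℝ)

/-- A block of `len` consecutive samples, the first one at time `start`, drawn from `law`. -/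
structure Stage {d : ℕ} (𝒳 : Finset (Vec d)) where
  start : ℕ
  len : ℕ
  law : 𝒳 → ℝ

/-- What has been sampled so far: the number of samples and the blocks they came in. -/
structure Trace {d : ℕ} (𝒳 : Finset (Vec d)) where
  time : ℕ
  stages : List (Stage 𝒳)

/-- Append a block. -/
def Trace.add {d : ℕ} {𝒳 : Finset (Vec d)} (tr : Trace 𝒳) (len : ℕ) (law : 𝒳 → ℝ) : Trace 𝒳 :=
  ⟨tr.time + len, tr.stages ++ [⟨tr.time, len, law⟩]⟩

section Algorithm

variable {d m : ℕ} {𝒳 𝒵 : Finset (Vec d)} (κ : Consts) (sol : Solver 𝒳 𝒵)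

/-- The robust inverse propensity score estimator on the `T` samples `(x t, r t)`, `t < T`, drawn
from the design `lam`, with active set `𝒴` and confidence `δ`. The variance of
`yᵀ A(λ)⁻¹ x_t r_t` enters Catoni's parameter through its upper bound `2 ‖y‖²_{A(λ)⁻¹}`. -/
def rips (𝒴 : Finset (Vec d)) (δ : ℝ) (lam : 𝒳 → ℝ) (T : ℕ) (x : ℕ → 𝒳) (r : ℕ → ℝ) : Vec d :=
  sol.fit 𝒴 lam fun y =>
    catoni (√(2 * Real.log (1 / (δ / (2 * 𝒴.card))) / (T * (2 * invNormSq 𝒳 lam y)))) T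
      fun t => invForm 𝒳 lam y (x t) * r t

/-- State of `RAGE^ε`: the samples so far, the current arm `ŷ_ℓ` and the gap estimates `Δ̂^ℓ`. -/
structure RageState {d : ℕ} (𝒳 𝒵 : Finset (Vec d)) where
  trace : Trace 𝒳
  yhat : 𝒵
  gap : 𝒵 → ℝ

open Classical in
/-- Epoch `ℓ` of `RAGE^ε` with active set `S`, optimal set `Y`, confidence `δ` and safety gap
estimates `sg`, reading its samples from the stream `data`. -/
def rageStep (S Y : Finset 𝒵) (δ : ℝ) (sg : 𝒵 → ℝ) (data : ℕ → Sample 𝒳 m) (ℓ : ℕ)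
    (st : RageState 𝒳 𝒵) : RageState 𝒳 𝒵 :=
  let eps : ℝ := 2 / κ.cf * (1 / 2) ^ ℓ
  let L : ℝ := Real.log (4 * (S.card : ℝ) ^ 2 * (ℓ : ℝ) ^ 2 / δ)
  let v : 𝒵 → Vec d := fun z => z - st.yhat
  let b : 𝒵 → ℝ := fun z => κ.ca * (pp (-sg z) + pp (st.gap z) + eps)
  let τ : ℕ := stageLen 𝒳 𝒵 S v L (κ.cc * eps) b
  let lam : 𝒳 → ℝ := sol.design S v (L / τ) (κ.cc * eps) b
  let W : Finset (Vec d) := Finset.image₂ (fun z z' : 𝒵 => (z : Vec d) - z') S S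
  let θhat : Vec d := rips sol W (δ / (2 * (ℓ : ℝ) ^ 2)) lam τ
    (fun t => (data (st.trace.time + t)).1) (fun t => (data (st.trace.time + t)).2.1)
  let width : 𝒵 → 𝒵 → ℝ := fun z z' => √(invNormSq 𝒳 lam (z - z') * L / τ)
  let yhat : 𝒵 := sol.argmax Y fun y => inner ℝ θhat (y : Vec d) - 8 * width y st.yhat
  { trace := st.trace.add τ lam
    yhat := yhat
    gap := fun z => inner ℝ θhat ((yhat : Vec d) - z) + width z yhat }

/-- `RAGE^ε` after `n` epochs. -/
def rageIter (S Y : Finset 𝒵) (δ : ℝ) (sg : 𝒵 → ℝ) (data : ℕ → Sample 𝒳 m) (tr : Trace 𝒳) :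
    ℕ → RageState 𝒳 𝒵
  | 0 => ⟨tr, sol.start Y, fun _ => 0⟩
  | n + 1 => rageStep κ sol S Y δ sg data (n + 1) (rageIter S Y δ sg data tr n)

open Classical in
/-- `RAGE^ε` with tolerance `ε`, started after `tr`: the samples at the end and the estimated gaps
to the best arm of `Y`. There is nothing to do when `Y` is empty. -/
def rage (S Y : Finset 𝒵) (ε δ : ℝ) (sg : 𝒵 → ℝ) (data : ℕ → Sample 𝒳 m) (tr : Trace 𝒳) :
    Trace 𝒳 × (𝒵 → ℝ) :=
  if Y.Nonempty then
    let st := rageIter κ sol S Y δ sg data tr ⌈Real.logb 2 (2 / (κ.cf * ε))⌉₊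
    (st.trace, st.gap)
  else (tr, fun _ => 0)

/-- State of `BESIDE`: the samples so far, the safety gap estimates `Δ̂_safe^{i,ℓ}`, the gap
estimates `Δ̂^ℓ` and the set `𝒴_ℓ` of arms guaranteed to be safe. -/
structure State {d : ℕ} (𝒳 𝒵 : Finset (Vec d)) (m : ℕ) where
  trace : Trace 𝒳
  safe : Fin m → 𝒵 → ℝ
  gap : 𝒵 → ℝ
  Y : Finset 𝒵

/-- `max_j 𝔭(-Δ̂_safe^j(z))`. -/
def State.unsafety (st : State 𝒳 𝒵 m) (z : 𝒵) : ℝ := ⨆ j, pp (-st.safe j z)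

/-- `min_j |Δ̂_safe^j(z)| + max_j 𝔭(-Δ̂_safe^j(z)) + 𝔭(Δ̂(z))`. -/
def State.level (st : State 𝒳 𝒵 m) (z : 𝒵) : ℝ :=
  (⨅ j, |st.safe j z|) + st.unsafety z + pp (st.gap z)

open Classical in
/-- Round `ℓ` of `BESIDE`. -/
def step (γ δ : ℝ) (data : ℕ → Sample 𝒳 m) (ℓ : ℕ) (st : State 𝒳 𝒵 m) : State 𝒳 𝒵 m :=
  let eps : ℝ := 2 / κ.c0 * (1 / 2) ^ ℓ
  let L : ℝ := Real.log (4 * m * 𝒵.card * (ℓ : ℝ) ^ 2 / δ)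
  let v : 𝒵 → Vec d := fun z => z
  let b : 𝒵 → ℝ := fun z => κ.cd * (st.level z + eps)
  let τ : ℕ := stageLen 𝒳 𝒵 Finset.univ v L (κ.ce * eps) b
  let lam : 𝒳 → ℝ := sol.design Finset.univ v (L / τ) (κ.ce * eps) b
  let μhat : Fin m → Vec d := fun i => rips sol 𝒵 (δ / (2 * m * (ℓ : ℝ) ^ 2)) lam τ
    (fun t => (data (st.trace.time + t)).1) (fun t => (data (st.trace.time + t)).2.2 i)
  let safe : Fin m → 𝒵 → ℝ := fun i z =>
    γ - inner ℝ (μhat i) (z : Vec d) + √(invNormSq 𝒳 lam z * L / τ)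
  let Y : Finset 𝒵 := (Finset.univ.filter fun z => ∀ i,
    κ.cy * (κ.cd * st.level z + (κ.cd + κ.ce) * eps) ≤ safe i z) ∪ st.Y
  let res := rage κ sol Finset.univ Y eps (δ / (4 * (ℓ : ℝ) ^ 2))
    (fun z => -⨆ j, pp (-safe j z)) data (st.trace.add τ lam)
  { trace := res.1, safe := safe, gap := res.2, Y := Y }

/-- `BESIDE` after `n` rounds. -/
def iter (γ δ : ℝ) (data : ℕ → Sample 𝒳 m) : ℕ → State 𝒳 𝒵 m
  | 0 => ⟨⟨0, []⟩, fun _ _ => 0, fun _ => 0, ∅⟩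
  | n + 1 => step κ sol γ δ data (n + 1) (iter γ δ data n)

open Classical in
/-- `BESIDE` with threshold `γ`, tolerance `ε` and confidence `δ`, run on a stream of samples of
which it reads only a finite initial part: all samples it collects and the arm it returns. -/
def beside (γ ε δ : ℝ) (data : ℕ → Sample 𝒳 m) : Trace 𝒳 × 𝒵 :=
  let st := iter κ sol γ δ data ⌈Real.logb 2 (2 / (κ.c0 * ε))⌉₊
  let Yend : Finset 𝒵 := Finset.univ.filter fun z => ∀ i,
    κ.cy * (κ.cd * st.level z + (κ.cd + κ.ce) * ε) - κ.cg * ε ≤ st.safe i z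
  let res := rage κ sol Yend Yend ε δ (fun z => -st.unsafety z) data st.trace
  (res.1, sol.argmax Yend fun z => -res.2 z)

end Algorithm

/-! ### Interaction with the environment -/

/-- The stream of observations `r_t = θᵀ x_t + w_t^θ`, `s_{t,i} = μ_iᵀ x_t + w_{t,i}^μ`. -/
def observations {d m : ℕ} {𝒳 : Finset (Vec d)} {Ω : Type*} (θ : Vec d) (μ : Fin m → Vec d)
    (arm : ℕ → Ω → 𝒳) (wθ : ℕ → Ω → ℝ) (wμ : ℕ → Ω → Fin m → ℝ) (ω : Ω) (t : ℕ) : Sample 𝒳 m :=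
  (arm t ω, inner ℝ θ (arm t ω : Vec d) + wθ t ω,
    fun i => inner ℝ (μ i) (arm t ω : Vec d) + wμ t ω i)

/-- The arms `arm t` are played by an algorithm that, on the observed stream `data`, draws its
samples in the blocks listed in `(alg data).stages`; `ℱ t` is what is known before the arm at time
`t` is drawn (the history and, possibly, further internal randomness). Within a block the arms are
drawn from its law. The noise at time `t` is independent of `ℱ t` and of the arm at time `t`, and
each of its coordinates is centered `1`-subGaussian. -/
structure IsRun {d m : ℕ} {𝒳 : Finset (Vec d)} {Ω : Type*} [mΩ : MeasurableSpace Ω]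
    (P : Measure Ω) (alg : (ℕ → Sample 𝒳 m) → Trace 𝒳) (θ : Vec d) (μ : Fin m → Vec d)
    (ℱ : Filtration ℕ mΩ) (arm : ℕ → Ω → 𝒳) (wθ : ℕ → Ω → ℝ) (wμ : ℕ → Ω → Fin m → ℝ) :
    Prop where
  arm_meas : ∀ t, Measurable[ℱ (t + 1)] (arm t)
  noise_meas : ∀ t, Measurable[ℱ (t + 1)] fun ω => (wθ t ω, wμ t ω)
  noise_indep : ∀ t, Indep (MeasurableSpace.comap (fun ω => (wθ t ω, wμ t ω)) inferInstance)
    (ℱ t ⊔ MeasurableSpace.comap (arm t) inferInstance) P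
  noise_subG_reward : ∀ t, HasSubgaussianMGF (wθ t) 1 P
  noise_subG_safety : ∀ t i, HasSubgaussianMGF (fun ω => wμ t ω i) 1 P
  arm_law : ∀ t a, ∀ᵐ ω ∂P, ∀ s ∈ (alg (observations θ μ arm wθ wμ ω)).stages,
    s.start ≤ t → t < s.start + s.len → (P⟦arm t ⁻¹' {a} | ℱ t⟧) ω = s.law a

end Beside

end

noncomputable section

namespace Beside

open scoped ENNReal

/-! ### Algebra of the design norm `‖·‖_{A(λ)⁻¹}` -/

section DesignAlgebra

variable {d : ℕ} {𝒳 : Finset (Vec d)} {lam : 𝒳 → ℝ}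

/-! The proof separates probability from analysis by means of one event, `AllAccurate`: every linear
estimate formed in a run is within eight confidence widths of its target. Correctness and sample
count are deterministic consequences of that event.

Probability. If `x` is drawn from `λ`, the weighted observation `yᵀ A(λ)⁻¹ x · r` is unbiased for
`θᵀ y` and has second moment at most `2 ‖y‖²`. Since `exp (ψ u) ≤ 1 + u + u² / 2`, these two moments
control the exponential moment of Catoni's sum (`sum_design_quadratic_le`,
`measure_sum_psi_nonneg_le`), and `T ≥ 4 l` samples give error `4 ‖y‖ √(l / T)` outside an event of
probability `2 exp (-l)`. Starts, lengths and laws of the blocks are random but decided by earlier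
data, so one may condition on them (`measure_stage_failure_le`). The confidences decay like `1 /
ℓ²`, and their sum costs at most twice the confidence input, which is `δ / 2`.

Analysis. Two nested inductions over dyadic scales `e` compare estimated with true quantities.
Inside `RAGE^ε` the design keeps all widths below a small multiple of unsafety + gap + `e`, so the
gaps to the best arm of `Y` are known up to a tenth of that sum (`RageSetup.guarantee_succ`). In the
outer loop the set `Y` contains only safe arms, yet it competes with every arm of safety margin at
least `e`: such an arm can be missing only if its safety was left poorly estimated, which happens
only because a known safe arm already beats it (`MainSetup.safeGuarantee`). So `bestGap` to `Y`
dominates the gap `Δ^e` of the theorem, although `Δ^e` refers to arms the learner may never certify.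
At the end, the candidate set contains `z_*` and only `ε`-safe arms (`MainSetup.endGuarantee`), and
minimizing the estimated gap over it is enough.

Sample count. The estimated slacks are bounded below by constant multiples of the denominators in
the theorem. Hence a near-optimal design for the theorem's term at the same scale is feasible for
the algorithm with `τ` of the order of that term (`stageLen_le`). There are `O(log² (1 / ε))`
blocks, and the `ℓ`-dependent logarithms cost one more factor `log (1 / ε)`, whence the exponent
`3`. -/

lemma dotProduct_eq_inner (u v : Vec d) : u.ofLp ⬝ᵥ v.ofLp = inner ℝ u v := by
  rw [EuclideanSpace.inner_eq_star_dotProduct, dotProduct_comm]; simp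

lemma covMat_mulVec (lam : 𝒳 → ℝ) (v : Fin d → ℝ) :
    (covMat 𝒳 lam).mulVec v = ∑ x : 𝒳, (lam x * ((x : Vec d).ofLp ⬝ᵥ v)) • (x : Vec d).ofLp := by
  rw [covMat, Matrix.sum_mulVec]
  refine Finset.sum_congr rfl fun x _ => ?_
  rw [Matrix.smul_mulVec, Matrix.vecMulVec_mulVec, op_smul_eq_smul, smul_smul]

lemma covMat_transpose (lam : 𝒳 → ℝ) : (covMat 𝒳 lam).transpose = covMat 𝒳 lam := by
  simp [covMat, Matrix.transpose_sum, Matrix.transpose_smul, Matrix.transpose_vecMulVec]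

lemma invForm_comm (lam : 𝒳 → ℝ) (u v : Vec d) : invForm 𝒳 lam u v = invForm 𝒳 lam v u := by
  rw [invForm, invForm, Matrix.dotProduct_mulVec, ← Matrix.mulVec_transpose,
    Matrix.transpose_nonsing_inv, covMat_transpose, dotProduct_comm]

lemma invForm_sub_left (lam : 𝒳 → ℝ) (u v w : Vec d) :
    invForm 𝒳 lam (u - v) w = invForm 𝒳 lam u w - invForm 𝒳 lam v w := by
  simp [invForm, sub_dotProduct]

lemma invForm_neg_left (lam : 𝒳 → ℝ) (u w : Vec d) :
    invForm 𝒳 lam (-u) w = - invForm 𝒳 lam u w := by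
  simp [invForm]

lemma invNormSq_neg (lam : 𝒳 → ℝ) (v : Vec d) : invNormSq 𝒳 lam (-v) = invNormSq 𝒳 lam v := by
  rw [invNormSq, invForm_neg_left, invForm_comm, invForm_neg_left, neg_neg, invNormSq]

lemma invNormSq_zero (lam : 𝒳 → ℝ) : invNormSq 𝒳 lam 0 = 0 := by
  simp [invNormSq, invForm]

lemma invNormSq_sub_comm (lam : 𝒳 → ℝ) (u v : Vec d) :
    invNormSq 𝒳 lam (u - v) = invNormSq 𝒳 lam (v - u) := by
  rw [← invNormSq_neg, neg_sub]

lemma IsDesign.nonneg (h : IsDesign 𝒳 lam) (x : 𝒳) : 0 ≤ lam x := h.1.1 x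

lemma IsDesign.sum_eq_one (h : IsDesign 𝒳 lam) : ∑ x, lam x = 1 := h.1.2

/-- Insert `A(λ)⁻¹ A(λ) = 1` between `y` and `θ` and expand `A(λ)` into rank-one terms. This is the
unbiasedness of inverse propensity scoring. -/
lemma IsDesign.sum_invForm_mul_inner (h : IsDesign 𝒳 lam) (y θ : Vec d) :
    ∑ x : 𝒳, lam x * (invForm 𝒳 lam y x * inner ℝ θ (x : Vec d)) = inner ℝ θ y := by
  have h1 : (covMat 𝒳 lam)⁻¹.mulVec ((covMat 𝒳 lam).mulVec θ.ofLp) = θ.ofLp := by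
    rw [Matrix.mulVec_mulVec, Matrix.nonsing_inv_mul _ h.2, Matrix.one_mulVec]
  rw [covMat_mulVec, Matrix.mulVec_sum] at h1
  have h2 : y.ofLp ⬝ᵥ θ.ofLp = inner ℝ θ y := by rw [dotProduct_eq_inner, real_inner_comm]
  rw [← h2, ← h1, dotProduct_sum]
  refine Finset.sum_congr rfl fun x _ => ?_
  rw [Matrix.mulVec_smul, dotProduct_smul, invForm, smul_eq_mul, dotProduct_eq_inner (x : Vec d),
    real_inner_comm]
  ring

/-- Unbiasedness applied to the parameter `A(λ)⁻¹ y`. It identifies the second moment of the weights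
with the design norm. -/
lemma IsDesign.sum_invForm_sq (h : IsDesign 𝒳 lam) (y : Vec d) :
    ∑ x : 𝒳, lam x * invForm 𝒳 lam y x ^ 2 = invNormSq 𝒳 lam y := by
  set A := covMat 𝒳 lam
  let θ : Vec d := WithLp.toLp 2 (A⁻¹.mulVec y.ofLp)
  have := h.sum_invForm_mul_inner y θ
  rw [invNormSq, invForm]
  have h2 : inner ℝ θ y = y.ofLp ⬝ᵥ A⁻¹.mulVec y.ofLp := by
    rw [real_inner_comm, ← dotProduct_eq_inner]
  rw [← h2, ← this]
  refine Finset.sum_congr rfl fun x _ => ?_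
  have h3 : inner ℝ θ (x : Vec d) = invForm 𝒳 lam y x := by
    rw [invForm_comm, invForm, real_inner_comm, ← dotProduct_eq_inner]
  rw [h3]; ring

lemma IsDesign.invNormSq_nonneg (h : IsDesign 𝒳 lam) (y : Vec d) : 0 ≤ invNormSq 𝒳 lam y := by
  rw [← h.sum_invForm_sq]
  exact Finset.sum_nonneg fun x _ => mul_nonneg (h.nonneg x) (sq_nonneg _)

lemma IsDesign.invNormSq_pos (h : IsDesign 𝒳 lam) {y : Vec d} (hy : y ≠ 0) :
    0 < invNormSq 𝒳 lam y := by
  refine lt_of_le_of_ne (h.invNormSq_nonneg y) fun h0 => hy ?_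
  rw [← h.sum_invForm_sq, eq_comm, Finset.sum_eq_zero_iff_of_nonneg
    fun x _ => mul_nonneg (h.nonneg x) (sq_nonneg _)] at h0
  have := h.sum_invForm_mul_inner y y
  rw [Finset.sum_eq_zero] at this
  · exact inner_self_eq_zero.1 this.symm
  · intro x hx
    rcases mul_eq_zero.1 (h0 x hx) with h1 | h1
    · simp [h1]
    · simp [pow_eq_zero_iff (two_ne_zero)] at h1; simp [h1]

lemma IsDesign.invNormSq_sub_le (h : IsDesign 𝒳 lam) (u v : Vec d) :
    invNormSq 𝒳 lam (u - v) ≤ 2 * invNormSq 𝒳 lam u + 2 * invNormSq 𝒳 lam v := by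
  rw [← h.sum_invForm_sq, ← h.sum_invForm_sq, ← h.sum_invForm_sq, Finset.mul_sum, Finset.mul_sum,
    ← Finset.sum_add_distrib]
  refine Finset.sum_le_sum fun x _ => ?_
  rw [invForm_sub_left]
  nlinarith [h.nonneg x, mul_nonneg (h.nonneg x)
    (sq_nonneg (invForm 𝒳 lam u x + invForm 𝒳 lam v x))]

/-- The map `u ↦ (√λ_x · uᵀ A(λ)⁻¹ x)_x` is linear and isometric into a Euclidean space, from which
the triangle inequality is inherited. -/
lemma IsDesign.sqrt_invNormSq_sub_le (h : IsDesign 𝒳 lam) (u v : Vec d) :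
    √(invNormSq 𝒳 lam (u - v)) ≤ √(invNormSq 𝒳 lam u) + √(invNormSq 𝒳 lam v) := by
  let F : Vec d → EuclideanSpace ℝ 𝒳 := fun u => WithLp.toLp 2 fun x => √(lam x) * invForm 𝒳 lam u x
  have hF : ∀ u, √(invNormSq 𝒳 lam u) = ‖F u‖ := by
    intro u
    rw [EuclideanSpace.norm_eq, ← h.sum_invForm_sq]
    congr 1
    refine Finset.sum_congr rfl fun x _ => ?_
    simp [F, mul_pow, Real.sq_sqrt (h.nonneg x)]
  have hs : F (u - v) = F u - F v := by
    ext x; simp [F, invForm_sub_left, mul_sub]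
  rw [hF, hF, hF, hs]
  exact norm_sub_le _ _

/-- The uniform design works: a vector in the kernel of `A(λ)` is orthogonal to every arm, hence to
their span. -/
lemma exists_isDesign (hX : Submodule.span ℝ (𝒳 : Set (Vec d)) = ⊤) (hne : 𝒳.Nonempty) :
    ∃ lam, IsDesign 𝒳 lam := by
  have hc : (0 : ℝ) < 𝒳.card := by exact_mod_cast hne.card_pos
  refine ⟨fun _ => 1 / 𝒳.card, ⟨fun x => by positivity, ?_⟩, ?_⟩
  · simp [hc.ne']
  · rw [← Matrix.isUnit_iff_isUnit_det, ← Matrix.mulVec_injective_iff_isUnit]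
    intro u v huv
    rw [← sub_eq_zero, ← Matrix.mulVec_sub] at huv
    set w : Fin d → ℝ := u - v
    have h1 : w ⬝ᵥ (covMat 𝒳 fun _ => 1 / (𝒳.card : ℝ)).mulVec w = 0 := by rw [huv]; simp
    rw [covMat_mulVec, dotProduct_sum] at h1
    have h2 : ∀ x ∈ (Finset.univ : Finset 𝒳), 0 ≤ w ⬝ᵥ
        (1 / (𝒳.card : ℝ) * ((x : Vec d).ofLp ⬝ᵥ w)) • (x : Vec d).ofLp := by
      intro x _
      rw [dotProduct_smul, smul_eq_mul, dotProduct_comm w]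
      have := mul_self_nonneg ((x : Vec d).ofLp ⬝ᵥ w)
      rw [mul_assoc]; positivity
    rw [Finset.sum_eq_zero_iff_of_nonneg h2] at h1
    let W : Vec d := WithLp.toLp 2 w
    have h3 : ∀ x ∈ 𝒳, inner ℝ x W = (0 : ℝ) := by
      intro x hx
      have := h1 ⟨x, hx⟩ (Finset.mem_univ _)
      rw [dotProduct_smul, smul_eq_mul, dotProduct_comm w, mul_assoc] at this
      rcases mul_eq_zero.1 this with h | h
      · exact absurd h (by positivity)
      · rw [← dotProduct_eq_inner]; exact mul_self_eq_zero.1 h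
    have h4 : W = 0 := by
      have h5 : ∀ z ∈ Submodule.span ℝ (𝒳 : Set (Vec d)), inner ℝ z W = (0 : ℝ) := by
        intro z hz
        induction hz using Submodule.span_induction with
        | mem x hx => exact h3 x hx
        | zero => simp
        | add x y _ _ hx hy => rw [inner_add_left, hx, hy, add_zero]
        | smul a x _ hx => rw [inner_smul_left, hx, mul_zero]
      exact inner_self_eq_zero.1 (h5 W (hX ▸ Submodule.mem_top))
    have h6 : w = 0 := congrArg WithLp.ofLp h4
    exact sub_eq_zero.1 h6

end DesignAlgebra

/-! ### Catoni's influence function and estimator -/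

section Catoni

lemma psi_of_nonneg {u : ℝ} (h : 0 ≤ u) : psi u = Real.log (1 + u + u ^ 2 / 2) := by
  simp [psi, h]

lemma psi_neg (u : ℝ) : psi (-u) = -psi u := by
  rcases lt_trichotomy u 0 with h | h | h
  · simp only [psi, Left.nonneg_neg_iff, h.le, h.not_ge, if_true, if_false]; ring_nf
  · simp [h, psi]
  · simp [psi, h.le, h.not_ge]

lemma psi_of_nonpos {u : ℝ} (h : u ≤ 0) : psi u = -Real.log (1 - u + u ^ 2 / 2) := by
  rw [← neg_neg u, psi_neg, psi_of_nonneg (by linarith)]; ring_nf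

lemma psi_strictMono : StrictMono psi := by
  have h1 : ∀ u v : ℝ, 0 ≤ u → u < v → psi u < psi v := by
    intro u v hu huv
    rw [psi_of_nonneg hu, psi_of_nonneg (hu.trans huv.le)]
    exact Real.log_lt_log (by positivity) (by nlinarith)
  intro u v huv
  rcases le_or_gt 0 u with hu | hu
  · exact h1 u v hu huv
  · rcases le_or_gt v 0 with hv | hv
    · have := h1 (-v) (-u) (by linarith) (by linarith)
      rw [psi_neg, psi_neg] at this; linarith
    · have h2 := h1 0 v le_rfl hv
      have h3 := h1 0 (-u) le_rfl (by linarith)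
      rw [psi_neg] at h3
      have h0 : psi 0 = 0 := by simp [psi]
      linarith

lemma psi_zero : psi 0 = 0 := by simp [psi]

lemma continuous_psi : Continuous psi := by
  unfold psi
  refine Continuous.if_le ?_ ?_ continuous_const continuous_id ?_
  · exact Continuous.log (by fun_prop) fun y => by nlinarith [sq_nonneg (y + 1)]
  · exact (Continuous.log (by fun_prop) fun y => by nlinarith [sq_nonneg (y - 1)]).neg
  · intro x hx; simp [← hx]

/-- For `u ≤ 0` the claim is that `(1 + u + u² / 2) (1 - u + u² / 2) = 1 + u⁴ / 4` is at least `1`.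
-/
lemma exp_psi_le (u : ℝ) : Real.exp (psi u) ≤ 1 + u + u ^ 2 / 2 := by
  rcases le_total 0 u with hu | hu
  · rw [psi_of_nonneg hu, Real.exp_log (by positivity)]
  · have h : 0 < 1 - u + u ^ 2 / 2 := by nlinarith [sq_nonneg u]
    rw [psi_of_nonpos hu, Real.exp_neg, Real.exp_log h, inv_le_iff_one_le_mul₀ h]
    nlinarith [sq_nonneg (u ^ 2)]

lemma catoniSum_strictAnti {α : ℝ} (hα : 0 < α) {T : ℕ} (hT : 0 < T) (X : ℕ → ℝ) :
    StrictAnti fun z => ∑ t ∈ Finset.range T, psi (α * (X t - z)) := by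
  intro z w hzw
  refine Finset.sum_lt_sum_of_nonempty ⟨0, by simpa using hT⟩ fun t _ => psi_strictMono ?_
  nlinarith

lemma exists_catoniSum_eq_zero {α : ℝ} (hα : 0 < α) (T : ℕ) (X : ℕ → ℝ) :
    ∃ z, ∑ t ∈ Finset.range T, psi (α * (X t - z)) = 0 := by
  have hcont : Continuous fun z => ∑ t ∈ Finset.range T, psi (α * (X t - z)) :=
    continuous_finsetSum _ fun t _ => continuous_psi.comp (by fun_prop)
  set B := ∑ t ∈ Finset.range T, |X t|
  have hB : ∀ t ∈ Finset.range T, |X t| ≤ B := fun t ht =>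
    Finset.single_le_sum (f := fun t => |X t|) (fun _ _ => abs_nonneg _) ht
  have h1 : ∑ t ∈ Finset.range T, psi (α * (X t - B)) ≤ 0 := by
    refine Finset.sum_nonpos fun t ht => ?_
    rw [← psi_zero]
    refine psi_strictMono.monotone ?_
    have := (le_abs_self _).trans (hB t ht)
    nlinarith
  have h2 : 0 ≤ ∑ t ∈ Finset.range T, psi (α * (X t - -B)) := by
    refine Finset.sum_nonneg fun t ht => ?_
    rw [← psi_zero]
    refine psi_strictMono.monotone ?_
    have := (neg_abs_le (X t)).trans' (neg_le_neg (hB t ht))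
    nlinarith
  obtain ⟨z, hz⟩ := mem_range_of_exists_le_of_exists_ge hcont ⟨B, h1⟩ ⟨-B, h2⟩
  exact ⟨z, hz⟩

lemma catoniSum_catoni {α : ℝ} (hα : 0 < α) {T : ℕ} (hT : 0 < T) (X : ℕ → ℝ) :
    ∑ t ∈ Finset.range T, psi (α * (X t - catoni α T X)) = 0 := by
  obtain ⟨z, hz⟩ := exists_catoniSum_eq_zero hα T X
  have : {z : ℝ | ∑ t ∈ Finset.range T, psi (α * (X t - z)) = 0} = {z} := by
    ext w
    simp only [Set.mem_ofPred_eq, Set.mem_singleton_iff]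
    refine ⟨fun hw => (catoniSum_strictAnti hα hT X).injective (hw.trans hz.symm), ?_⟩
    rintro rfl; exact hz
  rw [catoni, this, csSup_singleton, hz]

/-- Catoni's sum strictly decreases in its centre and vanishes at the estimate. Deviations of the
estimator thereby become sign conditions on a sum, which serves both the tail bound and
measurability. -/
lemma catoni_le_iff {α : ℝ} (hα : 0 < α) {T : ℕ} (hT : 0 < T) (X : ℕ → ℝ) (c : ℝ) :
    catoni α T X ≤ c ↔ ∑ t ∈ Finset.range T, psi (α * (X t - c)) ≤ 0 := by
  conv_rhs => rw [← catoniSum_catoni hα hT X]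
  exact ((catoniSum_strictAnti hα hT X).le_iff_ge).symm

lemma le_catoni_iff {α : ℝ} (hα : 0 < α) {T : ℕ} (hT : 0 < T) (X : ℕ → ℝ) (c : ℝ) :
    c ≤ catoni α T X ↔ 0 ≤ ∑ t ∈ Finset.range T, psi (α * (X t - c)) := by
  conv_rhs => rw [← catoniSum_catoni hα hT X]
  exact ((catoniSum_strictAnti hα hT X).le_iff_ge).symm

/-- Every centre is a root when the parameter is `0`, and the supremum of an unbounded set of reals
defaults to `0`. -/
lemma catoni_zero_left (T : ℕ) (X : ℕ → ℝ) : catoni 0 T X = 0 := by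
  simp [catoni, psi_zero]

lemma catoni_zero_length (α : ℝ) (X : ℕ → ℝ) : catoni α 0 X = 0 := by
  simp [catoni]

end Catoni

/-! ### First two moments of subgaussian noise -/

section Moments

variable {Ω : Type*} [MeasurableSpace Ω] {P : Measure Ω} [IsProbabilityMeasure P] {w : Ω → ℝ}

/-- The moment generating function gives `1 + t E[w] ≤ exp (t² / 2) ≤ 1 + t²` for `|t| ≤ 1`; a
nonzero mean violates this for small `t` of its own sign. -/
lemma integral_eq_zero_of_hasSubgaussianMGF (h : HasSubgaussianMGF w 1 P) : ∫ ω, w ω ∂P = 0 := by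
  have key : ∀ t : ℝ, |t| ≤ 1 → t * ∫ ω, w ω ∂P ≤ t ^ 2 := by
    intro t ht
    have ht2 : t ^ 2 ≤ 1 := by rwa [sq_le_one_iff_abs_le_one]
    have h1 : ∫ ω, (t * w ω + 1) ∂P ≤ mgf w P t :=
      integral_mono ((h.integrable.const_mul t).add (integrable_const 1))
        (h.integrable_exp_mul t) fun ω => Real.add_one_le_exp _
    rw [integral_add (h.integrable.const_mul t) (integrable_const 1), integral_const_mul] at h1
    have h2 := h.mgf_le t
    have h3 := (abs_le.1 (Real.abs_exp_sub_one_sub_id_le (x := (1 : NNReal) * t ^ 2 / 2) (by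
      rw [abs_of_nonneg (by positivity)]; simp; linarith))).2
    simp at h1 h2 h3
    nlinarith [sq_nonneg t]
  set c := ∫ ω, w ω ∂P
  by_contra hc
  -- With this choice `t * c = 2 (1 + |c|) t²`, which is larger than `t²` as soon as `c ≠ 0`.
  set t := c / (2 * (1 + |c|))
  have hd : 0 < 2 * (1 + |c|) := by positivity
  have ht : |t| ≤ 1 := by
    rw [abs_div, abs_of_pos hd, div_le_one hd]; linarith [abs_nonneg c]
  have h1 := key t ht
  have hct : c = t * (2 * (1 + |c|)) := by simp only [t]; field_simp
  have htne : 0 < t ^ 2 := by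
    refine sq_pos_of_ne_zero fun h0 => hc ?_
    rw [hct, h0, zero_mul]
  have h2 : t * c = t ^ 2 * (2 * (1 + |c|)) := by
    calc t * c = t * (t * (2 * (1 + |c|))) := by rw [← hct]
      _ = _ := by ring
  nlinarith [mul_nonneg htne.le (abs_nonneg c)]

omit [IsProbabilityMeasure P] in
lemma integrable_sq_of_hasSubgaussianMGF (h : HasSubgaussianMGF w 1 P) :
    Integrable (fun ω => w ω ^ 2) P := by
  have := (h.memLp 2).integrable_sq
  simpa using this

lemma two_add_sq_le_exp_add_exp_neg (x : ℝ) : 2 + x ^ 2 ≤ Real.exp x + Real.exp (-x) := by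
  have h := Real.cosh_eq x
  have h2 := Real.cosh_two_mul (x / 2)
  have h3 := Real.cosh_sq (x / 2)
  have h4 : (x / 2) ^ 2 ≤ Real.sinh (x / 2) ^ 2 := by
    rw [sq_le_sq]
    rcases le_total 0 (x / 2) with hx | hx
    · rw [abs_of_nonneg hx, abs_of_nonneg (Real.sinh_nonneg_iff.2 hx)]
      exact Real.self_le_sinh_iff.2 hx
    · rw [abs_of_nonpos hx, abs_of_nonpos (Real.sinh_nonpos_iff.2 hx)]
      exact neg_le_neg (Real.sinh_le_self_iff.2 hx)
  have h5 : 2 * (x / 2) = x := by ring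
  rw [h5] at h2
  nlinarith

/-- Integrate `2 + (t w)² ≤ exp (t w) + exp (-t w)`, bound the right side by `2 exp (t² / 2)`,
divide by `t²` and let `t` tend to `0`. -/
lemma integral_sq_le_one_of_hasSubgaussianMGF (h : HasSubgaussianMGF w 1 P) :
    ∫ ω, w ω ^ 2 ∂P ≤ 1 := by
  have key : ∀ t : ℝ, 0 < t → t ≤ 1 → ∫ ω, w ω ^ 2 ∂P ≤ 1 + t ^ 2 / 2 := by
    intro t ht ht1
    have hi := integrable_sq_of_hasSubgaussianMGF h
    have h1 : ∫ ω, (t ^ 2 * w ω ^ 2 + 2) ∂P ≤ ∫ ω, (Real.exp (t * w ω) + Real.exp (-t * w ω)) ∂P :=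
      integral_mono ((hi.const_mul _).add (integrable_const 2))
        ((h.integrable_exp_mul t).add (h.integrable_exp_mul (-t))) fun ω => by
          have := two_add_sq_le_exp_add_exp_neg (t * w ω)
          simp only [neg_mul]
          linarith [mul_pow t (w ω) 2]
    rw [integral_add (hi.const_mul _) (integrable_const 2), integral_const_mul,
      integral_add (h.integrable_exp_mul t) (h.integrable_exp_mul (-t))] at h1
    have h2 := h.mgf_le t
    have h2' := h.mgf_le (-t)
    simp only [mgf] at h2 h2'
    have h3 := (abs_le.1 (Real.abs_exp_sub_one_sub_id_le (x := (1 : NNReal) * t ^ 2 / 2) (by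
      rw [abs_of_nonneg (by positivity)]; simp; nlinarith))).2
    simp at h1 h2 h2' h3
    have h4 : t ^ 2 * ∫ ω, w ω ^ 2 ∂P ≤ t ^ 2 * (1 + t ^ 2 / 2) := by nlinarith
    exact le_of_mul_le_mul_left h4 (by positivity)
  refine le_of_forall_pos_le_add fun e he => ?_
  have := key (min 1 e) (by positivity) (min_le_left _ _)
  have h1 : min 1 e ≤ 1 := min_le_left _ _
  have h2 : min 1 e ≤ e := min_le_right _ _
  have h3 : 0 < min 1 e := by positivity
  nlinarith

end Moments

/-! ### Exponential moments of Catoni's sum along a block -/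

section Supermartingale

variable {Ω : Type*} {m₀ m₁ mΩ : MeasurableSpace Ω} {P : Measure Ω} [IsProbabilityMeasure P]

/-- Integrating out a centered noise variable of variance at most one. -/
lemma lintegral_quadratic_noise_le (hm₁ : m₁ ≤ mΩ) {w : Ω → ℝ}
    (hw : Measurable w) (hind : Indep (MeasurableSpace.comap w inferInstance) m₁ P)
    (hsub : HasSubgaussianMGF w 1 P) {G : Ω → ℝ≥0∞} {p q : Ω → ℝ}
    (hG : Measurable[m₁] G) (hp : Measurable[m₁] p) (hq : Measurable[m₁] q) :
    ∫⁻ ω, G ω * ENNReal.ofReal (1 + (p ω + q ω * w ω) + (p ω + q ω * w ω) ^ 2 / 2) ∂P ≤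
      ∫⁻ ω, G ω * ENNReal.ofReal (1 + p ω + p ω ^ 2 / 2 + q ω ^ 2 / 2) ∂P := by
  let f : Ω → ℝ≥0∞ × ℝ × ℝ := fun ω => (G ω, p ω, q ω)
  have hf₁ : Measurable[m₁] f := hG.prodMk (hp.prodMk hq)
  have hf : Measurable f := hf₁.mono hm₁ le_rfl
  have hfw : IndepFun f w P := by
    rw [IndepFun_iff_Indep]
    exact indep_of_indep_of_le_left hind.symm (measurable_iff_comap_le.1 hf₁)
  have hmap := (indepFun_iff_map_prod_eq_prod_map_map hf.aemeasurable hw.aemeasurable).1 hfw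
  let H : (ℝ≥0∞ × ℝ × ℝ) × ℝ → ℝ≥0∞ := fun x =>
    x.1.1 * ENNReal.ofReal (1 + (x.1.2.1 + x.1.2.2 * x.2) + (x.1.2.1 + x.1.2.2 * x.2) ^ 2 / 2)
  have hH : Measurable H := by fun_prop
  -- Independence makes the joint law a product, so the noise is integrated with the past frozen.
  have h1 : ∫⁻ ω, H (f ω, w ω) ∂P = ∫⁻ a, ∫⁻ r, H (a, r) ∂(P.map w) ∂(P.map f) := by
    have : IsProbabilityMeasure (P.map w) := Measure.isProbabilityMeasure_map hw.aemeasurable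
    rw [← lintegral_prod _ hH.aemeasurable, ← hmap, lintegral_map hH (hf.prodMk hw)]
  have h2 : ∀ a : ℝ≥0∞ × ℝ × ℝ, ∫⁻ r, H (a, r) ∂(P.map w) ≤
      a.1 * ENNReal.ofReal (1 + a.2.1 + a.2.1 ^ 2 / 2 + a.2.2 ^ 2 / 2) := by
    rintro ⟨g, a, b⟩
    simp only [H]
    rw [lintegral_const_mul _ (by fun_prop), lintegral_map (by fun_prop) hw]
    gcongr
    have hi := hsub.integrable
    have hi2 := integrable_sq_of_hasSubgaussianMGF hsub
    have hexp : ∀ ω, 1 + (a + b * w ω) + (a + b * w ω) ^ 2 / 2 =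
        (1 + a + a ^ 2 / 2) + (b + a * b) * w ω + b ^ 2 / 2 * w ω ^ 2 := fun ω => by ring
    simp only [hexp]
    rw [← ofReal_integral_eq_lintegral_ofReal]
    · refine ENNReal.ofReal_le_ofReal ?_
      rw [integral_add (f := fun ω => 1 + a + a ^ 2 / 2 + (b + a * b) * w ω)
          ((integrable_const _).add (hi.const_mul _)) (hi2.const_mul _),
        integral_add (integrable_const _) (hi.const_mul _), integral_const_mul,
        integral_const_mul, integral_eq_zero_of_hasSubgaussianMGF hsub]
      have := integral_sq_le_one_of_hasSubgaussianMGF hsub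
      simp only [integral_const, probReal_univ, one_smul]
      nlinarith [sq_nonneg b]
    · exact ((integrable_const _).add (hi.const_mul _)).add (hi2.const_mul _)
    · refine Filter.Eventually.of_forall fun ω => ?_
      simp only [← hexp, Pi.zero_apply]
      nlinarith [sq_nonneg (1 + (a + b * w ω))]
  calc _ = ∫⁻ ω, H (f ω, w ω) ∂P := rfl
    _ ≤ ∫⁻ a, a.1 * ENNReal.ofReal (1 + a.2.1 + a.2.1 ^ 2 / 2 + a.2.2 ^ 2 / 2) ∂(P.map f) := by
      rw [h1]; exact lintegral_mono h2
    _ = _ := by rw [lintegral_map (by fun_prop) hf]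

/-- The defining property of conditional probabilities, for nonnegative functions. -/
lemma setLIntegral_eq_lintegral_condProb (hm₁ : m₁ ≤ mΩ) {A : Set Ω}
    (hA : MeasurableSet A) {F : Ω → ℝ≥0∞} (hF : Measurable[m₁] F) :
    ∫⁻ ω in A, F ω ∂P = ∫⁻ ω, ENNReal.ofReal ((P⟦A | m₁⟧) ω) * F ω ∂P := by
  have hg : Measurable[m₁] fun ω => ENNReal.ofReal ((P⟦A | m₁⟧) ω) :=
    (stronglyMeasurable_condExp.measurable).ennreal_ofReal
  -- On `m₁` the conditional probability is the density of the measure restricted to `A`; an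
  -- identity of measures extends from sets to nonnegative functions.
  have hmeas : (P.restrict A).trim hm₁ =
      (P.trim hm₁).withDensity fun ω => ENNReal.ofReal ((P⟦A | m₁⟧) ω) := by
    refine @Measure.ext _ m₁ _ _ fun s hs => ?_
    have hs' := hm₁ s hs
    rw [trim_measurableSet_eq hm₁ hs, withDensity_apply _ hs, Measure.restrict_apply hs',
      setLIntegral_trim hm₁ hg hs, ← ofReal_integral_eq_lintegral_ofReal]
    · rw [setIntegral_condExp hm₁ ((integrable_const _).indicator hA) hs,
        integral_indicator_const _ hA]
      simp [Set.inter_comm, Measure.real, Measure.restrict_apply hA]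
    · exact integrable_condExp.integrableOn
    · exact ae_restrict_of_ae (condExp_nonneg (Filter.Eventually.of_forall fun ω =>
        Set.indicator_nonneg (fun _ _ => zero_le_one) ω))
  rw [← lintegral_trim hm₁ hF, hmeas, lintegral_withDensity_eq_lintegral_mul _ hg hF]
  exact lintegral_trim hm₁ (hg.mul hF)

variable {𝒳 : Type*} [Fintype 𝒳] [MeasurableSpace 𝒳] [DiscreteMeasurableSpace 𝒳]

/-- Given the past, the influence of an observation has bounded exponential moment. -/
lemma setLIntegral_exp_psi_step_le (hm₀₁ : m₀ ≤ m₁) (hm₁ : m₁ ≤ mΩ) {arm : Ω → 𝒳}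
    (harm₁ : Measurable[m₁] arm) {w : Ω → ℝ} (hw : Measurable w)
    (hind : Indep (MeasurableSpace.comap w inferInstance) m₁ P)
    (hsub : HasSubgaussianMGF w 1 P) {E : Set Ω} (hE : MeasurableSet[m₀] E)
    {lam : Ω → 𝒳 → ℝ} (hlam : ∀ a, ∀ᵐ ω ∂P, ω ∈ E → (P⟦arm ⁻¹' {a} | m₀⟧) ω = lam ω a)
    (hnn : ∀ ω ∈ E, ∀ a, 0 ≤ lam ω a)
    {p q : 𝒳 → Ω → ℝ} (hp : ∀ a, Measurable[m₀] (p a)) (hq : ∀ a, Measurable[m₀] (q a)) {r : ℝ}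
    (hr : ∀ ω ∈ E, ∑ a, lam ω a * (1 + p a ω + p a ω ^ 2 / 2 + q a ω ^ 2 / 2) ≤ r)
    {G : Ω → ℝ≥0∞} (hG : Measurable[m₀] G) :
    ∫⁻ ω in E, G ω * ENNReal.ofReal (Real.exp (psi (p (arm ω) ω + q (arm ω) ω * w ω))) ∂P ≤
      ENNReal.ofReal r * ∫⁻ ω in E, G ω ∂P := by
  have hm₀ : m₀ ≤ mΩ := hm₀₁.trans hm₁
  have harm : Measurable arm := harm₁.mono hm₁ le_rfl
  have hsel : ∀ f : 𝒳 → Ω → ℝ, (∀ a, Measurable[m₀] (f a)) →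
      Measurable[m₁] fun ω => f (arm ω) ω := by
    intro f hf
    have h1 : @Measurable (𝒳 × Ω) ℝ (@Prod.instMeasurableSpace _ _ _ m₁) _ fun x => f x.1 x.2 :=
      @measurable_from_prod_countable_right _ _ _ _ m₁ _ _ _ _
        fun a => (hf a).mono hm₀₁ le_rfl
    exact h1.comp (@Measurable.prodMk _ _ _ _ _ m₁ _ _ harm₁ (@measurable_id _ m₁))
  have hE' : MeasurableSet E := hm₀ _ hE
  have hGE : Measurable[m₀] (E.indicator G) := hG.indicator hE
  have hcpos : ∀ a ω, 0 ≤ 1 + p a ω + p a ω ^ 2 / 2 + q a ω ^ 2 / 2 := fun a ω => by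
    nlinarith [sq_nonneg (1 + p a ω), sq_nonneg (q a ω)]
  -- The quadratic bound on `exp ∘ ψ` leaves only the mean and variance of the noise. The
  -- coefficients evaluated at the drawn arm are `m₁`-measurable, hence independent of that noise.
  have step1 : ∫⁻ ω in E, G ω *
        ENNReal.ofReal (Real.exp (psi (p (arm ω) ω + q (arm ω) ω * w ω))) ∂P ≤
      ∫⁻ ω, E.indicator G ω * ENNReal.ofReal (1 + p (arm ω) ω + p (arm ω) ω ^ 2 / 2
        + q (arm ω) ω ^ 2 / 2) ∂P := by
    refine le_trans ?_ (lintegral_quadratic_noise_le hm₁ hw hind hsub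
      (hGE.mono hm₀₁ le_rfl) (hsel p hp) (hsel q hq))
    rw [← lintegral_indicator hE']
    refine lintegral_mono fun ω => ?_
    by_cases hω : ω ∈ E
    · simp only [Set.indicator_of_mem hω]
      gcongr
      exact exp_psi_le _
    · simp [Set.indicator_of_notMem hω]
  -- Once the arm is fixed the integrand is `m₀`-measurable, so the indicator of the arm can be
  -- replaced by its conditional probability.
  have step2 : ∫⁻ ω, E.indicator G ω * ENNReal.ofReal (1 + p (arm ω) ω + p (arm ω) ω ^ 2 / 2
        + q (arm ω) ω ^ 2 / 2) ∂P =
      ∑ a, ∫⁻ ω in arm ⁻¹' {a}, E.indicator G ω * ENNReal.ofReal (1 + p a ω + p a ω ^ 2 / 2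
        + q a ω ^ 2 / 2) ∂P := by
    have hset : ∀ a, MeasurableSet (arm ⁻¹' {a}) := fun a => harm (measurableSet_singleton a)
    have : ∀ ω, E.indicator G ω * ENNReal.ofReal (1 + p (arm ω) ω + p (arm ω) ω ^ 2 / 2
        + q (arm ω) ω ^ 2 / 2) = ∑ a, (arm ⁻¹' {a}).indicator (fun ω => E.indicator G ω *
          ENNReal.ofReal (1 + p a ω + p a ω ^ 2 / 2 + q a ω ^ 2 / 2)) ω := by
      intro ω
      rw [Finset.sum_eq_single (arm ω)]
      · simp
      · intro b _ hb
        rw [Set.indicator_of_notMem]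
        simpa using hb.symm
      · simp
    simp_rw [this]
    rw [lintegral_finsetSum']
    · exact Finset.sum_congr rfl fun a _ => lintegral_indicator (hset a) _
    · intro a _
      refine (Measurable.indicator ?_ (hset a)).aemeasurable
      exact (hGE.mono hm₀ le_rfl).mul (((((measurable_const.add ((hp a).mono hm₀ le_rfl)).add
        ((((hp a).mono hm₀ le_rfl).pow_const 2).div_const 2)).add
        ((((hq a).mono hm₀ le_rfl).pow_const 2).div_const 2))).ennreal_ofReal)
  have hFm : ∀ a, Measurable[m₀] fun ω => E.indicator G ω *
      ENNReal.ofReal (1 + p a ω + p a ω ^ 2 / 2 + q a ω ^ 2 / 2) := fun a =>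
    hGE.mul ((((measurable_const.add (hp a)).add (((hp a).pow_const 2).div_const 2)).add
        (((hq a).pow_const 2).div_const 2)).ennreal_ofReal)
  have step3 : ∀ a, ∫⁻ ω in arm ⁻¹' {a}, E.indicator G ω *
        ENNReal.ofReal (1 + p a ω + p a ω ^ 2 / 2 + q a ω ^ 2 / 2) ∂P =
      ∫⁻ ω in E, ENNReal.ofReal (lam ω a * (1 + p a ω + p a ω ^ 2 / 2 + q a ω ^ 2 / 2)) * G ω ∂P := by
    intro a
    rw [setLIntegral_eq_lintegral_condProb hm₀ (harm (measurableSet_singleton a)) (hFm a),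
      ← lintegral_indicator hE']
    refine lintegral_congr_ae ?_
    filter_upwards [hlam a] with ω hω
    by_cases h : ω ∈ E
    · simp only [Set.indicator_of_mem h]
      rw [hω h, ENNReal.ofReal_mul (hnn ω h a)]; ring
    · simp [Set.indicator_of_notMem h]
  refine step1.trans ?_
  rw [step2]
  simp_rw [step3]
  have hGm : Measurable G := hG.mono hm₀ le_rfl
  rw [← lintegral_const_mul _ hGm]
  -- No measurability of `lam` is assumed, so the sum and the integral are exchanged with the
  -- conditional probability in its place.
  calc ∑ a, ∫⁻ ω in E, ENNReal.ofReal
          (lam ω a * (1 + p a ω + p a ω ^ 2 / 2 + q a ω ^ 2 / 2)) * G ω ∂P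
      = ∑ a, ∫⁻ ω in E, ENNReal.ofReal ((P⟦arm ⁻¹' {a} | m₀⟧) ω *
          (1 + p a ω + p a ω ^ 2 / 2 + q a ω ^ 2 / 2)) * G ω ∂P := by
        refine Finset.sum_congr rfl fun a _ => setLIntegral_congr_fun_ae hE' ?_
        filter_upwards [hlam a] with ω hω h
        rw [hω h]
    _ = ∫⁻ ω in E, ∑ a, ENNReal.ofReal ((P⟦arm ⁻¹' {a} | m₀⟧) ω *
          (1 + p a ω + p a ω ^ 2 / 2 + q a ω ^ 2 / 2)) * G ω ∂P := by
        rw [lintegral_finsetSum']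
        intro a _
        refine Measurable.aemeasurable (Measurable.mono ?_ hm₀ le_rfl)
        exact ((stronglyMeasurable_condExp.measurable.mul (((measurable_const.add (hp a)).add
          (((hp a).pow_const 2).div_const 2)).add
          (((hq a).pow_const 2).div_const 2))).ennreal_ofReal).mul hG
    _ ≤ ∫⁻ ω in E, ENNReal.ofReal r * G ω ∂P := by
        refine setLIntegral_mono_ae' hE' ?_
        filter_upwards [ae_all_iff.2 hlam] with ω hω h
        rw [← Finset.sum_mul]
        gcongr
        rw [← ENNReal.ofReal_sum_of_nonneg]
        · refine ENNReal.ofReal_le_ofReal (le_trans (le_of_eq ?_) (hr ω h))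
          exact Finset.sum_congr rfl fun a _ => by rw [hω a h]
        · intro a _
          rw [hω a h]
          exact mul_nonneg (hnn ω h a) (hcpos a ω)

/-- Exponential tail bound for the sum of the influences of the observations in a block. -/
lemma measure_sum_psi_nonneg_le {ℱ : Filtration ℕ mΩ} {arm : ℕ → Ω → 𝒳} {w : ℕ → Ω → ℝ}
    (harm : ∀ t, Measurable[ℱ (t + 1)] (arm t)) (hw : ∀ t, Measurable[ℱ (t + 1)] (w t))
    (hind : ∀ t, Indep (MeasurableSpace.comap (w t) inferInstance)
      (ℱ t ⊔ MeasurableSpace.comap (arm t) inferInstance) P)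
    (hsub : ∀ t, HasSubgaussianMGF (w t) 1 P) {n T : ℕ} {E : Set Ω} (hE : MeasurableSet[ℱ n] E)
    {lam : Ω → 𝒳 → ℝ}
    (hlam : ∀ t, n ≤ t → t < n + T → ∀ a, ∀ᵐ ω ∂P, ω ∈ E →
      (P⟦arm t ⁻¹' {a} | ℱ t⟧) ω = lam ω a)
    (hnn : ∀ ω ∈ E, ∀ a, 0 ≤ lam ω a)
    {p q : 𝒳 → Ω → ℝ} (hp : ∀ a, Measurable[ℱ n] (p a)) (hq : ∀ a, Measurable[ℱ n] (q a)) {r : ℝ}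
    (hr : ∀ ω ∈ E, ∑ a, lam ω a * (1 + p a ω + p a ω ^ 2 / 2 + q a ω ^ 2 / 2) ≤ r) :
    P (E ∩ {ω | 0 ≤ ∑ t ∈ Finset.range T,
        psi (p (arm (n + t) ω) ω + q (arm (n + t) ω) ω * w (n + t) ω)}) ≤
      ENNReal.ofReal r ^ T * P E := by
  let F : ℕ → Ω → ℝ≥0∞ := fun t ω => ENNReal.ofReal
    (Real.exp (psi (p (arm (n + t) ω) ω + q (arm (n + t) ω) ω * w (n + t) ω)))
  have hsel : ∀ t, ∀ f : 𝒳 → Ω → ℝ, (∀ a, Measurable[ℱ n] (f a)) →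
      Measurable[ℱ (n + t + 1)] fun ω => f (arm (n + t) ω) ω := by
    intro t f hf
    have h1 : @Measurable (𝒳 × Ω) ℝ (@Prod.instMeasurableSpace _ _ _ (ℱ (n + t + 1))) _
        fun x => f x.1 x.2 :=
      @measurable_from_prod_countable_right _ _ _ _ (ℱ (n + t + 1)) _ _ _ _
        fun a => (hf a).mono (ℱ.mono (by omega)) le_rfl
    exact h1.comp (@Measurable.prodMk _ _ _ _ _ (ℱ (n + t + 1)) _ _ (harm (n + t))
      (@measurable_id _ (ℱ (n + t + 1))))
  have hFm : ∀ t, Measurable[ℱ (n + t + 1)] (F t) := fun t =>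
    (Real.measurable_exp.comp (continuous_psi.measurable.comp
      ((hsel t p hp).add ((hsel t q hq).mul (hw (n + t)))))).ennreal_ofReal
  have hprod : ∀ k, Measurable[ℱ (n + k)] fun ω => ∏ t ∈ Finset.range k, F t ω := by
    intro k
    refine Finset.measurable_fun_prod _ fun t ht => (hFm t).mono (ℱ.mono ?_) le_rfl
    have := Finset.mem_range.1 ht
    omega
  -- Each observation contributes at most a factor `r`. Peeling off the last one is legitimate
  -- because the earlier product and `E` are known before it.
  have key : ∀ k ≤ T, ∫⁻ ω in E, ∏ t ∈ Finset.range k, F t ω ∂P ≤ ENNReal.ofReal r ^ k * P E := by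
    intro k
    induction k with
    | zero => intro _; simp
    | succ k ih =>
      intro hk
      simp_rw [Finset.prod_range_succ]
      refine (setLIntegral_exp_psi_step_le
        (m₁ := ℱ (n + k) ⊔ MeasurableSpace.comap (arm (n + k)) inferInstance) le_sup_left
        (sup_le (ℱ.le _) ((harm (n + k)).mono (ℱ.le _) le_rfl).comap_le)
        ((comap_measurable _).mono le_sup_right le_rfl) ((hw (n + k)).mono (ℱ.le _) le_rfl) (hind (n + k))
        (hsub (n + k)) (ℱ.mono (by omega) _ hE) (hlam (n + k) (by omega) (by omega)) hnn
        (fun a => (hp a).mono (ℱ.mono (by omega)) le_rfl)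
        (fun a => (hq a).mono (ℱ.mono (by omega)) le_rfl) hr (hprod k)).trans ?_
      rw [pow_succ', mul_assoc]
      gcongr
      exact ih (by omega)
  have hE' : MeasurableSet E := ℱ.le n _ hE
  refine le_trans ?_ (key T le_rfl)
  have hPm : Measurable fun ω => ∏ t ∈ Finset.range T, F t ω := (hprod T).mono (ℱ.le _) le_rfl
  have hsub' : E ∩ {ω | 0 ≤ ∑ t ∈ Finset.range T,
        psi (p (arm (n + t) ω) ω + q (arm (n + t) ω) ω * w (n + t) ω)} ⊆
      {ω | 1 ≤ ∏ t ∈ Finset.range T, F t ω} ∩ E := by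
    rintro ω ⟨hω, h⟩
    refine ⟨?_, hω⟩
    change 1 ≤ ∏ t ∈ Finset.range T, F t ω
    rw [← ENNReal.ofReal_prod_of_nonneg fun _ _ => (Real.exp_pos _).le, ← Real.exp_sum]
    rw [← ENNReal.ofReal_one]
    exact ENNReal.ofReal_le_ofReal (Real.one_le_exp h)
  calc _ ≤ P ({ω | 1 ≤ ∏ t ∈ Finset.range T, F t ω} ∩ E) := measure_mono hsub'
    _ = (P.restrict E) {ω | 1 ≤ ∏ t ∈ Finset.range T, F t ω} :=
      (Measure.restrict_apply' hE').symm
    _ ≤ _ := by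
      have := mul_meas_ge_le_lintegral (μ := P.restrict E) hPm 1
      simpa using this

end Supermartingale

/-! ### Measurability in the design -/

section DesignMeasurability

variable {d : ℕ} {𝒳 : Finset (Vec d)}

lemma continuous_covMat : Continuous (covMat 𝒳) := by
  unfold covMat
  fun_prop

-- The inverse is `det⁻¹` times the adjugate, also for singular matrices, where both conventions
-- give `0`; each factor is measurable in the weights.
@[fun_prop]
lemma measurable_invForm (u v : Vec d) : Measurable fun lam => invForm 𝒳 lam u v := by
  have h1 : Measurable fun lam => ((covMat 𝒳 lam).det)⁻¹ :=
    (continuous_covMat.matrix_det.measurable).inv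
  have h2 : Continuous fun lam => u.ofLp ⬝ᵥ ((covMat 𝒳 lam).adjugate.mulVec v.ofLp) :=
    continuous_const.dotProduct (continuous_covMat.matrix_adjugate.matrix_mulVec continuous_const)
  convert! h1.mul h2.measurable using 1
  ext lam
  rw [invForm, Matrix.inv_def, Matrix.smul_mulVec, dotProduct_smul, Ring.inverse_eq_inv',
    smul_eq_mul]
  rfl

@[fun_prop]
lemma measurable_invNormSq (u : Vec d) : Measurable fun lam => invNormSq 𝒳 lam u :=
  measurable_invForm u u

lemma measurableSet_isDesign : MeasurableSet {lam : 𝒳 → ℝ | IsDesign 𝒳 lam} := by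
  have h1 : MeasurableSet (stdSimplex ℝ 𝒳) := (isClosed_stdSimplex ℝ 𝒳).measurableSet
  have h2 : MeasurableSet {lam : 𝒳 → ℝ | IsUnit (covMat 𝒳 lam).det} := by
    simp only [isUnit_iff_ne_zero]
    exact (continuous_covMat.matrix_det.measurable) (measurableSet_singleton (0 : ℝ)).compl
  exact h1.inter h2

end DesignMeasurability

/-! ### Accuracy of the estimator for one design -/

section Rips

variable {d : ℕ} {𝒳 𝒵 : Finset (Vec d)}

/-- Catoni's parameter in the estimator. -/
def catoniParam (lam : 𝒳 → ℝ) (l : ℝ) (T : ℕ) (y : Vec d) : ℝ :=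
  √(2 * l / (T * (2 * invNormSq 𝒳 lam y)))

/-- If Catoni's estimates are accurate then so is the fitted vector. -/
lemma abs_inner_rips_sub_le (sol : Solver 𝒳 𝒵) {𝒴 : Finset (Vec d)} {δ : ℝ} {lam : 𝒳 → ℝ}
    (hlam : IsDesign 𝒳 lam) {T : ℕ} {x : ℕ → 𝒳} {r : ℕ → ℝ} {θ : Vec d} {s : ℝ} (hs : 0 ≤ s)
    (hW : ∀ y ∈ 𝒴, y ≠ 0 → |catoni (catoniParam lam (Real.log (1 / (δ / (2 * 𝒴.card)))) T y) T
      (fun t => invForm 𝒳 lam y (x t) * r t) - inner ℝ θ y| ≤ 4 * √(invNormSq 𝒳 lam y) * s)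
    {y : Vec d} (hy : y ∈ 𝒴) :
    |inner ℝ (rips sol 𝒴 δ lam T x r) y - inner ℝ θ y| ≤ 8 * √(invNormSq 𝒳 lam y) * s := by
  rcases eq_or_ne y 0 with rfl | hy0
  · simp [invNormSq_zero]
  set W : 𝒴 → ℝ := fun y => catoni (catoniParam lam (Real.log (1 / (δ / (2 * 𝒴.card)))) T y) T
      (fun t => invForm 𝒳 lam y (x t) * r t) with hWdef
  have hrips : rips sol 𝒴 δ lam T x r = sol.fit 𝒴 lam W := rfl
  -- The true `θ` competes in the fit with error at most `4 s`. The fitted vector is thus within `4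
  -- s` of the Catoni values, which are within `4 s` of the truth.
  have hfit := sol.fit_spec 𝒴 lam W hlam θ
  have hle : fitError 𝒳 𝒴 lam W θ ≤ 4 * s := by
    have : Nonempty 𝒴 := ⟨⟨y, hy⟩⟩
    refine ciSup_le fun z => ?_
    rcases eq_or_ne (z : Vec d) 0 with hz | hz
    · rw [hz, invNormSq_zero]; simp; exact hs
    · have hp : 0 < √(invNormSq 𝒳 lam z) := Real.sqrt_pos.2 (hlam.invNormSq_pos hz)
      rw [div_le_iff₀ hp, abs_sub_comm]
      refine (hW z z.2 hz).trans (le_of_eq (by ring))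
  have h1 : |inner ℝ (sol.fit 𝒴 lam W) y - W ⟨y, hy⟩| / √(invNormSq 𝒳 lam y) ≤ 4 * s :=
    (le_ciSup (f := fun y : 𝒴 => |inner ℝ (sol.fit 𝒴 lam W) (y : Vec d) - W y| /
      √(invNormSq 𝒳 lam y)) (Finite.bddAbove_range _) ⟨y, hy⟩).trans (hfit.trans hle)
  have hp : 0 < √(invNormSq 𝒳 lam y) := Real.sqrt_pos.2 (hlam.invNormSq_pos hy0)
  rw [div_le_iff₀ hp] at h1
  have h2 := hW y hy hy0
  rw [hrips]
  calc _ = |(inner ℝ (sol.fit 𝒴 lam W) y - W ⟨y, hy⟩) + (W ⟨y, hy⟩ - inner ℝ θ y)| := by ring_nf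
    _ ≤ _ := abs_add_le _ _
    _ ≤ 4 * s * √(invNormSq 𝒳 lam y) + 4 * √(invNormSq 𝒳 lam y) * s := add_le_add h1 h2
    _ = _ := by ring

/-- The factor by which each observation multiplies the exponential moment. -/
lemma sum_design_quadratic_le {lam : 𝒳 → ℝ} (hlam : IsDesign 𝒳 lam) {θ y : Vec d} (hy : y ≠ 0)
    (hθ : ‖θ‖ ≤ 1) (hx : ∀ x ∈ 𝒳, ‖x‖ ≤ 1) {l : ℝ} (hl : 0 < l) {T : ℕ} (hT : 4 * l ≤ T) {α z : ℝ}
    (hα : α = catoniParam lam l T y)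
    (hz : z = inner ℝ θ y + 4 * √(invNormSq 𝒳 lam y) * √(l / T)) :
    ∑ a : 𝒳, lam a * (1 + α * (invForm 𝒳 lam y a * inner ℝ θ (a : Vec d) - z) +
      (α * (invForm 𝒳 lam y a * inner ℝ θ (a : Vec d) - z)) ^ 2 / 2 +
      (α * invForm 𝒳 lam y a) ^ 2 / 2) ≤ Real.exp (-(l / T)) := by
  have hT0 : (0 : ℝ) < T := by linarith
  set N := invNormSq 𝒳 lam y with hN
  have hN0 : 0 < N := hlam.invNormSq_pos hy
  set u := l / T with hu
  have hu0 : 0 < u := by positivity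
  have hu1 : u ≤ 1 / 4 := by rw [hu, div_le_iff₀ hT0]; linarith
  set M := inner ℝ θ y with hM
  have hα2 : α = √(u / N) := by
    rw [hα, catoniParam, hu, ← hN]; congr 1; field_simp
  have hαN : α ^ 2 * N = u := by
    rw [hα2, Real.sq_sqrt (by positivity)]; field_simp
  have hαη : α * (4 * √N * √u) = 4 * u := by
    rw [hα2, Real.sqrt_div hu0.le]
    have : √N ≠ 0 := (Real.sqrt_pos.2 hN0).ne'
    field_simp
    rw [Real.sq_sqrt hu0.le]
  have e0 := hlam.sum_eq_one
  have e1 := hlam.sum_invForm_mul_inner y θ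
  have e2 := hlam.sum_invForm_sq y
  have e3 : ∑ a : 𝒳, lam a * (invForm 𝒳 lam y a * inner ℝ θ (a : Vec d)) ^ 2 ≤ N := by
    rw [hN, ← e2]
    refine Finset.sum_le_sum fun a _ => ?_
    refine mul_le_mul_of_nonneg_left ?_ (hlam.nonneg a)
    have h1 : |inner ℝ θ (a : Vec d)| ≤ 1 := (abs_real_inner_le_norm _ _).trans
      (mul_le_one₀ hθ (norm_nonneg _) (hx a a.2))
    rw [mul_pow]
    have := (sq_le_one_iff_abs_le_one _).2 h1
    nlinarith [sq_nonneg (invForm 𝒳 lam y a)]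
  have expand : ∑ a : 𝒳, lam a * (1 + α * (invForm 𝒳 lam y a * inner ℝ θ (a : Vec d) - z) +
      (α * (invForm 𝒳 lam y a * inner ℝ θ (a : Vec d) - z)) ^ 2 / 2 +
      (α * invForm 𝒳 lam y a) ^ 2 / 2) =
      (1 - α * z + α ^ 2 * z ^ 2 / 2) * ∑ a, lam a + (α - α ^ 2 * z) *
        ∑ a : 𝒳, lam a * (invForm 𝒳 lam y a * inner ℝ θ (a : Vec d)) +
      α ^ 2 / 2 * (∑ a : 𝒳, lam a * (invForm 𝒳 lam y a * inner ℝ θ (a : Vec d)) ^ 2) +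
      α ^ 2 / 2 * ∑ a : 𝒳, lam a * invForm 𝒳 lam y a ^ 2 := by
    simp only [Finset.mul_sum, ← Finset.sum_add_distrib]
    exact Finset.sum_congr rfl fun a _ => by ring
  rw [expand, e0, e1, e2, ← hN, ← hM]
  set η := 4 * √N * √u with hη
  have h5 : α ^ 2 / 2 * (∑ a : 𝒳, lam a * (invForm 𝒳 lam y a * inner ℝ θ (a : Vec d)) ^ 2) ≤
      α ^ 2 / 2 * N := mul_le_mul_of_nonneg_left e3 (by positivity)
  -- Here `α² N = u` and `α η = 4 u`, so the sum is at most `1 - 4 u + u + 8 u² = 1 - 3 u + 8 u²`.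
  -- This is at most `1 - u` because `u ≤ 1 / 4`, which is the purpose of the requirement `T ≥ 4 l`.
  have h6 : (α * η) ^ 2 = 16 * u ^ 2 := by rw [hαη]; ring
  have h7 := Real.add_one_le_exp (-u)
  rw [hz]
  nlinarith [sq_nonneg (α * M)]

end Rips

/-! ### Tail bounds on a block of fixed start and length -/

section Block

variable {d : ℕ} {𝒳 𝒵 : Finset (Vec d)} {Ω : Type*} {mΩ : MeasurableSpace Ω} {P : Measure Ω}
  [IsProbabilityMeasure P]

/-- Design, parameter and centre are known at time `n`; each of the `T` observations then multiplies
the exponential moment by at most `exp (-l / T)`. -/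
lemma measure_catoni_upper_tail {ℱ : Filtration ℕ mΩ} {arm : ℕ → Ω → 𝒳} {w : ℕ → Ω → ℝ}
    (harm : ∀ t, Measurable[ℱ (t + 1)] (arm t)) (hw : ∀ t, Measurable[ℱ (t + 1)] (w t))
    (hind : ∀ t, Indep (MeasurableSpace.comap (w t) inferInstance)
      (ℱ t ⊔ MeasurableSpace.comap (arm t) inferInstance) P)
    (hsub : ∀ t, HasSubgaussianMGF (w t) 1 P) {n T : ℕ} {E : Set Ω} (hE : MeasurableSet[ℱ n] E)
    {lam : Ω → 𝒳 → ℝ} (hmeas : Measurable[ℱ n] lam)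
    (hlam : ∀ t, n ≤ t → t < n + T → ∀ a, ∀ᵐ ω ∂P, ω ∈ E →
      (P⟦arm t ⁻¹' {a} | ℱ t⟧) ω = lam ω a)
    (hdes : ∀ ω ∈ E, IsDesign 𝒳 (lam ω)) {θ y : Vec d} (hy : y ≠ 0) (hθ : ‖θ‖ ≤ 1)
    (hx : ∀ x ∈ 𝒳, ‖x‖ ≤ 1) {l : ℝ} (hl : 0 < l) (hT : 4 * l ≤ T) :
    P (E ∩ {ω | 0 ≤ ∑ t ∈ Finset.range T, psi (catoniParam (lam ω) l T y *
        (invForm 𝒳 (lam ω) y (arm (n + t) ω) * (inner ℝ θ (arm (n + t) ω : Vec d) + w (n + t) ω) -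
          (inner ℝ θ y + 4 * √(invNormSq 𝒳 (lam ω) y) * √(l / T))))}) ≤
      ENNReal.ofReal (Real.exp (-l)) * P E := by
  have hT0 : (0 : ℝ) < T := by linarith
  let α : Ω → ℝ := fun ω => catoniParam (lam ω) l T y
  let z : Ω → ℝ := fun ω => inner ℝ θ y + 4 * √(invNormSq 𝒳 (lam ω) y) * √(l / T)
  have hN : Measurable[ℱ n] fun ω => invNormSq 𝒳 (lam ω) y := (measurable_invNormSq y).comp hmeas
  have hα : Measurable[ℱ n] α := by
    refine Measurable.comp (g := fun N : ℝ => √(2 * l / (T * (2 * N)))) ?_ hN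
    fun_prop
  have hz : Measurable[ℱ n] z := by
    refine Measurable.comp (g := fun N : ℝ => inner ℝ θ y + 4 * √N * √(l / T)) ?_ hN
    fun_prop
  have hi : ∀ a : 𝒳, Measurable[ℱ n] fun ω => invForm 𝒳 (lam ω) y a := fun a =>
    (measurable_invForm y (a : Vec d)).comp hmeas
  have key := measure_sum_psi_nonneg_le (P := P) (E := E) (T := T) harm hw hind hsub hE hlam
    (fun ω hω => (hdes ω hω).nonneg)
    (p := fun a ω => α ω * (invForm 𝒳 (lam ω) y a * inner ℝ θ (a : Vec d) - z ω))
    (q := fun a ω => α ω * invForm 𝒳 (lam ω) y a)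
    (fun a => hα.mul (((hi a).mul_const _).sub hz)) (fun a => hα.mul (hi a))
    (r := Real.exp (-(l / T)))
    (fun ω hω => sum_design_quadratic_le (hdes ω hω) hy hθ hx hl hT rfl rfl)
  rw [← ENNReal.ofReal_pow (Real.exp_pos _).le, ← Real.exp_nat_mul] at key
  have h1 : (T : ℝ) * -(l / T) = -l := by field_simp
  rw [h1] at key
  refine le_trans (le_of_eq ?_) key
  congr 3
  ext ω
  refine iff_of_eq (congrArg (fun s => 0 ≤ s) (Finset.sum_congr rfl fun t _ => ?_))
  congr 1
  simp only [α, z]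
  ring

/-- On a block whose law is fixed at its start, Catoni's estimates are accurate. -/
lemma measure_block_failure_le {ℱ : Filtration ℕ mΩ} {arm : ℕ → Ω → 𝒳} {w : ℕ → Ω → ℝ}
    (harm : ∀ t, Measurable[ℱ (t + 1)] (arm t)) (hw : ∀ t, Measurable[ℱ (t + 1)] (w t))
    (hind : ∀ t, Indep (MeasurableSpace.comap (w t) inferInstance)
      (ℱ t ⊔ MeasurableSpace.comap (arm t) inferInstance) P)
    (hsub : ∀ t, HasSubgaussianMGF (w t) 1 P) {n T : ℕ} {E : Set Ω} (hE : MeasurableSet[ℱ n] E)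
    {lam : Ω → 𝒳 → ℝ} (hmeas : Measurable[ℱ n] lam)
    (hlam : ∀ t, n ≤ t → t < n + T → ∀ a, ∀ᵐ ω ∂P, ω ∈ E →
      (P⟦arm t ⁻¹' {a} | ℱ t⟧) ω = lam ω a)
    (hdes : ∀ ω ∈ E, IsDesign 𝒳 (lam ω)) {θ : Vec d} (hθ : ‖θ‖ ≤ 1)
    (hx : ∀ x ∈ 𝒳, ‖x‖ ≤ 1) (sol : Solver 𝒳 𝒵) {𝒴 : Finset (Vec d)} {δ : ℝ} (hδ : 0 < δ)
    (hδ1 : δ < 1) (hT : 4 * Real.log (1 / (δ / (2 * 𝒴.card))) ≤ T) :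
    P (E ∩ {ω | ¬ ∀ y ∈ 𝒴, |inner ℝ (rips sol 𝒴 δ (lam ω) T (fun t => arm (n + t) ω)
        (fun t => inner ℝ θ (arm (n + t) ω : Vec d) + w (n + t) ω)) y - inner ℝ θ y| ≤
          8 * √(invNormSq 𝒳 (lam ω) y) * √(Real.log (1 / (δ / (2 * 𝒴.card))) / T)}) ≤
      ENNReal.ofReal δ * P E := by
  rcases 𝒴.eq_empty_or_nonempty with rfl | hne
  · simp
  have hc : (1 : ℝ) ≤ 𝒴.card := by exact_mod_cast hne.card_pos
  set l := Real.log (1 / (δ / (2 * 𝒴.card))) with hl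
  have hδ' : 0 < δ / (2 * 𝒴.card) := by positivity
  have hl0 : 0 < l := by
    refine Real.log_pos ?_
    rw [lt_div_iff₀ hδ', one_mul, div_lt_one (by positivity)]
    linarith
  have hexp : Real.exp (-l) = δ / (2 * 𝒴.card) := by
    rw [hl, Real.exp_neg, Real.exp_log (by positivity), one_div, inv_inv]
  have hT0 : 0 < T := by
    have : (0 : ℝ) < T := by linarith
    exact_mod_cast this
  -- Since `ψ` is odd, a lower deviation for `y` is an upper deviation for `-y`. Each vector thus
  -- accounts for two events of relative probability `δ / (2 |𝒴|)`.
  let bad : Vec d → Set Ω := fun y => E ∩ {ω | 0 ≤ ∑ t ∈ Finset.range T,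
    psi (catoniParam (lam ω) l T y *
        (invForm 𝒳 (lam ω) y (arm (n + t) ω) * (inner ℝ θ (arm (n + t) ω : Vec d) + w (n + t) ω) -
          (inner ℝ θ y + 4 * √(invNormSq 𝒳 (lam ω) y) * √(l / T))))}
  have hbad : ∀ y, y ≠ 0 → P (bad y) ≤ ENNReal.ofReal (δ / (2 * 𝒴.card)) * P E := fun y hy => by
    rw [← hexp]
    exact measure_catoni_upper_tail harm hw hind hsub hE hmeas hlam hdes hy hθ hx hl0 hT
  have hcover : E ∩ {ω | ¬ ∀ y ∈ 𝒴, |inner ℝ (rips sol 𝒴 δ (lam ω) T (fun t => arm (n + t) ω)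
        (fun t => inner ℝ θ (arm (n + t) ω : Vec d) + w (n + t) ω)) y - inner ℝ θ y| ≤
          8 * √(invNormSq 𝒳 (lam ω) y) * √(l / T)} ⊆
      ⋃ y ∈ 𝒴.erase 0, (bad y ∪ bad (-y)) := by
    rintro ω ⟨hω, hω'⟩
    by_contra hnot
    simp only [Set.mem_iUnion, not_exists, Finset.mem_erase] at hnot
    refine hω' fun y hy => abs_inner_rips_sub_le sol (hdes ω hω) (Real.sqrt_nonneg _) ?_ hy
    intro y hy hy0
    have h1 := hnot y ⟨hy0, hy⟩
    rw [Set.mem_union, not_or] at h1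
    have hα : 0 < catoniParam (lam ω) l T y := by
      have := (hdes ω hω).invNormSq_pos hy0
      have hT0' : (0 : ℝ) < T := by exact_mod_cast hT0
      rw [catoniParam]; positivity
    rw [abs_le]
    constructor
    · have h2 : ¬ ω ∈ bad (-y) := h1.2
      by_contra hlt
      refine h2 ⟨hω, ?_⟩
      rw [← hl] at hlt
      have h3 : catoni (catoniParam (lam ω) l T y) T (fun t => invForm 𝒳 (lam ω) y
          (arm (n + t) ω) * (inner ℝ θ (arm (n + t) ω : Vec d) + w (n + t) ω)) ≤
          inner ℝ θ y - 4 * √(invNormSq 𝒳 (lam ω) y) * √(l / T) := by linarith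
      rw [catoni_le_iff hα hT0] at h3
      have h4 : catoniParam (lam ω) l T (-y) = catoniParam (lam ω) l T y := by
        simp [catoniParam, invNormSq_neg]
      rw [Set.mem_ofPred_eq, h4, invNormSq_neg, ← neg_nonpos, ← Finset.sum_neg_distrib]
      refine le_trans (le_of_eq (Finset.sum_congr rfl fun t _ => ?_)) h3
      rw [← psi_neg, invForm_neg_left, inner_neg_right]
      congr 1
      ring
    · have h2 : ¬ ω ∈ bad y := h1.1
      by_contra hlt
      refine h2 ⟨hω, ?_⟩
      rw [← hl] at hlt
      exact (le_catoni_iff hα hT0 _ _).1 (by linarith)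
  calc _ ≤ P (⋃ y ∈ 𝒴.erase 0, (bad y ∪ bad (-y))) := measure_mono hcover
    _ ≤ ∑ y ∈ 𝒴.erase 0, P (bad y ∪ bad (-y)) := measure_biUnion_finset_le _ _
    _ ≤ ∑ y ∈ 𝒴.erase 0, (ENNReal.ofReal (δ / 𝒴.card) * P E) := by
        refine Finset.sum_le_sum fun y hy => (measure_union_le _ _).trans ?_
        have hy0 := (Finset.mem_erase.1 hy).1
        refine (add_le_add (hbad y hy0) (hbad (-y) (neg_ne_zero.2 hy0))).trans (le_of_eq ?_)
        rw [← add_mul, ← ENNReal.ofReal_add hδ'.le hδ'.le]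
        congr 2
        field_simp
        ring
    _ ≤ ∑ y ∈ 𝒴, (ENNReal.ofReal (δ / 𝒴.card) * P E) :=
        Finset.sum_le_sum_of_subset (Finset.erase_subset _ _)
    _ = ENNReal.ofReal δ * P E := by
        rw [Finset.sum_const, nsmul_eq_mul, ← mul_assoc]
        congr 1
        rw [← ENNReal.ofReal_natCast, ← ENNReal.ofReal_mul (by positivity)]
        congr 1
        field_simp

end Block

/-! ### Blocks whose start, length and law depend on the data -/

section StageFailure

/-- `measurable_pi_lambda` with the σ-algebra found by unification. -/
lemma measurable_pi_of_forall {α ι : Type*} {m₁ : MeasurableSpace α} {β : ι → Type*}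
    {mβ : ∀ i, MeasurableSpace (β i)} {f : α → ∀ i, β i} (hf : ∀ i, Measurable fun a => f a i) :
    Measurable f := measurable_pi_lambda _ hf

variable {d m : ℕ} {𝒳 𝒵 : Finset (Vec d)} {Ω : Type*} {mΩ : MeasurableSpace Ω} {P : Measure Ω}
  [IsProbabilityMeasure P]

/-- Forget everything from time `n` on. -/
def truncate (s₀ : Sample 𝒳 m) (n : ℕ) (data : ℕ → Sample 𝒳 m) : ℕ → Sample 𝒳 m :=
  fun t => if t < n then data t else s₀

lemma truncate_of_lt {s₀ : Sample 𝒳 m} {n t : ℕ} (h : t < n) (data : ℕ → Sample 𝒳 m) :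
    truncate s₀ n data t = data t := if_pos h

variable {alg : (ℕ → Sample 𝒳 m) → Trace 𝒳} {θ : Vec d} {μ : Fin m → Vec d} {ℱ : Filtration ℕ mΩ}
  {arm : ℕ → Ω → 𝒳} {wθ : ℕ → Ω → ℝ} {wμ : ℕ → Ω → Fin m → ℝ}

omit [IsProbabilityMeasure P] in
lemma IsRun.measurable_observation (h : IsRun P alg θ μ ℱ arm wθ wμ) (t : ℕ) :
    Measurable[ℱ (t + 1)] fun ω => observations θ μ arm wθ wμ ω t := by
  have h1 := h.arm_meas t
  have h2 : Measurable[ℱ (t + 1)] (wθ t) := measurable_fst.comp (h.noise_meas t)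
  have h3 : Measurable[ℱ (t + 1)] (wμ t) := measurable_snd.comp (h.noise_meas t)
  have hin : ∀ v : Vec d, Measurable[ℱ (t + 1)] fun ω => inner ℝ v (arm t ω : Vec d) := fun v =>
    (measurable_of_countable fun a : 𝒳 => inner ℝ v (a : Vec d)).comp h1
  exact h1.prodMk (((hin θ).add h2).prodMk
    (measurable_pi_of_forall fun i => (hin (μ i)).add ((measurable_pi_apply i).comp h3)))

omit [IsProbabilityMeasure P] in
lemma IsRun.measurable_truncate (h : IsRun P alg θ μ ℱ arm wθ wμ) (s₀ : Sample 𝒳 m) (n : ℕ) :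
    Measurable[ℱ n] fun ω => truncate s₀ n (observations θ μ arm wθ wμ ω) := by
  refine measurable_pi_of_forall fun t => ?_
  by_cases ht : t < n
  · simp only [truncate, ht, if_true]
    exact (h.measurable_observation t).mono (ℱ.mono ht) le_rfl
  · simp only [truncate, ht, if_false]
    exact measurable_const

/-- A block whose start, length and law are determined by the data before it yields accurate
estimates, up to its confidence. -/
lemma IsRun.measure_stage_failure_le (h : IsRun P alg θ μ ℱ arm wθ wμ) {ϑ : Vec d} (hϑ : ‖ϑ‖ ≤ 1)
    (hx : ∀ x ∈ 𝒳, ‖x‖ ≤ 1) {w : ℕ → Ω → ℝ} {g : Sample 𝒳 m → ℝ}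
    (hg : ∀ ω t, g (observations θ μ arm wθ wμ ω t) = inner ℝ ϑ (arm t ω : Vec d) + w t ω)
    (hw : ∀ t, Measurable[ℱ (t + 1)] (w t))
    (hind : ∀ t, Indep (MeasurableSpace.comap (w t) inferInstance)
      (ℱ t ⊔ MeasurableSpace.comap (arm t) inferInstance) P)
    (hsub : ∀ t, HasSubgaussianMGF (w t) 1 P)
    {C : Set (ℕ → Sample 𝒳 m)} {σ τ : (ℕ → Sample 𝒳 m) → ℕ} {lam : (ℕ → Sample 𝒳 m) → 𝒳 → ℝ}
    (hC : MeasurableSet C) (hσ : Measurable σ) (hτ : Measurable τ) (hlam : Measurable lam)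
    (hcausal : ∀ data ∈ C, ∀ data', (∀ t < σ data, data t = data' t) →
      data' ∈ C ∧ σ data' = σ data ∧ τ data' = τ data ∧ lam data' = lam data)
    (hstage : ∀ data ∈ C, (⟨σ data, τ data, lam data⟩ : Stage 𝒳) ∈ (alg data).stages)
    (hdes : ∀ data ∈ C, IsDesign 𝒳 (lam data)) (sol : Solver 𝒳 𝒵) {𝒴 : Finset (Vec d)} {δ : ℝ}
    (hδ : 0 < δ) (hδ1 : δ < 1)
    (hlen : ∀ data ∈ C, 4 * Real.log (1 / (δ / (2 * 𝒴.card))) ≤ τ data) :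
    P {ω | observations θ μ arm wθ wμ ω ∈ C ∧ ¬ ∀ y ∈ 𝒴,
        |inner ℝ (rips sol 𝒴 δ (lam (observations θ μ arm wθ wμ ω))
          (τ (observations θ μ arm wθ wμ ω))
          (fun t => (observations θ μ arm wθ wμ ω (σ (observations θ μ arm wθ wμ ω) + t)).1)
          (fun t => g (observations θ μ arm wθ wμ ω (σ (observations θ μ arm wθ wμ ω) + t)))) y
          - inner ℝ ϑ y| ≤
        8 * √(invNormSq 𝒳 (lam (observations θ μ arm wθ wμ ω)) y) *
          √(Real.log (1 / (δ / (2 * 𝒴.card))) / τ (observations θ μ arm wθ wμ ω))} ≤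
      ENNReal.ofReal δ * P {ω | observations θ μ arm wθ wμ ω ∈ C} := by
  have hΩ : Nonempty Ω := nonempty_of_isProbabilityMeasure P
  obtain ⟨ω₀⟩ := hΩ
  set obs := observations θ μ arm wθ wμ with hobs
  let s₀ : Sample 𝒳 m := obs ω₀ 0
  -- Start and length are read off the truncated stream, which makes each of these events known at
  -- time `n`; causality shows that the full stream yields the same values.
  let E : ℕ × ℕ → Set Ω := fun nT => {ω | truncate s₀ nT.1 (obs ω) ∈ C ∧
    σ (truncate s₀ nT.1 (obs ω)) = nT.1 ∧ τ (truncate s₀ nT.1 (obs ω)) = nT.2}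
  have htr : ∀ n, Measurable[ℱ n] fun ω => truncate s₀ n (obs ω) := h.measurable_truncate s₀
  have hE : ∀ nT, MeasurableSet[ℱ nT.1] (E nT) := fun nT =>
    (htr nT.1) (hC.inter ((hσ (measurableSet_singleton nT.1)).inter
      (hτ (measurableSet_singleton nT.2))))
  have hback : ∀ nT, ∀ ω ∈ E nT, obs ω ∈ C ∧ σ (obs ω) = nT.1 ∧ τ (obs ω) = nT.2 ∧
      lam (obs ω) = lam (truncate s₀ nT.1 (obs ω)) := by
    rintro nT ω ⟨h1, h2, h3⟩
    obtain ⟨a1, a2, a3, a4⟩ := hcausal _ h1 (obs ω) fun t ht => truncate_of_lt (h2 ▸ ht) _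
    exact ⟨a1, a2.trans h2, a3.trans h3, a4⟩
  have hforw : ∀ ω, obs ω ∈ C → ω ∈ E (σ (obs ω), τ (obs ω)) := by
    intro ω hω
    obtain ⟨a1, a2, a3, -⟩ := hcausal _ hω (truncate s₀ (σ (obs ω)) (obs ω))
      fun t ht => (truncate_of_lt ht _).symm
    exact ⟨a1, a2, a3⟩
  -- The possible starts and lengths partition the event, so the bounds on the pieces add up to a
  -- bound relative to its probability.
  have hU : {ω | obs ω ∈ C} = ⋃ nT, E nT := by
    ext ω
    simp only [Set.mem_ofPred_eq, Set.mem_iUnion]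
    exact ⟨fun hω => ⟨_, hforw ω hω⟩, fun ⟨nT, hω⟩ => (hback nT ω hω).1⟩
  have hdisj : Pairwise (Function.onFun Disjoint E) := by
    intro a b hab
    refine Set.disjoint_left.2 fun ω ha hb => hab ?_
    have h1 := hback a ω ha
    have h2 := hback b ω hb
    exact Prod.ext (h1.2.1.symm.trans h2.2.1) (h1.2.2.1.symm.trans h2.2.2.1)
  rw [hU, measure_iUnion hdisj fun nT => ℱ.le _ _ (hE nT), ← ENNReal.tsum_mul_left]
  let B : ℕ × ℕ → Set Ω := fun nT => {ω | ¬ ∀ y ∈ 𝒴, |inner ℝ (rips sol 𝒴 δ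
    (lam (truncate s₀ nT.1 (obs ω))) nT.2 (fun t => arm (nT.1 + t) ω)
        (fun t => inner ℝ ϑ (arm (nT.1 + t) ω : Vec d) + w (nT.1 + t) ω)) y - inner ℝ ϑ y| ≤
          8 * √(invNormSq 𝒳 (lam (truncate s₀ nT.1 (obs ω))) y) *
            √(Real.log (1 / (δ / (2 * 𝒴.card))) / nT.2)}
  refine (measure_mono (t := ⋃ nT, E nT ∩ B nT) ?_).trans
    ((measure_iUnion_le _).trans (ENNReal.tsum_le_tsum fun nT => ?_))
  · rintro ω ⟨hω, hbad⟩
    have hmem := hforw ω hω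
    obtain ⟨-, -, -, a4⟩ := hback _ ω hmem
    refine Set.mem_iUnion.2 ⟨_, hmem, ?_⟩
    simp only [B, Set.mem_ofPred_eq]
    rw [← a4]
    simp only [hg] at hbad
    exact hbad
  · rcases (E nT).eq_empty_or_nonempty with he | ⟨ω₁, hω₁⟩
    · simp [he]
    refine measure_block_failure_le h.arm_meas hw hind hsub (hE nT) (hlam.comp (htr nT.1)) ?_ ?_
      hϑ hx sol hδ hδ1 ?_
    · intro t h1 h2 a
      filter_upwards [h.arm_law t a] with ω hω hωE
      obtain ⟨b1, b2, b3, b4⟩ := hback nT ω hωE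
      have := hω _ (hstage _ b1) (b2.trans_le h1)
        (h2.trans_eq (by rw [← b2, ← b3]))
      rw [this]
      exact congrFun b4 a
    · exact fun ω hω => hdes _ hω.1
    · obtain ⟨b1, b2, b3, b4⟩ := hback nT ω₁ hω₁
      rw [← b3]
      exact hlen _ b1

end StageFailure

/-! ### Measurability of the building blocks -/

section Measurability

variable {α : Type*} [MeasurableSpace α]

/-- Random indices (lengths, current arms, active sets) take countably many values, so measurability
need only be checked with the index frozen. -/
lemma measurable_cases {β γ : Type*} [MeasurableSpace β] [MeasurableSpace γ] [Countable β]
    [MeasurableSingletonClass β] {c : α → β} (hc : Measurable c) {F : β → α → γ}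
    (hF : ∀ b, Measurable (F b)) : Measurable fun a => F (c a) a :=
  (measurable_from_prod_countable_right (f := fun x : β × α => F x.1 x.2) hF).comp
    (hc.prodMk measurable_id)

/-- Sublevel sets are given by the sign of Catoni's sum; nonpositive arguments are treated apart, as
the estimate degenerates to `0` there. -/
lemma measurable_catoni (T : ℕ) :
    Measurable fun p : ℝ × (ℕ → ℝ) => catoni (√p.1) T p.2 := by
  rcases Nat.eq_zero_or_pos T with rfl | hT
  · simp only [catoni_zero_length]; exact measurable_const
  refine measurable_of_Iic fun c => ?_
  have : (fun p : ℝ × (ℕ → ℝ) => catoni (√p.1) T p.2) ⁻¹' Set.Iic c =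
      {p | p.1 ≤ 0 ∧ 0 ≤ c} ∪
      {p | 0 < p.1 ∧ ∑ t ∈ Finset.range T, psi (√p.1 * (p.2 t - c)) ≤ 0} := by
    ext p
    simp only [Set.mem_preimage, Set.mem_Iic, Set.mem_union, Set.mem_ofPred_eq]
    rcases le_or_gt p.1 0 with hp | hp
    · rw [Real.sqrt_eq_zero_of_nonpos hp, catoni_zero_left]
      simp [hp, hp.not_gt]
    · rw [catoni_le_iff (Real.sqrt_pos.2 hp) hT]
      simp [hp, hp.not_ge]
  rw [this]
  have hs : Measurable fun p : ℝ × (ℕ → ℝ) => ∑ t ∈ Finset.range T, psi (√p.1 * (p.2 t - c)) :=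
    Finset.measurable_fun_sum _ fun t _ => continuous_psi.measurable.comp (by fun_prop)
  refine MeasurableSet.union ?_ ?_
  · exact (measurableSet_le measurable_fst measurable_const).inter (MeasurableSet.const _)
  · exact (measurableSet_lt measurable_const measurable_fst).inter
      (measurableSet_le hs measurable_const)

lemma measurable_catoni_sqrt {β : α → ℝ} {X : α → ℕ → ℝ} (hβ : Measurable β) (hX : Measurable X)
    (T : ℕ) : Measurable fun a => catoni (√(β a)) T (X a) := by
  have h := (measurable_catoni T).comp (hβ.prodMk hX)
  exact h

variable {d : ℕ} {𝒳 𝒵 : Finset (Vec d)}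

lemma measurable_rips (sol : Solver 𝒳 𝒵) (𝒴 : Finset (Vec d)) (δ : ℝ) {lam : α → 𝒳 → ℝ}
    {τ : α → ℕ} {x : α → ℕ → 𝒳} {r : α → ℕ → ℝ} (hlam : Measurable lam) (hτ : Measurable τ)
    (hx : Measurable x) (hr : Measurable r) :
    Measurable fun a => rips sol 𝒴 δ (lam a) (τ a) (x a) (r a) := by
  refine measurable_cases hτ (F := fun T a => rips sol 𝒴 δ (lam a) T (x a) (r a)) fun T => ?_
  let W : α → 𝒴 → ℝ := fun a y => catoni (√(2 * Real.log (1 / (δ / (2 * 𝒴.card))) /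
    (T * (2 * invNormSq 𝒳 (lam a) (y : Vec d))))) T
      fun t => invForm 𝒳 (lam a) (y : Vec d) (x a t) * r a t
  have hW : Measurable W := by
    refine measurable_pi_lambda _ fun y => ?_
    have hX : Measurable fun a => fun t => invForm 𝒳 (lam a) (y : Vec d) (x a t) * r a t := by
      refine measurable_pi_lambda _ fun t => Measurable.mul ?_ ((measurable_pi_apply t).comp hr)
      exact measurable_cases ((measurable_pi_apply t).comp hx)
        (F := fun b a => invForm 𝒳 (lam a) (y : Vec d) (b : 𝒳))
        fun b => (measurable_invForm _ _).comp hlam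
    have hN : Measurable fun a => invNormSq 𝒳 (lam a) (y : Vec d) :=
      (measurable_invNormSq _).comp hlam
    have hp : Measurable fun a => 2 * Real.log (1 / (δ / (2 * 𝒴.card))) /
      (T * (2 * invNormSq 𝒳 (lam a) (y : Vec d))) := by fun_prop
    exact measurable_catoni_sqrt hp hX T
  have hfit := (sol.fit_meas 𝒴).comp (hlam.prodMk hW)
  exact hfit

lemma measurableSet_feasible (S : Finset 𝒵) (v : 𝒵 → Vec d) (s thr : ℝ) {b : α → 𝒵 → ℝ}
    {lam : α → 𝒳 → ℝ} (hb : Measurable b) (hlam : Measurable lam) :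
    MeasurableSet {a | Feasible 𝒳 𝒵 S v s thr (b a) (lam a)} := by
  refine (hlam measurableSet_isDesign).inter ?_
  have : {a | ∀ z ∈ S, -b a z + √(s * invNormSq 𝒳 (lam a) (v z)) ≤ thr} =
      ⋂ z ∈ S, {a | -b a z + √(s * invNormSq 𝒳 (lam a) (v z)) ≤ thr} := by
    ext; simp
  refine MeasurableSet.congr ?_ this.symm
  refine Finset.measurableSet_biInter _ fun z _ => measurableSet_le ?_ measurable_const
  have hN : Measurable fun a => invNormSq 𝒳 (lam a) (v z) := (measurable_invNormSq _).comp hlam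
  have hbz : Measurable fun a => b a z := (measurable_pi_apply z).comp hb
  fun_prop

/-- Existence of a feasible design is an uncountable union, but it is equivalent to feasibility of
the solver's measurable choice. -/
lemma measurable_stageLen (sol : Solver 𝒳 𝒵) (S : Finset 𝒵) (v : 𝒵 → Vec d) (L thr : ℝ) :
    Measurable fun b => stageLen 𝒳 𝒵 S v L thr b := by
  let Q : ℕ → Set (𝒵 → ℝ) := fun τ => {b | (∃ j : ℕ, τ = 2 ^ j) ∧ 4 * L ≤ τ ∧
    ∃ lam, Feasible 𝒳 𝒵 S v (L / τ) thr b lam}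
  have hQ : ∀ τ, MeasurableSet (Q τ) := by
    intro τ
    have : {b : 𝒵 → ℝ | ∃ lam, Feasible 𝒳 𝒵 S v (L / τ) thr b lam} =
        {b | Feasible 𝒳 𝒵 S v (L / τ) thr b (sol.design S v (L / τ) thr b)} := by
      ext b
      exact ⟨fun h => sol.design_spec _ _ _ _ _ h, fun h => ⟨_, h⟩⟩
    refine (MeasurableSet.const _).inter ((MeasurableSet.const _).inter ?_)
    exact (measurableSet_feasible S v _ thr measurable_id (sol.design_meas S v _ thr)).congr
      this.symm
  refine measurable_of_Iic fun n => ?_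
  -- The first set on the right accounts for `sInf ∅ = 0`.
  have : (fun b => stageLen 𝒳 𝒵 S v L thr b) ⁻¹' Set.Iic n =
      (⋂ k, (Q k)ᶜ) ∪ ⋃ k ∈ Finset.range (n + 1), Q k := by
    ext b
    have hdef : stageLen 𝒳 𝒵 S v L thr b = sInf {τ : ℕ | b ∈ Q τ} := rfl
    simp only [Set.mem_preimage, Set.mem_Iic, Set.mem_union, Set.mem_iInter, Set.mem_compl_iff,
      Set.mem_iUnion, hdef, Finset.mem_range, exists_prop]
    rcases Set.eq_empty_or_nonempty {τ : ℕ | b ∈ Q τ} with he | hne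
    · rw [he]
      simp only [Nat.sInf_empty, zero_le, true_iff]
      refine Or.inl fun k hk => ?_
      have : k ∈ {τ : ℕ | b ∈ Q τ} := hk
      rw [he] at this
      exact this
    · constructor
      · intro hle
        exact Or.inr ⟨_, Nat.lt_succ_of_le hle, Nat.sInf_mem hne⟩
      · rintro (hk | ⟨k, hk, hk'⟩)
        · obtain ⟨k, hk'⟩ := hne
          exact absurd hk' (hk k)
        · exact (Nat.sInf_le hk').trans (Nat.lt_succ_iff.1 hk)
  rw [this]
  exact (MeasurableSet.iInter fun k => (hQ k).compl).union
    (Finset.measurableSet_biUnion _ fun k _ => hQ k)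

instance : MeasurableSpace (Finset 𝒵) := ⊤

instance : DiscreteMeasurableSpace (Finset 𝒵) := ⟨fun _ => trivial⟩

lemma measurable_filter {p : α → 𝒵 → Prop} [∀ a, DecidablePred (p a)] (hp : ∀ z, MeasurableSet {a | p a z}) :
    Measurable fun a => Finset.univ.filter (p a) := by
  refine measurable_to_countable' fun S => ?_
  have : (fun a => Finset.univ.filter (p a)) ⁻¹' {S} =
      ⋂ z, {a | p a z ↔ z ∈ S} := by
    ext a
    simp [Finset.ext_iff]
  rw [this]
  refine MeasurableSet.iInter fun z => ?_
  by_cases hz : z ∈ S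
  · simpa [hz] using hp z
  · simp only [hz, iff_false]
    exact (hp z).compl

lemma measurable_inner_right (z : Vec d) : Measurable fun v : Vec d => inner ℝ v z := by
  fun_prop

end Measurability

/-! ### Length of a block versus value of a design -/

section StageLen

variable {d : ℕ} {𝒳 𝒵 : Finset (Vec d)} {S : Finset 𝒵} {v : 𝒵 → Vec d} {L thr : ℝ} {b : 𝒵 → ℝ}

/-- `X` bounds the design value, the maximum of `‖v_z‖² L / (b_z + thr)²`; every length above it
meets the threshold. -/
lemma feasible_of_le {lam : 𝒳 → ℝ} (hlam : IsDesign 𝒳 lam) {X τ : ℝ} (hτ : 0 < τ) (hX : X ≤ τ)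
    (hpos : ∀ z ∈ S, 0 ≤ b z + thr)
    (h : ∀ z ∈ S, invNormSq 𝒳 lam (v z) * L ≤ X * (b z + thr) ^ 2) :
    Feasible 𝒳 𝒵 S v (L / τ) thr b lam := by
  refine ⟨hlam, fun z hz => ?_⟩
  have h1 : √(L / τ * invNormSq 𝒳 lam (v z)) ≤ b z + thr := by
    refine Real.sqrt_le_iff.2 ⟨hpos z hz, ?_⟩
    rw [div_mul_eq_mul_div, div_le_iff₀ hτ]
    nlinarith [h z hz, sq_nonneg (b z + thr), mul_le_mul_of_nonneg_right hX (sq_nonneg (b z + thr))]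
  linarith

lemma exists_pow_two_between {M : ℝ} (hM : 1 ≤ M) : ∃ j : ℕ, M ≤ 2 ^ j ∧ (2 : ℝ) ^ j ≤ 2 * M := by
  obtain ⟨n, hn, hn'⟩ := exists_nat_pow_near hM (by norm_num : (1 : ℝ) < 2)
  refine ⟨n + 1, hn'.le, ?_⟩
  rw [pow_succ]; linarith

/-- Some power of two lies between `max (4 L) X` and twice that number, and it is admissible. This
turns any comparison design into a sample bound. -/
lemma stageLen_le {lam : 𝒳 → ℝ} (hlam : IsDesign 𝒳 lam) {X : ℝ} (hX : 0 ≤ X) (hL : 1 ≤ 4 * L)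
    (hpos : ∀ z ∈ S, 0 ≤ b z + thr)
    (h : ∀ z ∈ S, invNormSq 𝒳 lam (v z) * L ≤ X * (b z + thr) ^ 2) :
    (stageLen 𝒳 𝒵 S v L thr b : ℝ) ≤ 8 * L + 2 * X := by
  obtain ⟨j, hj, hj'⟩ := exists_pow_two_between (hL.trans (le_max_left _ X))
  have hmem : stageLen 𝒳 𝒵 S v L thr b ≤ 2 ^ j := by
    refine Nat.sInf_le ⟨⟨j, rfl⟩, ?_, lam, ?_⟩
    · push_cast; exact (le_max_left _ _).trans hj
    · refine feasible_of_le hlam (by positivity) ?_ hpos h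
      push_cast; exact (le_max_right _ _).trans hj
  have : (stageLen 𝒳 𝒵 S v L thr b : ℝ) ≤ 2 ^ j := by exact_mod_cast hmem
  refine this.trans (hj'.trans ?_)
  have : max (4 * L) X ≤ 4 * L + X := max_le (by linarith) (by linarith)
  linarith

/-- Positivity of `b + thr` makes the value of any design finite. The set of admissible lengths is
then nonempty, so the infimum is attained and is not the default `0`. -/
lemma stageLen_spec (hd : ∃ lam, IsDesign 𝒳 lam) (hL : 0 ≤ L) (hpos : ∀ z ∈ S, 0 < b z + thr) :
    4 * L ≤ stageLen 𝒳 𝒵 S v L thr b ∧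
      ∃ lam, Feasible 𝒳 𝒵 S v (L / stageLen 𝒳 𝒵 S v L thr b) thr b lam := by
  have hne : {τ : ℕ | (∃ j : ℕ, τ = 2 ^ j) ∧ 4 * L ≤ τ ∧
      ∃ lam, Feasible 𝒳 𝒵 S v (L / τ) thr b lam}.Nonempty := by
    obtain ⟨lam, hlam⟩ := hd
    let X : ℝ := ∑ z ∈ S, invNormSq 𝒳 lam (v z) * L / (b z + thr) ^ 2
    have hterm : ∀ z ∈ S, 0 ≤ invNormSq 𝒳 lam (v z) * L / (b z + thr) ^ 2 := fun z _ =>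
      div_nonneg (mul_nonneg (hlam.invNormSq_nonneg _) hL) (sq_nonneg _)
    have hX : ∀ z ∈ S, invNormSq 𝒳 lam (v z) * L ≤ X * (b z + thr) ^ 2 := by
      intro z hz
      have := Finset.single_le_sum hterm hz
      rwa [div_le_iff₀ (pow_pos (hpos z hz) 2)] at this
    obtain ⟨j, hj, -⟩ := exists_pow_two_between (le_max_left 1 (max (4 * L) X))
    have h1 := (le_max_right 1 (max (4 * L) X)).trans hj
    refine ⟨2 ^ j, ⟨j, rfl⟩, ?_, lam, ?_⟩
    · push_cast; exact (le_max_left _ _).trans h1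
    · refine feasible_of_le hlam (by positivity) ?_ (fun z hz => (hpos z hz).le) hX
      push_cast; exact (le_max_right _ _).trans h1
  obtain ⟨-, h1, h2⟩ := Nat.sInf_mem hne
  exact ⟨h1, h2⟩

end StageLen

/-! ### Names for the intermediate quantities of the algorithm -/

section AlgorithmParts

variable {d m : ℕ} {𝒳 𝒵 : Finset (Vec d)} (κ : Consts) (sol : Solver 𝒳 𝒵)

/-- The scale `ε_ℓ` of epoch `ℓ` of `RAGE^ε`. -/
def rageEps (ℓ : ℕ) : ℝ := 2 / κ.cf * (1 / 2) ^ ℓ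

/-- The logarithmic factor of epoch `ℓ` of `RAGE^ε`. -/
def rageLog (S : Finset 𝒵) (δ : ℝ) (ℓ : ℕ) : ℝ :=
  Real.log (4 * (S.card : ℝ) ^ 2 * (ℓ : ℝ) ^ 2 / δ)

/-- The slack granted to each arm in epoch `ℓ` of `RAGE^ε`. -/
def rageSlack (sg : 𝒵 → ℝ) (ℓ : ℕ) (gap : 𝒵 → ℝ) (z : 𝒵) : ℝ :=
  κ.ca * (pp (-sg z) + pp (gap z) + rageEps κ ℓ)

/-- The number of samples of epoch `ℓ` of `RAGE^ε`. -/
def rageLen (𝒳 : Finset (Vec d)) (S : Finset 𝒵) (δ : ℝ) (sg : 𝒵 → ℝ) (ℓ : ℕ) (yhat : 𝒵)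
    (gap : 𝒵 → ℝ) : ℕ :=
  stageLen 𝒳 𝒵 S (fun z => z - yhat) (rageLog S δ ℓ) (κ.cc * rageEps κ ℓ) (rageSlack κ sg ℓ gap)

/-- The sampling law of epoch `ℓ` of `RAGE^ε`. -/
def rageLaw (S : Finset 𝒵) (δ : ℝ) (sg : 𝒵 → ℝ) (ℓ : ℕ) (yhat : 𝒵) (gap : 𝒵 → ℝ) : 𝒳 → ℝ :=
  sol.design S (fun z => z - yhat) (rageLog S δ ℓ / rageLen κ 𝒳 S δ sg ℓ yhat gap)
    (κ.cc * rageEps κ ℓ) (rageSlack κ sg ℓ gap)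

open Classical in
/-- The differences of the arms in `S`. -/
def diffs (S : Finset 𝒵) : Finset (Vec d) :=
  Finset.image₂ (fun z z' : 𝒵 => (z : Vec d) - z') S S

/-- The reward estimate of epoch `ℓ` of `RAGE^ε`. -/
def rageEst (S : Finset 𝒵) (δ : ℝ) (sg : 𝒵 → ℝ) (data : ℕ → Sample 𝒳 m) (ℓ t₀ : ℕ) (yhat : 𝒵)
    (gap : 𝒵 → ℝ) : Vec d :=
  rips sol (diffs S) (δ / (2 * (ℓ : ℝ) ^ 2)) (rageLaw κ sol S δ sg ℓ yhat gap)
    (rageLen κ 𝒳 S δ sg ℓ yhat gap) (fun t => (data (t₀ + t)).1) (fun t => (data (t₀ + t)).2.1)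

/-- The width of the confidence interval for the difference `u` in epoch `ℓ` of `RAGE^ε`. -/
def rageWidth (S : Finset 𝒵) (δ : ℝ) (sg : 𝒵 → ℝ) (ℓ : ℕ) (yhat : 𝒵) (gap : 𝒵 → ℝ) (u : Vec d) :
    ℝ :=
  √(invNormSq 𝒳 (rageLaw κ sol S δ sg ℓ yhat gap) u * rageLog S δ ℓ /
    rageLen κ 𝒳 S δ sg ℓ yhat gap)

/-- The empirically best arm of epoch `ℓ` of `RAGE^ε`. -/
def rageBest (S Y : Finset 𝒵) (δ : ℝ) (sg : 𝒵 → ℝ) (data : ℕ → Sample 𝒳 m) (ℓ t₀ : ℕ) (yhat : 𝒵)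
    (gap : 𝒵 → ℝ) : 𝒵 :=
  sol.argmax Y fun y => inner ℝ (rageEst κ sol S δ sg data ℓ t₀ yhat gap) (y : Vec d) -
    8 * rageWidth κ sol S δ sg ℓ yhat gap (y - yhat)

/-- The gap estimates of epoch `ℓ` of `RAGE^ε`. -/
def rageGap (S Y : Finset 𝒵) (δ : ℝ) (sg : 𝒵 → ℝ) (data : ℕ → Sample 𝒳 m) (ℓ t₀ : ℕ) (yhat : 𝒵)
    (gap : 𝒵 → ℝ) (z : 𝒵) : ℝ :=
  inner ℝ (rageEst κ sol S δ sg data ℓ t₀ yhat gap)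
      ((rageBest κ sol S Y δ sg data ℓ t₀ yhat gap : Vec d) - z) +
    rageWidth κ sol S δ sg ℓ yhat gap (z - rageBest κ sol S Y δ sg data ℓ t₀ yhat gap)

lemma rageStep_eq (S Y : Finset 𝒵) (δ : ℝ) (sg : 𝒵 → ℝ) (data : ℕ → Sample 𝒳 m) (ℓ : ℕ)
    (st : RageState 𝒳 𝒵) : rageStep κ sol S Y δ sg data ℓ st =
      { trace := st.trace.add (rageLen κ 𝒳 S δ sg ℓ st.yhat st.gap)
          (rageLaw κ sol S δ sg ℓ st.yhat st.gap)
        yhat := rageBest κ sol S Y δ sg data ℓ st.trace.time st.yhat st.gap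
        gap := rageGap κ sol S Y δ sg data ℓ st.trace.time st.yhat st.gap } := rfl

/-- The scale `ε_ℓ` of round `ℓ` of `BESIDE`. -/
def mainEps (ℓ : ℕ) : ℝ := 2 / κ.c0 * (1 / 2) ^ ℓ

/-- The logarithmic factor of round `ℓ` of `BESIDE`. -/
def mainLog (𝒵 : Finset (Vec d)) (m : ℕ) (δ : ℝ) (ℓ : ℕ) : ℝ :=
  Real.log (4 * m * 𝒵.card * (ℓ : ℝ) ^ 2 / δ)

/-- The slack granted to each arm in round `ℓ` of `BESIDE`. -/
def mainSlack (ℓ : ℕ) (level : 𝒵 → ℝ) (z : 𝒵) : ℝ := κ.cd * (level z + mainEps κ ℓ)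

/-- The number of samples devoted to safety in round `ℓ` of `BESIDE`. -/
def mainLen (𝒳 : Finset (Vec d)) (m : ℕ) (δ : ℝ) (ℓ : ℕ) (level : 𝒵 → ℝ) : ℕ :=
  stageLen 𝒳 𝒵 Finset.univ (fun z => z) (mainLog 𝒵 m δ ℓ) (κ.ce * mainEps κ ℓ) (mainSlack κ ℓ level)

/-- The sampling law of the safety samples of round `ℓ` of `BESIDE`. -/
def mainLaw (m : ℕ) (δ : ℝ) (ℓ : ℕ) (level : 𝒵 → ℝ) : 𝒳 → ℝ :=
  sol.design Finset.univ (fun z => z) (mainLog 𝒵 m δ ℓ / mainLen κ 𝒳 m δ ℓ level)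
    (κ.ce * mainEps κ ℓ) (mainSlack κ ℓ level)

/-- The estimate of the `i`-th safety parameter in round `ℓ` of `BESIDE`. -/
def mainEst (δ : ℝ) (data : ℕ → Sample 𝒳 m) (ℓ t₀ : ℕ) (level : 𝒵 → ℝ) (i : Fin m) : Vec d :=
  rips sol 𝒵 (δ / (2 * m * (ℓ : ℝ) ^ 2)) (mainLaw κ sol m δ ℓ level) (mainLen κ 𝒳 m δ ℓ level)
    (fun t => (data (t₀ + t)).1) (fun t => (data (t₀ + t)).2.2 i)

/-- The safety gap estimates of round `ℓ` of `BESIDE`. -/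
def mainSafe (γ δ : ℝ) (data : ℕ → Sample 𝒳 m) (ℓ t₀ : ℕ) (level : 𝒵 → ℝ) (i : Fin m) (z : 𝒵) :
    ℝ :=
  γ - inner ℝ (mainEst κ sol δ data ℓ t₀ level i) (z : Vec d) +
    √(invNormSq 𝒳 (mainLaw κ sol m δ ℓ level) z * mainLog 𝒵 m δ ℓ / mainLen κ 𝒳 m δ ℓ level)

open Classical in
/-- The arms found safe in round `ℓ` of `BESIDE`. -/
def mainSet (γ δ : ℝ) (data : ℕ → Sample 𝒳 m) (ℓ t₀ : ℕ) (level : 𝒵 → ℝ) : Finset 𝒵 :=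
  Finset.univ.filter fun z => ∀ i, κ.cy * (κ.cd * level z + (κ.cd + κ.ce) * mainEps κ ℓ) ≤
    mainSafe κ sol γ δ data ℓ t₀ level i z

/-- What round `ℓ` of `BESIDE` passes on to `RAGE^ε`: the samples so far, the safety gap estimates
and the set of arms guaranteed to be safe. -/
structure Context {d : ℕ} (𝒳 𝒵 : Finset (Vec d)) (m : ℕ) where
  trace : Trace 𝒳
  safe : Fin m → 𝒵 → ℝ
  Y : Finset 𝒵

open Classical in
/-- The context of the call of `RAGE^ε` in round `ℓ` of `BESIDE`. -/
def context (γ δ : ℝ) (data : ℕ → Sample 𝒳 m) (ℓ : ℕ) (st : State 𝒳 𝒵 m) : Context 𝒳 𝒵 m where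
  trace := st.trace.add (mainLen κ 𝒳 m δ ℓ st.level) (mainLaw κ sol m δ ℓ st.level)
  safe := mainSafe κ sol γ δ data ℓ st.trace.time st.level
  Y := mainSet κ sol γ δ data ℓ st.trace.time st.level ∪ st.Y

/-- `-max_j 𝔭(-Δ̂_safe^j)`. -/
def Context.sg (c : Context 𝒳 𝒵 m) (z : 𝒵) : ℝ := -⨆ j, pp (-c.safe j z)

/-- The call of `RAGE^ε` in round `ℓ` of `BESIDE`. -/
def innerRage (δ : ℝ) (data : ℕ → Sample 𝒳 m) (ℓ : ℕ) (c : Context 𝒳 𝒵 m) : Trace 𝒳 × (𝒵 → ℝ) :=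
  rage κ sol Finset.univ c.Y (mainEps κ ℓ) (δ / (4 * (ℓ : ℝ) ^ 2)) c.sg data c.trace

lemma step_eq (γ δ : ℝ) (data : ℕ → Sample 𝒳 m) (ℓ : ℕ) (st : State 𝒳 𝒵 m) :
    step κ sol γ δ data ℓ st =
      { trace := (innerRage κ sol δ data ℓ (context κ sol γ δ data ℓ st)).1
        safe := (context κ sol γ δ data ℓ st).safe
        gap := (innerRage κ sol δ data ℓ (context κ sol γ δ data ℓ st)).2
        Y := (context κ sol γ δ data ℓ st).Y } := rfl

open Classical in
/-- The set `𝒴_end`. -/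
def endSet (ε : ℝ) (st : State 𝒳 𝒵 m) : Finset 𝒵 :=
  Finset.univ.filter fun z => ∀ i,
    κ.cy * (κ.cd * st.level z + (κ.cd + κ.ce) * ε) - κ.cg * ε ≤ st.safe i z

/-- The number of rounds of `BESIDE`. -/
def rounds (ε : ℝ) : ℕ := ⌈Real.logb 2 (2 / (κ.c0 * ε))⌉₊

/-- The number of epochs of `RAGE^ε`. -/
def epochs (ε : ℝ) : ℕ := ⌈Real.logb 2 (2 / (κ.cf * ε))⌉₊

lemma rage_eq (S Y : Finset 𝒵) (ε δ : ℝ) (sg : 𝒵 → ℝ) (data : ℕ → Sample 𝒳 m) (tr : Trace 𝒳)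
    (hY : Y.Nonempty) : rage κ sol S Y ε δ sg data tr =
      ((rageIter κ sol S Y δ sg data tr (epochs κ ε)).trace,
        (rageIter κ sol S Y δ sg data tr (epochs κ ε)).gap) := by
  simp [rage, hY, epochs]

lemma rage_of_empty (S : Finset 𝒵) (ε δ : ℝ) (sg : 𝒵 → ℝ) (data : ℕ → Sample 𝒳 m)
    (tr : Trace 𝒳) : rage κ sol S ∅ ε δ sg data tr = (tr, fun _ => 0) := by
  simp [rage]

/-- The final call of `RAGE^ε`. -/
def endRage (ε δ : ℝ) (data : ℕ → Sample 𝒳 m) (st : State 𝒳 𝒵 m) : Trace 𝒳 × (𝒵 → ℝ) :=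
  rage κ sol (endSet κ ε st) (endSet κ ε st) ε δ (fun z => -st.unsafety z) data st.trace

lemma beside_eq (γ ε δ : ℝ) (data : ℕ → Sample 𝒳 m) : beside κ sol γ ε δ data =
    ((endRage κ sol ε δ data (iter κ sol γ δ data (rounds κ ε))).1,
      sol.argmax (endSet κ ε (iter κ sol γ δ data (rounds κ ε))) fun z =>
        -(endRage κ sol ε δ data (iter κ sol γ δ data (rounds κ ε))).2 z) := rfl

end AlgorithmParts

/-! ### States depend only on the data already read -/

section Causality

variable {d m : ℕ} {𝒳 𝒵 : Finset (Vec d)} {κ : Consts} {sol : Solver 𝒳 𝒵}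
  {data data' : ℕ → Sample 𝒳 m}

lemma catoni_congr {α : ℝ} {T : ℕ} {X X' : ℕ → ℝ} (h : ∀ t < T, X t = X' t) :
    catoni α T X = catoni α T X' := by
  unfold catoni
  congr 1
  ext z
  refine iff_of_eq (congrArg (fun s => s = 0) (Finset.sum_congr rfl fun t ht => ?_))
  rw [h t (Finset.mem_range.1 ht)]

lemma rips_congr {𝒴 : Finset (Vec d)} {δ : ℝ} {lam : 𝒳 → ℝ} {T : ℕ} {x x' : ℕ → 𝒳} {r r' : ℕ → ℝ}
    (h : ∀ t < T, x t = x' t ∧ r t = r' t) :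
    rips sol 𝒴 δ lam T x r = rips sol 𝒴 δ lam T x' r' := by
  unfold rips
  congr 1
  ext y
  exact catoni_congr fun t ht => by rw [(h t ht).1, (h t ht).2]

/-- Length and law come from the previous state, and the estimate reads only the epoch's own block,
which ends at the new time. -/
lemma rageStep_congr {S Y : Finset 𝒵} {δ : ℝ} {sg : 𝒵 → ℝ} {ℓ : ℕ} {st : RageState 𝒳 𝒵}
    (h : ∀ t < (rageStep κ sol S Y δ sg data ℓ st).trace.time, data t = data' t) :
    rageStep κ sol S Y δ sg data' ℓ st = rageStep κ sol S Y δ sg data ℓ st := by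
  have hest : rageEst κ sol S δ sg data' ℓ st.trace.time st.yhat st.gap =
      rageEst κ sol S δ sg data ℓ st.trace.time st.yhat st.gap := by
    refine rips_congr fun t ht => ?_
    have : data (st.trace.time + t) = data' (st.trace.time + t) := h _ (Nat.add_lt_add_left ht _)
    rw [this]
    exact ⟨rfl, rfl⟩
  rw [rageStep_eq, rageStep_eq]
  unfold rageGap rageBest
  rw [hest]

lemma rageIter_time_mono {S Y : Finset 𝒵} {δ : ℝ} {sg : 𝒵 → ℝ} {tr : Trace 𝒳} {k k' : ℕ}
    (h : k ≤ k') : (rageIter κ sol S Y δ sg data tr k).trace.time ≤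
      (rageIter κ sol S Y δ sg data tr k').trace.time := by
  induction h with
  | refl => rfl
  | step h ih => exact ih.trans (Nat.le_add_right _ _)

lemma rageIter_congr {S Y : Finset 𝒵} {δ : ℝ} {sg : 𝒵 → ℝ} {tr : Trace 𝒳} {k : ℕ}
    (h : ∀ t < (rageIter κ sol S Y δ sg data tr k).trace.time, data t = data' t) :
    rageIter κ sol S Y δ sg data' tr k = rageIter κ sol S Y δ sg data tr k := by
  induction k with
  | zero => rfl
  | succ k ih =>
    have h1 := ih fun t ht => h t (ht.trans_le (rageIter_time_mono (Nat.le_succ k)))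
    change rageStep κ sol S Y δ sg data' (k + 1) (rageIter κ sol S Y δ sg data' tr k) =
      rageStep κ sol S Y δ sg data (k + 1) (rageIter κ sol S Y δ sg data tr k)
    rw [h1]
    exact rageStep_congr h

lemma rage_time_mono {S Y : Finset 𝒵} {ε δ : ℝ} {sg : 𝒵 → ℝ} {tr : Trace 𝒳} :
    tr.time ≤ (rage κ sol S Y ε δ sg data tr).1.time := by
  rcases Y.eq_empty_or_nonempty with rfl | hY
  · rw [rage_of_empty]
  · rw [rage_eq _ _ _ _ _ _ _ _ _ hY]
    exact rageIter_time_mono (k := 0) (Nat.zero_le _)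

lemma rage_congr {S Y : Finset 𝒵} {ε δ : ℝ} {sg : 𝒵 → ℝ} {tr : Trace 𝒳}
    (h : ∀ t < (rage κ sol S Y ε δ sg data tr).1.time, data t = data' t) :
    rage κ sol S Y ε δ sg data' tr = rage κ sol S Y ε δ sg data tr := by
  rcases Y.eq_empty_or_nonempty with rfl | hY
  · rw [rage_of_empty, rage_of_empty]
  · rw [rage_eq _ _ _ _ _ _ _ _ _ hY] at h
    rw [rage_eq _ _ _ _ _ _ _ _ _ hY, rage_eq _ _ _ _ _ _ _ _ _ hY, rageIter_congr h]

lemma context_congr {γ δ : ℝ} {ℓ : ℕ} {st : State 𝒳 𝒵 m}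
    (h : ∀ t < (context κ sol γ δ data ℓ st).trace.time, data t = data' t) :
    context κ sol γ δ data' ℓ st = context κ sol γ δ data ℓ st := by
  have hest : mainEst κ sol δ data' ℓ st.trace.time st.level =
      mainEst κ sol δ data ℓ st.trace.time st.level := by
    funext i
    refine rips_congr fun t ht => ?_
    have : data (st.trace.time + t) = data' (st.trace.time + t) := h _ (Nat.add_lt_add_left ht _)
    rw [this]
    exact ⟨rfl, rfl⟩
  unfold context mainSet mainSafe
  rw [hest]

lemma context_time_le_step {γ δ : ℝ} {ℓ : ℕ} {st : State 𝒳 𝒵 m} :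
    (context κ sol γ δ data ℓ st).trace.time ≤ (step κ sol γ δ data ℓ st).trace.time := by
  rw [step_eq]
  exact rage_time_mono

lemma time_le_context {γ δ : ℝ} {ℓ : ℕ} {st : State 𝒳 𝒵 m} :
    st.trace.time ≤ (context κ sol γ δ data ℓ st).trace.time := Nat.le_add_right _ _

lemma step_congr {γ δ : ℝ} {ℓ : ℕ} {st : State 𝒳 𝒵 m}
    (h : ∀ t < (step κ sol γ δ data ℓ st).trace.time, data t = data' t) :
    step κ sol γ δ data' ℓ st = step κ sol γ δ data ℓ st := by
  have h1 := context_congr fun t ht => h t (ht.trans_le context_time_le_step)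
  have h2 : innerRage κ sol δ data' ℓ (context κ sol γ δ data ℓ st) =
      innerRage κ sol δ data ℓ (context κ sol γ δ data ℓ st) := rage_congr h
  rw [step_eq, step_eq, h1, h2]

lemma iter_time_mono {γ δ : ℝ} {n n' : ℕ} (h : n ≤ n') :
    (iter κ sol γ δ data n).trace.time ≤ (iter κ sol γ δ data n').trace.time := by
  induction h with
  | refl => rfl
  | step h ih => exact ih.trans (time_le_context.trans context_time_le_step)

/-- Supplies the causality hypothesis for the main blocks: altering the stream after the state's
time changes nothing. -/
lemma iter_congr {γ δ : ℝ} {n : ℕ}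
    (h : ∀ t < (iter κ sol γ δ data n).trace.time, data t = data' t) :
    iter κ sol γ δ data' n = iter κ sol γ δ data n := by
  induction n with
  | zero => rfl
  | succ n ih =>
    have h1 := ih fun t ht => h t (ht.trans_le (iter_time_mono (Nat.le_succ n)))
    change step κ sol γ δ data' (n + 1) (iter κ sol γ δ data' n) =
      step κ sol γ δ data (n + 1) (iter κ sol γ δ data n)
    rw [h1]
    exact step_congr h

end Causality

/-! ### Every block appears in the list of the complete run -/

section TraceMembership

variable {d m : ℕ} {𝒳 𝒵 : Finset (Vec d)} {κ : Consts} {sol : Solver 𝒳 𝒵}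
  {data : ℕ → Sample 𝒳 m}

lemma stages_subset_add (tr : Trace 𝒳) (len : ℕ) (law : 𝒳 → ℝ) :
    tr.stages ⊆ (tr.add len law).stages := List.subset_append_left _ _

lemma mem_stages_add (tr : Trace 𝒳) (len : ℕ) (law : 𝒳 → ℝ) :
    (⟨tr.time, len, law⟩ : Stage 𝒳) ∈ (tr.add len law).stages := by simp [Trace.add]

lemma rageIter_stages_mono {S Y : Finset 𝒵} {δ : ℝ} {sg : 𝒵 → ℝ} {tr : Trace 𝒳} {k k' : ℕ}
    (h : k ≤ k') : (rageIter κ sol S Y δ sg data tr k).trace.stages ⊆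
      (rageIter κ sol S Y δ sg data tr k').trace.stages := by
  induction h with
  | refl => exact List.Subset.refl _
  | step h ih => exact List.Subset.trans ih (stages_subset_add _ _ _)

/-- `IsRun` prescribes sampling laws only for blocks listed at the end of the run; blocks are never
removed, so each epoch's block is among them. -/
lemma rageIter_mem_stages {S Y : Finset 𝒵} {δ ε : ℝ} {sg : 𝒵 → ℝ} {tr : Trace 𝒳}
    (hY : Y.Nonempty) {k : ℕ} (hk : k < epochs κ ε) :
    (⟨(rageIter κ sol S Y δ sg data tr k).trace.time,
      rageLen κ 𝒳 S δ sg (k + 1) (rageIter κ sol S Y δ sg data tr k).yhat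
        (rageIter κ sol S Y δ sg data tr k).gap,
      rageLaw κ sol S δ sg (k + 1) (rageIter κ sol S Y δ sg data tr k).yhat
        (rageIter κ sol S Y δ sg data tr k).gap⟩ : Stage 𝒳) ∈
      (rage κ sol S Y ε δ sg data tr).1.stages := by
  rw [rage_eq _ _ _ _ _ _ _ _ _ hY]
  exact rageIter_stages_mono (Nat.succ_le_of_lt hk) (mem_stages_add _ _ _)

lemma rage_stages_subset {S Y : Finset 𝒵} {ε δ : ℝ} {sg : 𝒵 → ℝ} {tr : Trace 𝒳} :
    tr.stages ⊆ (rage κ sol S Y ε δ sg data tr).1.stages := by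
  rcases Y.eq_empty_or_nonempty with rfl | hY
  · rw [rage_of_empty]; exact List.Subset.refl _
  · rw [rage_eq _ _ _ _ _ _ _ _ _ hY]
    exact rageIter_stages_mono (k := 0) (Nat.zero_le _)

lemma iter_stages_mono {γ δ : ℝ} {n n' : ℕ} (h : n ≤ n') :
    (iter κ sol γ δ data n).trace.stages ⊆ (iter κ sol γ δ data n').trace.stages := by
  induction h with
  | refl => exact List.Subset.refl _
  | step h ih => exact List.Subset.trans (List.Subset.trans ih (stages_subset_add _ _ _)) rage_stages_subset

lemma iter_stages_subset_beside {γ ε δ : ℝ} {n : ℕ} (hn : n ≤ rounds κ ε) :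
    (iter κ sol γ δ data n).trace.stages ⊆ (beside κ sol γ ε δ data).1.stages :=
  List.Subset.trans (iter_stages_mono hn) rage_stages_subset

end TraceMembership

/-! ### Measurability of the algorithm's state -/

section AlgorithmMeasurability

variable {d m : ℕ} {𝒳 𝒵 : Finset (Vec d)} (κ : Consts) (sol : Solver 𝒳 𝒵)
  {α : Type*} [MeasurableSpace α]

lemma measurable_pp : Measurable pp := by unfold pp; fun_prop

lemma measurable_rageSlack {sg gap : α → 𝒵 → ℝ} (hsg : Measurable sg) (hgap : Measurable gap)
    (ℓ : ℕ) : Measurable fun a => rageSlack κ (sg a) ℓ (gap a) := by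
  refine measurable_pi_lambda _ fun z => ?_
  have h1 : Measurable fun a => pp (-sg a z) :=
    measurable_pp.comp ((measurable_pi_apply z).comp hsg).neg
  have h2 : Measurable fun a => pp (gap a z) := measurable_pp.comp ((measurable_pi_apply z).comp hgap)
  unfold rageSlack
  fun_prop

include sol in
lemma measurable_rageLen (S : Finset 𝒵) (δ : ℝ) {sg gap : α → 𝒵 → ℝ} {yhat : α → 𝒵}
    (hsg : Measurable sg) (hgap : Measurable gap) (hy : Measurable yhat) (ℓ : ℕ) :
    Measurable fun a => rageLen κ 𝒳 S δ (sg a) ℓ (yhat a) (gap a) :=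
  measurable_cases hy (F := fun y a => rageLen κ 𝒳 S δ (sg a) ℓ y (gap a)) fun y => by
    have h := (measurable_stageLen sol S (fun z => (z : Vec d) - y) (rageLog S δ ℓ)
      (κ.cc * rageEps κ ℓ)).comp (measurable_rageSlack κ hsg hgap ℓ)
    exact h

lemma measurable_rageLaw (S : Finset 𝒵) (δ : ℝ) {sg gap : α → 𝒵 → ℝ} {yhat : α → 𝒵}
    (hsg : Measurable sg) (hgap : Measurable gap) (hy : Measurable yhat) (ℓ : ℕ) :
    Measurable fun a => rageLaw κ sol S δ (sg a) ℓ (yhat a) (gap a) := by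
  refine measurable_cases hy (F := fun y a => rageLaw κ sol S δ (sg a) ℓ y (gap a)) fun y => ?_
  refine measurable_cases (measurable_rageLen κ sol S δ hsg hgap measurable_const ℓ (yhat := fun _ => y))
    (F := fun τ a => sol.design S (fun z => (z : Vec d) - y) (rageLog S δ ℓ / (τ : ℕ))
      (κ.cc * rageEps κ ℓ) (rageSlack κ (sg a) ℓ (gap a))) fun τ => ?_
  have h := (sol.design_meas S (fun z => (z : Vec d) - y) (rageLog S δ ℓ / (τ : ℕ))
    (κ.cc * rageEps κ ℓ)).comp (measurable_rageSlack κ hsg hgap ℓ)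
  exact h

lemma measurable_shift {β : Type*} [MeasurableSpace β] {data : α → ℕ → Sample 𝒳 m}
    (hdata : Measurable data) {t₀ : α → ℕ} (ht : Measurable t₀) {g : Sample 𝒳 m → β}
    (hg : Measurable g) : Measurable fun a => fun t => g (data a (t₀ a + t)) := by
  refine measurable_cases ht (F := fun n a => fun t => g (data a (n + t))) fun n => ?_
  exact measurable_pi_lambda _ fun t => hg.comp ((measurable_pi_apply (n + t)).comp hdata)

variable {data : α → ℕ → Sample 𝒳 m} (hdata : Measurable data)

include hdata

lemma measurable_rageEst (S : Finset 𝒵) (δ : ℝ) {sg gap : α → 𝒵 → ℝ} {yhat : α → 𝒵} {t₀ : α → ℕ}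
    (hsg : Measurable sg) (hgap : Measurable gap) (hy : Measurable yhat) (ht : Measurable t₀)
    (ℓ : ℕ) : Measurable fun a => rageEst κ sol S δ (sg a) (data a) ℓ (t₀ a) (yhat a) (gap a) :=
  measurable_rips sol _ _ (measurable_rageLaw κ sol S δ hsg hgap hy ℓ)
    (measurable_rageLen κ sol S δ hsg hgap hy ℓ)
    (measurable_shift hdata ht measurable_fst)
    (measurable_shift hdata ht (measurable_fst.comp measurable_snd))

omit hdata in
lemma measurable_rageWidth (S : Finset 𝒵) (δ : ℝ) {sg gap : α → 𝒵 → ℝ} {yhat : α → 𝒵}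
    (hsg : Measurable sg) (hgap : Measurable gap) (hy : Measurable yhat) (ℓ : ℕ) (u : Vec d) :
    Measurable fun a => rageWidth κ sol S δ (sg a) ℓ (yhat a) (gap a) u := by
  have h1 := measurable_rageLaw κ sol S δ hsg hgap hy ℓ
  have h2 : Measurable fun a => (rageLen κ 𝒳 S δ (sg a) ℓ (yhat a) (gap a) : ℝ) :=
    measurable_from_top.comp (measurable_rageLen κ sol S δ hsg hgap hy ℓ)
  have h3 := (measurable_invNormSq u).comp h1
  exact ((h3.mul_const _).div h2).sqrt

lemma measurable_rageBest (S Y : Finset 𝒵) (δ : ℝ) {sg gap : α → 𝒵 → ℝ} {yhat : α → 𝒵}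
    {t₀ : α → ℕ} (hsg : Measurable sg) (hgap : Measurable gap) (hy : Measurable yhat)
    (ht : Measurable t₀) (ℓ : ℕ) :
    Measurable fun a => rageBest κ sol S Y δ (sg a) (data a) ℓ (t₀ a) (yhat a) (gap a) := by
  refine (sol.argmax_meas Y).comp (measurable_pi_lambda _ fun y => ?_)
  have h1 := (measurable_inner_right (y : Vec d)).comp
    (measurable_rageEst κ sol hdata S δ hsg hgap hy ht ℓ)
  have h2 : Measurable fun a => rageWidth κ sol S δ (sg a) ℓ (yhat a) (gap a)
      ((y : Vec d) - yhat a) :=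
    measurable_cases hy (F := fun b a => rageWidth κ sol S δ (sg a) ℓ (yhat a) (gap a)
      ((y : Vec d) - b)) fun b => measurable_rageWidth κ sol S δ hsg hgap hy ℓ _
  exact h1.sub (h2.const_mul 8)

lemma measurable_rageGap (S Y : Finset 𝒵) (δ : ℝ) {sg gap : α → 𝒵 → ℝ} {yhat : α → 𝒵}
    {t₀ : α → ℕ} (hsg : Measurable sg) (hgap : Measurable gap) (hy : Measurable yhat)
    (ht : Measurable t₀) (ℓ : ℕ) :
    Measurable fun a => rageGap κ sol S Y δ (sg a) (data a) ℓ (t₀ a) (yhat a) (gap a) := by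
  refine measurable_pi_lambda _ fun z => ?_
  refine measurable_cases (measurable_rageBest κ sol hdata S Y δ hsg hgap hy ht ℓ)
    (F := fun b a => inner ℝ (rageEst κ sol S δ (sg a) (data a) ℓ (t₀ a) (yhat a) (gap a))
      ((b : Vec d) - z) + rageWidth κ sol S δ (sg a) ℓ (yhat a) (gap a) ((z : Vec d) - b))
    fun b => ?_
  exact ((measurable_inner_right _).comp (measurable_rageEst κ sol hdata S δ hsg hgap hy ht ℓ)).add
    (measurable_rageWidth κ sol S δ hsg hgap hy ℓ _)

/-- Of the trace only its time is tracked, because no computed quantity depends on the list of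
blocks. -/
lemma measurable_rageIter (S Y : Finset 𝒵) (δ : ℝ) {sg : α → 𝒵 → ℝ} (hsg : Measurable sg)
    {tr : α → Trace 𝒳} (htr : Measurable fun a => (tr a).time) (k : ℕ) :
    (Measurable fun a => (rageIter κ sol S Y δ (sg a) (data a) (tr a) k).trace.time) ∧
    (Measurable fun a => (rageIter κ sol S Y δ (sg a) (data a) (tr a) k).yhat) ∧
    Measurable fun a => (rageIter κ sol S Y δ (sg a) (data a) (tr a) k).gap := by
  induction k with
  | zero => exact ⟨htr, measurable_const, measurable_const⟩
  | succ k ih =>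
    obtain ⟨h1, h2, h3⟩ := ih
    exact ⟨h1.add (measurable_rageLen κ sol S δ hsg h3 h2 (k + 1)),
      measurable_rageBest κ sol hdata S Y δ hsg h3 h2 h1 (k + 1),
      measurable_rageGap κ sol hdata S Y δ hsg h3 h2 h1 (k + 1)⟩

lemma measurable_rage (S Y : Finset 𝒵) (ε δ : ℝ) {sg : α → 𝒵 → ℝ} (hsg : Measurable sg)
    {tr : α → Trace 𝒳} (htr : Measurable fun a => (tr a).time) :
    (Measurable fun a => (rage κ sol S Y ε δ (sg a) (data a) (tr a)).1.time) ∧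
    Measurable fun a => (rage κ sol S Y ε δ (sg a) (data a) (tr a)).2 := by
  rcases Y.eq_empty_or_nonempty with rfl | hY
  · simp only [rage_of_empty]
    exact ⟨htr, measurable_const⟩
  · simp only [rage_eq _ _ _ _ _ _ _ _ _ hY]
    obtain ⟨h1, -, h3⟩ := measurable_rageIter κ sol hdata S Y δ hsg htr (epochs κ ε)
    exact ⟨h1, h3⟩

omit hdata in
lemma measurable_level {st : α → State 𝒳 𝒵 m} (hs : Measurable fun a => (st a).safe)
    (hg : Measurable fun a => (st a).gap) : Measurable fun a => (st a).level := by
  refine measurable_pi_lambda _ fun z => ?_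
  have h1 : ∀ j, Measurable fun a => (st a).safe j z := fun j =>
    (measurable_pi_apply z).comp ((measurable_pi_apply j).comp hs)
  have h2 : Measurable fun a => ⨅ j, |(st a).safe j z| :=
    Measurable.iInf fun j => (h1 j).abs
  have h3 : Measurable fun a => ⨆ j, pp (-(st a).safe j z) :=
    Measurable.iSup fun j => measurable_pp.comp (h1 j).neg
  have h4 : Measurable fun a => pp ((st a).gap z) := measurable_pp.comp ((measurable_pi_apply z).comp hg)
  exact (h2.add h3).add h4

omit hdata in
lemma measurable_mainSlack {level : α → 𝒵 → ℝ} (hl : Measurable level) (ℓ : ℕ) :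
    Measurable fun a => mainSlack κ ℓ (level a) := by
  refine measurable_pi_lambda _ fun z => ?_
  have := (measurable_pi_apply z).comp hl
  exact (this.add_const _).const_mul _

omit hdata in
include sol in
lemma measurable_mainLen (m : ℕ) (δ : ℝ) {level : α → 𝒵 → ℝ} (hl : Measurable level) (ℓ : ℕ) :
    Measurable fun a => mainLen κ 𝒳 m δ ℓ (level a) := by
  have h := (measurable_stageLen sol Finset.univ (fun z => (z : Vec d)) (mainLog 𝒵 m δ ℓ)
    (κ.ce * mainEps κ ℓ)).comp (measurable_mainSlack κ hl ℓ)
  exact h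

omit hdata in
lemma measurable_mainLaw (m : ℕ) (δ : ℝ) {level : α → 𝒵 → ℝ} (hl : Measurable level) (ℓ : ℕ) :
    Measurable fun a => mainLaw κ sol m δ ℓ (level a) := by
  refine measurable_cases (measurable_mainLen κ sol m δ hl ℓ)
    (F := fun τ a => sol.design Finset.univ (fun z => (z : Vec d)) (mainLog 𝒵 m δ ℓ / (τ : ℕ))
      (κ.ce * mainEps κ ℓ) (mainSlack κ ℓ (level a))) fun τ => ?_
  have h := (sol.design_meas Finset.univ (fun z => (z : Vec d)) (mainLog 𝒵 m δ ℓ / (τ : ℕ))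
    (κ.ce * mainEps κ ℓ)).comp (measurable_mainSlack κ hl ℓ)
  exact h

lemma measurable_mainSafe (γ δ : ℝ) {level : α → 𝒵 → ℝ} (hl : Measurable level) {t₀ : α → ℕ}
    (ht : Measurable t₀) (ℓ : ℕ) :
    Measurable fun a => mainSafe κ sol γ δ (data a) ℓ (t₀ a) (level a) := by
  refine measurable_pi_lambda _ fun i => measurable_pi_lambda _ fun z => ?_
  have hest : Measurable fun a => mainEst κ sol δ (data a) ℓ (t₀ a) (level a) i :=
    measurable_rips sol _ _ (measurable_mainLaw κ sol m δ hl ℓ) (measurable_mainLen κ sol m δ hl ℓ)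
      (measurable_shift hdata ht measurable_fst)
      (measurable_shift hdata ht
        ((measurable_pi_apply i).comp (measurable_snd.comp measurable_snd)))
  have h2 : Measurable fun a => (mainLen κ 𝒳 m δ ℓ (level a) : ℝ) :=
    measurable_from_top.comp (measurable_mainLen κ sol m δ hl ℓ)
  have h3 := (measurable_invNormSq (z : Vec d)).comp (measurable_mainLaw κ sol m δ hl ℓ)
  exact (((measurable_inner_right (z : Vec d)).comp hest).const_sub γ).add
    ((h3.mul_const _).div h2).sqrt

open Classical in
lemma measurable_context (γ δ : ℝ) {st : α → State 𝒳 𝒵 m}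
    (ht : Measurable fun a => (st a).trace.time) (hs : Measurable fun a => (st a).safe)
    (hg : Measurable fun a => (st a).gap) (hY : Measurable fun a => (st a).Y) (ℓ : ℕ) :
    (Measurable fun a => (context κ sol γ δ (data a) ℓ (st a)).trace.time) ∧
    (Measurable fun a => (context κ sol γ δ (data a) ℓ (st a)).safe) ∧
    (Measurable fun a => (context κ sol γ δ (data a) ℓ (st a)).sg) ∧
    Measurable fun a => (context κ sol γ δ (data a) ℓ (st a)).Y := by
  have hl := measurable_level hs hg
  have hsafe := measurable_mainSafe κ sol hdata γ δ hl ht ℓ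
  have hs1 : ∀ i z, Measurable fun a => mainSafe κ sol γ δ (data a) ℓ (st a).trace.time
      (st a).level i z := fun i z => (measurable_pi_apply z).comp ((measurable_pi_apply i).comp hsafe)
  refine ⟨ht.add (measurable_mainLen κ sol m δ hl ℓ), hsafe, ?_, ?_⟩
  · refine measurable_pi_lambda _ fun z => Measurable.neg (Measurable.iSup fun j => ?_)
    exact measurable_pp.comp (hs1 j z).neg
  · have hset : Measurable fun a => mainSet κ sol γ δ (data a) ℓ (st a).trace.time (st a).level := by
      unfold mainSet
      refine measurable_filter fun z => ?_
      have h : Measurable fun a => (st a).level z := (measurable_pi_apply z).comp hl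
      have h5 := fun i => measurableSet_le
        (((h.const_mul κ.cd).add_const ((κ.cd + κ.ce) * mainEps κ ℓ)).const_mul κ.cy) (hs1 i z)
      rw [Set.ofPred_forall]
      exact MeasurableSet.iInter h5
    have hU : Measurable fun p : Finset 𝒵 × Finset 𝒵 => p.1 ∪ p.2 := measurable_of_countable _
    exact hU.comp (hset.prodMk hY)

lemma measurable_iter (γ δ : ℝ) (n : ℕ) :
    (Measurable fun a => (iter κ sol γ δ (data a) n).trace.time) ∧
    (Measurable fun a => (iter κ sol γ δ (data a) n).safe) ∧
    (Measurable fun a => (iter κ sol γ δ (data a) n).gap) ∧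
    Measurable fun a => (iter κ sol γ δ (data a) n).Y := by
  induction n with
  | zero => exact ⟨measurable_const, measurable_const, measurable_const, measurable_const⟩
  | succ n ih =>
    obtain ⟨h1, h2, h3, h4⟩ := ih
    obtain ⟨c1, c2, c3, c4⟩ := measurable_context κ sol hdata γ δ h1 h2 h3 h4 (n + 1)
    -- The optimal set is random with finitely many values, so the call is studied with that set
    -- frozen.
    let F : Finset 𝒵 → α → Trace 𝒳 × (𝒵 → ℝ) := fun Y a =>
      rage κ sol Finset.univ Y (mainEps κ (n + 1)) (δ / (4 * ((n + 1 : ℕ) : ℝ) ^ 2))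
        (context κ sol γ δ (data a) (n + 1) (iter κ sol γ δ (data a) n)).sg (data a)
        (context κ sol γ δ (data a) (n + 1) (iter κ sol γ δ (data a) n)).trace
    have hr : ∀ Y, (Measurable fun a => (F Y a).1.time) ∧ Measurable fun a => (F Y a).2 :=
      fun Y => measurable_rage κ sol hdata Finset.univ Y _ _ c3 c1
    have h5 := measurable_cases c4 (F := fun Y a => (F Y a).1.time) fun Y => (hr Y).1
    have h6 := measurable_cases c4 (F := fun Y a => (F Y a).2) fun Y => (hr Y).2
    exact ⟨h5, c2, h6, c4⟩

lemma measurable_endSet (γ δ ε : ℝ) (n : ℕ) :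
    Measurable fun a => endSet κ ε (iter κ sol γ δ (data a) n) := by
  obtain ⟨h1, h2, h3, h4⟩ := measurable_iter κ sol hdata γ δ n
  have hl := measurable_level h2 h3
  unfold endSet
  refine measurable_filter fun z => ?_
  have h : Measurable fun a => (iter κ sol γ δ (data a) n).level z :=
    (measurable_pi_apply z).comp hl
  have h5 := fun i => measurableSet_le ((((h.const_mul κ.cd).add_const
    ((κ.cd + κ.ce) * ε)).const_mul κ.cy).sub_const (κ.cg * ε))
    ((measurable_pi_apply z).comp ((measurable_pi_apply i).comp h2))
  rw [Set.ofPred_forall]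
  exact MeasurableSet.iInter h5

lemma measurable_unsafety (γ δ : ℝ) (n : ℕ) :
    Measurable fun a => fun z => -(iter κ sol γ δ (data a) n).unsafety z := by
  obtain ⟨h1, h2, h3, h4⟩ := measurable_iter κ sol hdata γ δ n
  refine measurable_pi_lambda _ fun z => Measurable.neg (Measurable.iSup fun j => ?_)
  exact measurable_pp.comp ((measurable_pi_apply z).comp ((measurable_pi_apply j).comp h2)).neg

end AlgorithmMeasurability

/-! ### Positive parts -/

section PositivePart

lemma pp_nonneg (x : ℝ) : 0 ≤ pp x := le_max_right _ _

lemma le_pp (x : ℝ) : x ≤ pp x := le_max_left _ _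

lemma pp_of_nonneg {x : ℝ} (h : 0 ≤ x) : pp x = x := max_eq_left h

lemma pp_of_nonpos {x : ℝ} (h : x ≤ 0) : pp x = 0 := max_eq_right h

lemma pp_le {x y : ℝ} (h : x ≤ y) (hy : 0 ≤ y) : pp x ≤ y := max_le h hy

lemma abs_pp_sub_pp_le (x y : ℝ) : |pp x - pp y| ≤ |x - y| := abs_max_sub_max_le_abs x y 0

end PositivePart

/-- The numerical constants for which the guarantees are proved. -/
def consts : Consts where
  -- `cf` and `c0` give the initial scales `32` and `4`, at which the guarantees hold trivially.
  -- `ca`, `cc`, `cd`, `ce` make nine widths a small fraction of the quantities compared. `cy = 36`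
  -- is twice the `18` in the error bound `18 / 1000` for safety, since the true level is at most
  -- about twice the estimated one.
  ca := 1 / 3000
  cc := 1 / 3000
  cf := 1 / 16
  cd := 1 / 1000
  ce := 1 / 1000
  cy := 36
  cg := 1
  c0 := 1 / 2
  ca_pos := by norm_num
  cc_pos := by norm_num
  cf_pos := by norm_num
  cd_pos := by norm_num
  ce_pos := by norm_num
  cy_pos := by norm_num
  cg_pos := by norm_num
  c0_pos := by norm_num

/-! ### Dyadic scales and stopping -/

section Scales

/-- An epoch that is run starts from a scale above the tolerance; its own scale, half of that, may
fall below the tolerance but not below its half. -/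
lemma lt_scale_of_lt_ceil {c ε : ℝ} (hc : 0 < c) (hε : 0 < ε) {k : ℕ}
    (hk : k < ⌈Real.logb 2 (2 / (c * ε))⌉₊) : ε < 2 / c * (1 / 2) ^ k := by
  rw [Nat.lt_ceil, Real.lt_logb_iff_rpow_lt (by norm_num) (by positivity), Real.rpow_natCast,
    lt_div_iff₀ (by positivity)] at hk
  rw [one_div, inv_pow, ← div_eq_mul_inv, lt_div_iff₀ (by positivity), lt_div_iff₀ hc]
  linarith

lemma scale_ceil_le {c ε : ℝ} (hc : 0 < c) (hε : 0 < ε) :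
    2 / c * (1 / 2) ^ ⌈Real.logb 2 (2 / (c * ε))⌉₊ ≤ ε := by
  have h := Nat.le_ceil (Real.logb 2 (2 / (c * ε)))
  rw [Real.logb_le_iff_le_rpow (by norm_num) (by positivity), Real.rpow_natCast,
    div_le_iff₀ (by positivity)] at h
  rw [one_div, inv_pow, ← div_eq_mul_inv, div_le_iff₀ (by positivity), div_le_iff₀ hc]
  linarith

lemma rageEps_succ (κ : Consts) (k : ℕ) : rageEps κ (k + 1) = rageEps κ k / 2 := by
  unfold rageEps; rw [pow_succ]; ring

lemma rageEps_pos (κ : Consts) (k : ℕ) : 0 < rageEps κ k := by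
  have := κ.cf_pos; unfold rageEps; positivity

lemma mainEps_succ (κ : Consts) (k : ℕ) : mainEps κ (k + 1) = mainEps κ k / 2 := by
  unfold mainEps; rw [pow_succ]; ring

lemma mainEps_pos (κ : Consts) (k : ℕ) : 0 < mainEps κ k := by
  have := κ.c0_pos; unfold mainEps; positivity

lemma lt_rageEps {κ : Consts} {tol : ℝ} (htol : 0 < tol) {k : ℕ} (hk : k < epochs κ tol) :
    tol < rageEps κ k := lt_scale_of_lt_ceil κ.cf_pos htol hk

lemma rageEps_epochs_le {κ : Consts} {tol : ℝ} (htol : 0 < tol) :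
    rageEps κ (epochs κ tol) ≤ tol := scale_ceil_le κ.cf_pos htol

lemma lt_mainEps {κ : Consts} {ε : ℝ} (hε : 0 < ε) {k : ℕ} (hk : k < rounds κ ε) :
    ε < mainEps κ k := lt_scale_of_lt_ceil κ.c0_pos hε hk

lemma mainEps_rounds_le {κ : Consts} {ε : ℝ} (hε : 0 < ε) :
    mainEps κ (rounds κ ε) ≤ ε := scale_ceil_le κ.c0_pos hε

lemma one_le_log_of_four_le {x : ℝ} (hx : 4 ≤ x) : 1 ≤ Real.log x := by
  rw [Real.le_log_iff_exp_le (by linarith)]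
  linarith [Real.exp_one_lt_d9]

lemma one_le_rageLog {d : ℕ} {𝒵 : Finset (Vec d)} {S : Finset 𝒵} (hS : S.Nonempty) {δ : ℝ}
    (hδ : 0 < δ) (hδ1 : δ ≤ 1) {ℓ : ℕ} (hℓ : 1 ≤ ℓ) : 1 ≤ rageLog S δ ℓ := by
  refine one_le_log_of_four_le ?_
  have h1 : (1 : ℝ) ≤ S.card := by exact_mod_cast hS.card_pos
  have h2 : (1 : ℝ) ≤ ℓ := by exact_mod_cast hℓ
  rw [le_div_iff₀ hδ]
  have h3 : (1 : ℝ) ≤ (S.card : ℝ) ^ 2 := one_le_pow₀ h1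
  have h4 : (1 : ℝ) ≤ (ℓ : ℝ) ^ 2 := one_le_pow₀ h2
  nlinarith

end Scales

/-! ### Analysis of `RAGE^ε` -/

section Rage

variable {d m : ℕ} {𝒳 𝒵 : Finset (Vec d)} {sol : Solver 𝒳 𝒵}

/-- In epoch `k + 1` of `RAGE^ε` the estimated differences of rewards are accurate. -/
def RageAccurate (κ : Consts) (sol : Solver 𝒳 𝒵) (θ : Vec d) (S Y : Finset 𝒵) (δ : ℝ) (sg : 𝒵 → ℝ)
    (data : ℕ → Sample 𝒳 m) (tr : Trace 𝒳) (k : ℕ) : Prop :=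
  ∀ z ∈ S, ∀ z' ∈ S, |inner ℝ (rageEst κ sol S δ sg data (k + 1)
      (rageIter κ sol S Y δ sg data tr k).trace.time (rageIter κ sol S Y δ sg data tr k).yhat
      (rageIter κ sol S Y δ sg data tr k).gap) ((z : Vec d) - z') - inner ℝ θ ((z : Vec d) - z')| ≤
    8 * rageWidth κ sol S δ sg (k + 1) (rageIter κ sol S Y δ sg data tr k).yhat
      (rageIter κ sol S Y δ sg data tr k).gap ((z : Vec d) - z')

lemma rageLen_spec (κ : Consts) (sol : Solver 𝒳 𝒵) (hd : ∃ lam, IsDesign 𝒳 lam) {S : Finset 𝒵}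
    (hS : S.Nonempty) {δ : ℝ} (hδ : 0 < δ) (hδ1 : δ ≤ 1) (sg : 𝒵 → ℝ) {ℓ : ℕ} (hℓ : 1 ≤ ℓ)
    (yhat : 𝒵) (gap : 𝒵 → ℝ) :
    4 * rageLog S δ ℓ ≤ rageLen κ 𝒳 S δ sg ℓ yhat gap ∧
      Feasible 𝒳 𝒵 S (fun z => z - yhat) (rageLog S δ ℓ / rageLen κ 𝒳 S δ sg ℓ yhat gap)
        (κ.cc * rageEps κ ℓ) (rageSlack κ sg ℓ gap) (rageLaw κ sol S δ sg ℓ yhat gap) := by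
  have hL := one_le_rageLog hS hδ hδ1 hℓ
  have h1 := rageEps_pos κ ℓ
  have hcc := κ.cc_pos
  have hca := κ.ca_pos
  obtain ⟨h2, h3⟩ := stageLen_spec (S := S) (v := fun z => (z : Vec d) - yhat)
    (L := rageLog S δ ℓ) (thr := κ.cc * rageEps κ ℓ) (b := rageSlack κ sg ℓ gap) hd
    (by linarith) fun z _ => by
      have := pp_nonneg (-sg z)
      have := pp_nonneg (gap z)
      unfold rageSlack
      positivity
  exact ⟨h2, sol.design_spec _ _ _ _ _ h3⟩

lemma abs_inner_le_two {θ u v : Vec d} (hθ : ‖θ‖ ≤ 1) (hu : ‖u‖ ≤ 1) (hv : ‖v‖ ≤ 1) :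
    |inner ℝ θ (u - v)| ≤ 2 := by
  refine (abs_real_inner_le_norm _ _).trans ?_
  have h1 := norm_sub_le u v
  nlinarith [norm_nonneg θ, norm_nonneg (u - v)]

lemma rageWidth_le (κ : Consts) (sol : Solver 𝒳 𝒵) (hd : ∃ lam, IsDesign 𝒳 lam) {S : Finset 𝒵}
    {δ : ℝ} (hδ : 0 < δ) (hδ1 : δ ≤ 1) (sg : 𝒵 → ℝ) {ℓ : ℕ} (hℓ : 1 ≤ ℓ)
    (yhat : 𝒵) (gap : 𝒵 → ℝ) {z : 𝒵} (hz : z ∈ S) :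
    rageWidth κ sol S δ sg ℓ yhat gap ((z : Vec d) - yhat) ≤
      κ.ca * (pp (-sg z) + pp (gap z) + rageEps κ ℓ) + κ.cc * rageEps κ ℓ := by
  have h := (rageLen_spec κ sol hd ⟨z, hz⟩ hδ hδ1 sg hℓ yhat gap).2.2 z hz
  have h2 : rageWidth κ sol S δ sg ℓ yhat gap ((z : Vec d) - yhat) =
      √(rageLog S δ ℓ / rageLen κ 𝒳 S δ sg ℓ yhat gap *
        invNormSq 𝒳 (rageLaw κ sol S δ sg ℓ yhat gap) ((z : Vec d) - yhat)) := by
    unfold rageWidth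
    congr 1
    ring
  rw [h2]
  unfold rageSlack at h
  linarith

lemma rageWidth_triangle (κ : Consts) (sol : Solver 𝒳 𝒵) (hd : ∃ lam, IsDesign 𝒳 lam)
    {S : Finset 𝒵} (hS : S.Nonempty) {δ : ℝ} (hδ : 0 < δ) (hδ1 : δ ≤ 1) (sg : 𝒵 → ℝ) {ℓ : ℕ}
    (hℓ : 1 ≤ ℓ) (yhat : 𝒵) (gap : 𝒵 → ℝ) (u v : Vec d) :
    rageWidth κ sol S δ sg ℓ yhat gap (u - v) ≤
      rageWidth κ sol S δ sg ℓ yhat gap (u - yhat) +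
        rageWidth κ sol S δ sg ℓ yhat gap (v - yhat) := by
  have hlam := (rageLen_spec κ sol hd hS hδ hδ1 sg hℓ yhat gap).2.1
  have hL := one_le_rageLog hS hδ hδ1 hℓ
  have h2 : ∀ w, rageWidth κ sol S δ sg ℓ yhat gap w =
      √(invNormSq 𝒳 (rageLaw κ sol S δ sg ℓ yhat gap) w) *
        √(rageLog S δ ℓ / rageLen κ 𝒳 S δ sg ℓ yhat gap) := by
    intro w
    unfold rageWidth
    rw [mul_div_assoc, Real.sqrt_mul (hlam.invNormSq_nonneg _)]
  rw [h2, h2, h2, ← add_mul]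
  refine mul_le_mul_of_nonneg_right ?_ (Real.sqrt_nonneg _)
  have := hlam.sqrt_invNormSq_sub_le (u - yhat) (v - yhat)
  rwa [sub_sub_sub_cancel_right] at this

/-- The standing assumptions under which `RAGE^ε` is analyzed: `ystar` is the best arm of `Y`. -/
structure RageSetup (θ : Vec d) (S Y : Finset 𝒵) (tol δ : ℝ) (sg : 𝒵 → ℝ) (ystar : 𝒵) : Prop where
  design : ∃ lam, IsDesign 𝒳 lam
  norm_param : ‖θ‖ ≤ 1
  norm_arm : ∀ z ∈ 𝒵, ‖z‖ ≤ 1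
  subset : Y ⊆ S
  mem : ystar ∈ Y
  le_best : ∀ y ∈ Y, inner ℝ θ (y : Vec d) ≤ inner ℝ θ (ystar : Vec d)
  tol_pos : 0 < tol
  delta_pos : 0 < δ
  delta_le : δ ≤ 1
  slack : ∀ y ∈ Y, pp (-sg y) ≤ pp (inner ℝ θ ((ystar : Vec d) - y)) + tol

/-- What `RAGE^ε` guarantees after an epoch of scale `e`. -/
structure RageGuarantee (θ : Vec d) (S Y : Finset 𝒵) (sg : 𝒵 → ℝ) (ystar : 𝒵) (e : ℝ)
    (st : RageState 𝒳 𝒵) : Prop where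
  mem : st.yhat ∈ Y
  best : inner ℝ θ ((ystar : Vec d) - st.yhat) ≤ e
  gap : ∀ z ∈ S, |st.gap z - inner ℝ θ ((ystar : Vec d) - z)| ≤
    1 / 10 * (pp (-sg z) + pp (inner ℝ θ ((ystar : Vec d) - z)) + e)

/-- Let `e` be the new scale and `D` the width. As the old gap estimates are accurate up to
constants, `D(z - ŷ)` is at most `1 / 1500` of unsafety + gap + `2 e`, and the slack assumption
makes this `4 e / 1500` at the best arm `y*`. The penalty `8 D` in the selection rule cancels the
selected arm's own error, so its gap is at most `16 D(y* - ŷ)`. A new gap estimate errs by at most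
that amount plus nine widths, within the allowed tenth. -/
lemma RageSetup.guarantee_succ {θ : Vec d} {S Y : Finset 𝒵} {tol δ : ℝ} {sg : 𝒵 → ℝ} {ystar : 𝒵}
    (h : RageSetup (𝒳 := 𝒳) θ S Y tol δ sg ystar) {data : ℕ → Sample 𝒳 m} {tr : Trace 𝒳} {k : ℕ}
    (htol : tol < rageEps consts k)
    (hacc : RageAccurate consts sol θ S Y δ sg data tr k)
    (hk : RageGuarantee θ S Y sg ystar (rageEps consts k)
      (rageIter consts sol S Y δ sg data tr k)) :
    RageGuarantee θ S Y sg ystar (rageEps consts (k + 1))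
      (rageIter consts sol S Y δ sg data tr (k + 1)) := by
  set st := rageIter consts sol S Y δ sg data tr k with hst
  set e := rageEps consts (k + 1) with he
  have hek : rageEps consts k = 2 * e := by rw [he, rageEps_succ]; ring
  have he0 : 0 < e := rageEps_pos _ _
  rw [hek] at htol hk
  have hYne : Y.Nonempty := ⟨_, h.mem⟩
  have hSne : S.Nonempty := hYne.mono h.subset
  have hiter : rageIter consts sol S Y δ sg data tr (k + 1) =
      rageStep consts sol S Y δ sg data (k + 1) st := rfl
  rw [hiter, rageStep_eq]
  set D : Vec d → ℝ := rageWidth consts sol S δ sg (k + 1) st.yhat st.gap with hD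
  set est := rageEst consts sol S δ sg data (k + 1) st.trace.time st.yhat st.gap with hest
  set g : 𝒵 → ℝ := fun z => inner ℝ θ ((ystar : Vec d) - z) with hg
  have hD0 : ∀ u, 0 ≤ D u := fun u => Real.sqrt_nonneg _
  have hacc' : ∀ z ∈ S, ∀ z' ∈ S, |inner ℝ est ((z : Vec d) - z') -
      inner ℝ θ ((z : Vec d) - z')| ≤ 8 * D ((z : Vec d) - z') := hacc
  have hDle : ∀ z ∈ S, D ((z : Vec d) - st.yhat) ≤
      1 / 1500 * (pp (-sg z) + pp (g z) + 2 * e) := by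
    intro z hz
    have h1 : D ((z : Vec d) - st.yhat) ≤
        1 / 3000 * (pp (-sg z) + pp (st.gap z) + e) + 1 / 3000 * e :=
      rageWidth_le consts sol h.design h.delta_pos h.delta_le sg (Nat.le_add_left 1 k) st.yhat
        st.gap hz
    have h2 := hk.gap z hz
    have h3 := (abs_le.1 (abs_pp_sub_pp_le (st.gap z) (g z))).2
    have h4 := pp_nonneg (g z)
    have h5 := pp_nonneg (-sg z)
    change |st.gap z - g z| ≤ 1 / 10 * (pp (-sg z) + pp (g z) + 2 * e) at h2
    linarith
  have htri : ∀ u v : Vec d, D (u - v) ≤ D (u - st.yhat) + D (v - st.yhat) :=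
    rageWidth_triangle consts sol h.design hSne h.delta_pos h.delta_le sg (Nat.le_add_left 1 k)
      st.yhat st.gap
  have hystarS := h.subset h.mem
  have hystar : D ((ystar : Vec d) - st.yhat) ≤ 4 / 1500 * e := by
    have h1 := hDle ystar hystarS
    have h2 := h.slack ystar h.mem
    have h3 : pp (g ystar) = 0 := by simp [hg, pp]
    change pp (-sg ystar) ≤ pp (g ystar) + tol at h2
    linarith
  set yh := rageBest consts sol S Y δ sg data (k + 1) st.trace.time st.yhat st.gap with hyh
  obtain ⟨hyY, hymax⟩ := sol.argmax_spec Y (fun y => inner ℝ est (y : Vec d) -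
    8 * D ((y : Vec d) - st.yhat)) hYne
  change yh ∈ Y at hyY
  have hmax : inner ℝ est (ystar : Vec d) - 8 * D ((ystar : Vec d) - st.yhat) ≤
    inner ℝ est (yh : Vec d) - 8 * D ((yh : Vec d) - st.yhat) := hymax ystar h.mem
  have hyhatS := h.subset hk.mem
  have hyS := h.subset hyY
  have hgy : g yh ≤ 64 / 1500 * e := by
    have h1 := (abs_le.1 (hacc' ystar hystarS st.yhat hyhatS)).1
    have h2 := (abs_le.1 (hacc' yh hyS st.yhat hyhatS)).2
    simp only [inner_sub_right] at h1 h2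
    simp only [hg, inner_sub_right]
    linarith
  have hgy0 : 0 ≤ g yh := by
    have := h.le_best yh hyY
    simp only [hg, inner_sub_right]; linarith
  have hDy : D ((yh : Vec d) - st.yhat) ≤ 1 / 1500 * (128 / 1500 * e + 4 * e) := by
    have h1 := hDle yh hyS
    have h2 := h.slack yh hyY
    change pp (-sg yh) ≤ pp (g yh) + tol at h2
    rw [pp_of_nonneg hgy0] at h1 h2
    linarith
  refine ⟨hyY, ?_, fun z hz => ?_⟩
  · change g yh ≤ e
    linarith
  · change |inner ℝ est ((yh : Vec d) - z) + D ((z : Vec d) - yh) - g z| ≤ _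
    have h1 := abs_le.1 (hacc' yh hyS z hz)
    have h2 : D ((yh : Vec d) - z) = D ((z : Vec d) - yh) := by
      simp only [hD, rageWidth]
      rw [invNormSq_sub_comm]
    rw [h2] at h1
    have h3 := htri z yh
    have h4 := hDle z hz
    have h5 : inner ℝ θ ((yh : Vec d) - z) = g z - g yh := by
      simp only [hg, inner_sub_right]; ring
    rw [h5] at h1
    have h6 := hD0 ((z : Vec d) - yh)
    have h7 := pp_nonneg (g z)
    have h8 := pp_nonneg (-sg z)
    rw [abs_le]
    constructor <;> linarith [h1.1, h1.2]

lemma RageSetup.guarantee {θ : Vec d} {S Y : Finset 𝒵} {tol δ : ℝ} {sg : 𝒵 → ℝ} {ystar : 𝒵}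
    (h : RageSetup (𝒳 := 𝒳) θ S Y tol δ sg ystar) {data : ℕ → Sample 𝒳 m} {tr : Trace 𝒳}
    (hacc : ∀ k < epochs consts tol, RageAccurate consts sol θ S Y δ sg data tr k) {k : ℕ}
    (hk : k ≤ epochs consts tol) :
    RageGuarantee θ S Y sg ystar (rageEps consts k) (rageIter consts sol S Y δ sg data tr k) := by
  induction k with
  | zero =>
    -- All gaps are at most `2` in absolute value, less than a tenth of the initial scale.
    have he : rageEps consts 0 = 32 := by simp [rageEps, consts]; norm_num
    rw [he]
    have habs : ∀ z : 𝒵, |inner ℝ θ ((ystar : Vec d) - z)| ≤ 2 := fun z =>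
      abs_inner_le_two h.norm_param (h.norm_arm _ ystar.2) (h.norm_arm _ z.2)
    refine ⟨sol.start_spec Y ⟨_, h.mem⟩, ?_, fun z _ => ?_⟩
    · exact (le_abs_self _).trans ((habs _).trans (by norm_num))
    · change |0 - inner ℝ θ ((ystar : Vec d) - z)| ≤ _
      rw [zero_sub, abs_neg]
      have h1 := pp_nonneg (-sg z)
      have h2 := pp_nonneg (inner ℝ θ ((ystar : Vec d) - z))
      linarith [habs z]
  | succ k ih =>
    exact h.guarantee_succ (lt_rageEps h.tol_pos hk) (hacc k hk) (ih (Nat.le_of_succ_le hk))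

/-- The final gap estimates of `RAGE^ε`. -/
lemma RageSetup.abs_gap_sub_le {θ : Vec d} {S Y : Finset 𝒵} {tol δ : ℝ} {sg : 𝒵 → ℝ} {ystar : 𝒵}
    (h : RageSetup (𝒳 := 𝒳) θ S Y tol δ sg ystar) {data : ℕ → Sample 𝒳 m} {tr : Trace 𝒳}
    (hacc : ∀ k < epochs consts tol, RageAccurate consts sol θ S Y δ sg data tr k) {z : 𝒵}
    (hz : z ∈ S) :
    |(rage consts sol S Y tol δ sg data tr).2 z - inner ℝ θ ((ystar : Vec d) - z)| ≤
      1 / 10 * (pp (-sg z) + pp (inner ℝ θ ((ystar : Vec d) - z)) + tol) := by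
  rw [rage_eq _ _ _ _ _ _ _ _ _ ⟨_, h.mem⟩]
  refine ((h.guarantee hacc le_rfl).gap z hz).trans ?_
  have := rageEps_epochs_le (κ := consts) h.tol_pos
  linarith

/-- The number of samples of one epoch of `RAGE^ε`, compared with a given design. -/
lemma RageSetup.rageLen_le {θ : Vec d} {S Y : Finset 𝒵} {tol δ : ℝ} {sg : 𝒵 → ℝ} {ystar : 𝒵}
    (h : RageSetup (𝒳 := 𝒳) θ S Y tol δ sg ystar) {k : ℕ} (htol : tol < rageEps consts k)
    {st : RageState 𝒳 𝒵} (hk : RageGuarantee θ S Y sg ystar (rageEps consts k) st)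
    {zstar : Vec d} {Lz M : ℝ} (hLz : 0 < Lz) (hM : 0 ≤ M) {lam : 𝒳 → ℝ} (hlam : IsDesign 𝒳 lam)
    {den : 𝒵 → ℝ} (hden0 : ∀ z, 0 ≤ den z)
    (hden : ∀ z ∈ S, den z ≤ 2 * (pp (-sg z) + pp (inner ℝ θ ((ystar : Vec d) - z)) + tol) +
      pp (inner ℝ θ ((ystar : Vec d) - z)) + 2 * rageEps consts k)
    (hterm : ∀ z ∈ S, invNormSq 𝒳 lam (z - zstar) * Lz ≤ M * den z ^ 2) :
    (rageLen consts 𝒳 S δ sg (k + 1) st.yhat st.gap : ℝ) ≤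
      8 * rageLog S δ (k + 1) + 2 * (2700000000 * (rageLog S δ (k + 1) / Lz) * M) := by
  set e := rageEps consts (k + 1) with he
  have hek : rageEps consts k = 2 * e := by rw [he, rageEps_succ]; ring
  have he0 : 0 < e := rageEps_pos _ _
  rw [hek] at htol hk hden
  have hSne : S.Nonempty := Finset.Nonempty.mono h.subset ⟨_, h.mem⟩
  have hL := one_le_rageLog hSne h.delta_pos h.delta_le (Nat.le_add_left 1 k)
  set L := rageLog S δ (k + 1) with hLdef
  set g : 𝒵 → ℝ := fun z => inner ℝ θ ((ystar : Vec d) - z) with hg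
  have hslack : ∀ z, rageSlack consts sg (k + 1) st.gap z + consts.cc * rageEps consts (k + 1) =
      1 / 3000 * (pp (-sg z) + pp (st.gap z) + 2 * e) := by
    intro z
    change 1 / 3000 * (pp (-sg z) + pp (st.gap z) + e) + 1 / 3000 * e = _
    ring
  refine stageLen_le hlam (by positivity) (by linarith) (fun z _ => ?_) fun z hz => ?_
  · rw [hslack]
    have := pp_nonneg (-sg z)
    have := pp_nonneg (st.gap z)
    positivity
  · rw [hslack]
    set X := pp (-sg z) + pp (st.gap z) + 2 * e with hX
    have p1 := pp_nonneg (-sg z)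
    have p2 := pp_nonneg (st.gap z)
    have p3 := pp_nonneg (g z)
    have hdz : den z ≤ 5 * X := by
      have h1 := hden z hz
      have h2 := hk.gap z hz
      have h3 := (abs_le.1 (abs_pp_sub_pp_le (st.gap z) (g z))).1
      change |st.gap z - g z| ≤ 1 / 10 * (pp (-sg z) + pp (g z) + 2 * e) at h2
      change den z ≤ 2 * (pp (-sg z) + pp (g z) + tol) + pp (g z) + 2 * (2 * e) at h1
      linarith
    have hyS := h.subset hk.mem
    have hdy : den st.yhat ≤ 11 * X := by
      have h1 := hden st.yhat hyS
      have h2 := h.slack st.yhat hk.mem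
      have h3 := hk.best
      have h4 : pp (g st.yhat) ≤ 2 * e := pp_le h3 (by linarith)
      change pp (-sg st.yhat) ≤ pp (g st.yhat) + tol at h2
      change den st.yhat ≤ 2 * (pp (-sg st.yhat) + pp (g st.yhat) + tol) + pp (g st.yhat) +
        2 * (2 * e) at h1
      linarith
    have hX0 : 0 ≤ X := by linarith
    have d1 : den z ^ 2 ≤ 25 * X ^ 2 := by nlinarith [hden0 z]
    have d2 : den st.yhat ^ 2 ≤ 121 * X ^ 2 := by nlinarith [hden0 st.yhat]
    -- The comparison design controls differences to `zstar`, so `z - ŷ` is split there. The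
    -- constants are `2 · 25 + 2 · 121 ≤ 300` and `300 · 3000² = 2700000000`.
    have h1 : invNormSq 𝒳 lam ((z : Vec d) - st.yhat) ≤
        2 * invNormSq 𝒳 lam (z - zstar) + 2 * invNormSq 𝒳 lam (st.yhat - zstar) := by
      have := hlam.invNormSq_sub_le (z - zstar) (st.yhat - zstar)
      rwa [sub_sub_sub_cancel_right] at this
    have h2 := hterm z hz
    have h3 := hterm st.yhat hyS
    have h4 : invNormSq 𝒳 lam ((z : Vec d) - st.yhat) * Lz ≤ 300 * M * X ^ 2 := by
      have e1 : M * den z ^ 2 ≤ M * (25 * X ^ 2) := mul_le_mul_of_nonneg_left d1 hM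
      have e2 : M * den st.yhat ^ 2 ≤ M * (121 * X ^ 2) := mul_le_mul_of_nonneg_left d2 hM
      have e3 := mul_le_mul_of_nonneg_right h1 hLz.le
      have e4 : 0 ≤ M * X ^ 2 := by positivity
      nlinarith
    have h5 : invNormSq 𝒳 lam ((z : Vec d) - st.yhat) * L =
        (invNormSq 𝒳 lam ((z : Vec d) - st.yhat) * Lz) * (L / Lz) := by field_simp
    have h6 : 0 ≤ L / Lz := by positivity
    calc _ = (invNormSq 𝒳 lam ((z : Vec d) - st.yhat) * Lz) * (L / Lz) := h5
      _ ≤ (300 * M * X ^ 2) * (L / Lz) := mul_le_mul_of_nonneg_right h4 h6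
      _ = _ := by ring

/-- The number of samples of `RAGE^ε`. -/
lemma RageSetup.rage_time_le {θ : Vec d} {S Y : Finset 𝒵} {tol δ : ℝ} {sg : 𝒵 → ℝ} {ystar : 𝒵}
    (h : RageSetup (𝒳 := 𝒳) θ S Y tol δ sg ystar) {data : ℕ → Sample 𝒳 m} {tr : Trace 𝒳}
    (hacc : ∀ k < epochs consts tol, RageAccurate consts sol θ S Y δ sg data tr k)
    {zstar : Vec d} {Lz M Λ : ℝ} (hLz : 0 < Lz) (hM : 0 ≤ M)
    (hΛ : ∀ k < epochs consts tol, rageLog S δ (k + 1) ≤ Λ * Lz)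
    (hterm : ∀ e, 2 * tol ≤ e → ∃ lam, IsDesign 𝒳 lam ∧ ∃ den : 𝒵 → ℝ, (∀ z, 0 ≤ den z) ∧
      (∀ z ∈ S, den z ≤ 2 * (pp (-sg z) + pp (inner ℝ θ ((ystar : Vec d) - z)) + tol) +
        pp (inner ℝ θ ((ystar : Vec d) - z)) + e) ∧
      ∀ z ∈ S, invNormSq 𝒳 lam (z - zstar) * Lz ≤ M * den z ^ 2) :
    ((rage consts sol S Y tol δ sg data tr).1.time : ℝ) ≤ tr.time +
      epochs consts tol * (8 * (Λ * Lz) + 5400000000 * (Λ * M)) := by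
  rw [rage_eq _ _ _ _ _ _ _ _ _ ⟨_, h.mem⟩]
  have key : ∀ k ≤ epochs consts tol,
      ((rageIter consts sol S Y δ sg data tr k).trace.time : ℝ) ≤
        tr.time + k * (8 * (Λ * Lz) + 5400000000 * (Λ * M)) := by
    intro k
    induction k with
    | zero => intro _; simp [rageIter]
    | succ k ih =>
      intro hk
      have h1 := ih (Nat.le_of_succ_le hk)
      have htol := lt_rageEps h.tol_pos hk
      -- The starting scale exceeds `tol`, so its double lies in the range where comparison designs
      -- are available.
      obtain ⟨lam, hlam, den, hden0, hden, ht⟩ := hterm (2 * rageEps consts k) (by linarith)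
      have h2 := h.rageLen_le htol (h.guarantee hacc (Nat.le_of_succ_le hk)) hLz hM hlam hden0
        hden ht
      have h3 : ((rageIter consts sol S Y δ sg data tr (k + 1)).trace.time : ℝ) =
          (rageIter consts sol S Y δ sg data tr k).trace.time +
          rageLen consts 𝒳 S δ sg (k + 1) (rageIter consts sol S Y δ sg data tr k).yhat
            (rageIter consts sol S Y δ sg data tr k).gap := by
        rw [← Nat.cast_add]; rfl
      have h4 := hΛ k hk
      have h5 : rageLog S δ (k + 1) / Lz ≤ Λ := by rwa [div_le_iff₀ hLz]
      have h6 : rageLog S δ (k + 1) / Lz * M ≤ Λ * M := mul_le_mul_of_nonneg_right h5 hM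
      rw [h3]
      push_cast
      nlinarith
  exact key _ le_rfl

end Rage

/-! ### Gap to the best arm of a possibly empty set -/

section BestGap

variable {d : ℕ} {𝒵 : Finset (Vec d)}

/-- The positive part of the gap of `z` to the best arm of `Y`; it is `0` for `Y = ∅`. -/
def bestGap (θ : Vec d) (Y : Finset 𝒵) (z : Vec d) : ℝ :=
  ((Y.sup fun y => Real.toNNReal (inner ℝ θ ((y : Vec d) - z)) : NNReal) : ℝ)

variable {θ : Vec d} {Y Y' : Finset 𝒵} {z : Vec d}

lemma bestGap_nonneg : 0 ≤ bestGap θ Y z := NNReal.coe_nonneg _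

lemma inner_le_bestGap {y : 𝒵} (hy : y ∈ Y) : inner ℝ θ ((y : Vec d) - z) ≤ bestGap θ Y z :=
  (Real.le_coe_toNNReal _).trans (NNReal.coe_le_coe.2
    (Finset.le_sup (f := fun y : 𝒵 => Real.toNNReal (inner ℝ θ ((y : Vec d) - z))) hy))

lemma bestGap_le {c : ℝ} (hc : 0 ≤ c) (h : ∀ y ∈ Y, inner ℝ θ ((y : Vec d) - z) ≤ c) :
    bestGap θ Y z ≤ c := by
  lift c to NNReal using hc
  refine NNReal.coe_le_coe.2 (Finset.sup_le fun y hy => ?_)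
  rw [Real.toNNReal_le_iff_le_coe]
  exact h y hy

lemma bestGap_mono (h : Y ⊆ Y') : bestGap θ Y z ≤ bestGap θ Y' z :=
  bestGap_le bestGap_nonneg fun _ hy => inner_le_bestGap (h hy)

lemma bestGap_empty : bestGap θ (∅ : Finset 𝒵) z = 0 := by simp [bestGap]

lemma exists_best (θ : Vec d) (hY : Y.Nonempty) :
    ∃ ystar ∈ Y, ∀ y ∈ Y, inner ℝ θ (y : Vec d) ≤ inner ℝ θ (ystar : Vec d) :=
  Finset.exists_max_image Y (fun y => inner ℝ θ (y : Vec d)) hY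

lemma bestGap_eq_pp {ystar : 𝒵} (h1 : ystar ∈ Y)
    (h2 : ∀ y ∈ Y, inner ℝ θ (y : Vec d) ≤ inner ℝ θ (ystar : Vec d)) :
    bestGap θ Y z = pp (inner ℝ θ ((ystar : Vec d) - z)) := by
  refine le_antisymm (bestGap_le (pp_nonneg _) fun y hy => ?_)
    (pp_le (inner_le_bestGap h1) bestGap_nonneg)
  refine le_trans ?_ (le_pp _)
  have := h2 y hy
  simp only [inner_sub_right]; linarith

lemma exists_inner_pos_of_bestGap_pos (h : 0 < bestGap θ Y z) :
    ∃ y ∈ Y, 0 < inner ℝ θ ((y : Vec d) - z) := by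
  by_contra! hn
  exact h.not_ge (bestGap_le le_rfl hn)

end BestGap

/-! ### Stability of finite infima and suprema -/

section FinitePerturbation

variable {m : ℕ}

lemma abs_iInf_sub_iInf_le [Nonempty (Fin m)] {f g : Fin m → ℝ} {B : ℝ}
    (h : ∀ j, |f j - g j| ≤ B) : |(⨅ j, f j) - ⨅ j, g j| ≤ B := by
  have key : ∀ f g : Fin m → ℝ, (∀ j, |f j - g j| ≤ B) → (⨅ j, f j) ≤ (⨅ j, g j) + B := by
    intro f g h
    rw [← sub_le_iff_le_add]
    refine le_ciInf fun j => ?_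
    have h1 := ciInf_le (Finite.bddBelow_range f) j
    linarith [(abs_le.1 (h j)).2]
  rw [abs_sub_le_iff]
  have h1 := key f g h
  have h2 := key g f fun j => by rw [abs_sub_comm]; exact h j
  constructor <;> linarith

lemma abs_iSup_sub_iSup_le [Nonempty (Fin m)] {f g : Fin m → ℝ} {B : ℝ}
    (h : ∀ j, |f j - g j| ≤ B) : |(⨆ j, f j) - ⨆ j, g j| ≤ B := by
  have key : ∀ f g : Fin m → ℝ, (∀ j, |f j - g j| ≤ B) → (⨆ j, f j) ≤ (⨆ j, g j) + B := by
    intro f g h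
    refine ciSup_le fun j => ?_
    have h1 := le_ciSup (Finite.bddAbove_range g) j
    linarith [(abs_le.1 (h j)).2]
  rw [abs_sub_le_iff]
  have h1 := key f g h
  have h2 := key g f fun j => by rw [abs_sub_comm]; exact h j
  constructor <;> linarith

end FinitePerturbation

/-! ### Elementary bounds on safety gaps -/

section SafetyGaps

variable {d m : ℕ} {𝒵 : Finset (Vec d)} {θ : Vec d} {μ : Fin m → Vec d} {γ : ℝ} {z : Vec d}

lemma minAbsSafety_nonneg : 0 ≤ minAbsSafety μ γ z := Real.iInf_nonneg fun _ => abs_nonneg _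

lemma maxUnsafety_nonneg : 0 ≤ maxUnsafety μ γ z := Real.iSup_nonneg fun _ => pp_nonneg _

lemma ppEpsGap_nonneg {e : ℝ} : 0 ≤ ppEpsGap 𝒵 θ μ γ e z := by
  unfold ppEpsGap
  split_ifs
  · exact pp_nonneg _
  · exact le_rfl

lemma ppEpsGap_le {e c : ℝ} (hc : 0 ≤ c)
    (h : ∀ z' ∈ 𝒵, (∀ i, e ≤ safetyGap μ γ i z') → inner ℝ θ (z' - z) ≤ c) :
    ppEpsGap 𝒵 θ μ γ e z ≤ c := by
  unfold ppEpsGap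
  split_ifs with hne
  · refine pp_le (Finset.sup'_le _ _ fun z' hz' => ?_) hc
    unfold safeBy at hz'
    rw [Finset.mem_filter] at hz'
    exact h z' hz'.1 hz'.2
  · exact hc

lemma minAbsSafety_le (i : Fin m) : minAbsSafety μ γ z ≤ |safetyGap μ γ i z| :=
  ciInf_le (Finite.bddBelow_range _) i

lemma pp_neg_safetyGap_le (i : Fin m) : pp (-safetyGap μ γ i z) ≤ maxUnsafety μ γ z :=
  le_ciSup (f := fun i => pp (-safetyGap μ γ i z)) (Finite.bddAbove_range _) i

lemma maxUnsafety_le {c : ℝ} (hc : 0 ≤ c) (h : ∀ i, -c ≤ safetyGap μ γ i z) :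
    maxUnsafety μ γ z ≤ c :=
  Real.iSup_le (fun i => pp_le (by linarith [h i]) hc) hc

lemma maxUnsafety_of_safe (h : ∀ i, 0 ≤ safetyGap μ γ i z) : maxUnsafety μ γ z = 0 :=
  le_antisymm (maxUnsafety_le le_rfl fun i => by simpa using h i) maxUnsafety_nonneg

/-- A violated constraint has absolute gap equal to its violation. This removes the minimal safety
gap from estimates that feed the optimality term. -/
lemma minAbsSafety_le_maxUnsafety (h : 0 < maxUnsafety μ γ z) :
    minAbsSafety μ γ z ≤ maxUnsafety μ γ z := by
  have hex : ∃ i, 0 < pp (-safetyGap μ γ i z) := by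
    by_contra! hn
    exact h.not_ge (Real.iSup_le hn le_rfl)
  obtain ⟨i, hi⟩ := hex
  refine (minAbsSafety_le i).trans (le_trans (le_of_eq ?_) (pp_neg_safetyGap_le i))
  have hneg : 0 ≤ -safetyGap μ γ i z := by
    by_contra hn
    rw [pp_of_nonpos (by linarith)] at hi
    exact lt_irrefl _ hi
  rw [pp_of_nonneg hneg, abs_of_nonpos (by linarith)]

lemma abs_safetyGap_le_two (hμ : ∀ i, ‖μ i‖ ≤ 1) (hγ : |γ| ≤ 1) (hz : ‖z‖ ≤ 1) (i : Fin m) :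
    |safetyGap μ γ i z| ≤ 2 := by
  have h1 := (abs_real_inner_le_norm (μ i) z).trans (mul_le_one₀ (hμ i) (norm_nonneg _) hz)
  have h2 := abs_le.1 h1
  have h3 := abs_le.1 hγ
  unfold safetyGap
  rw [abs_le]
  constructor <;> linarith [h2.1, h2.2, h3.1, h3.2]

end SafetyGaps

/-! ### Analysis of the outer loop and correctness -/

section Main

variable {d m : ℕ} {𝒳 𝒵 : Finset (Vec d)} {sol : Solver 𝒳 𝒵}

/-- The standing assumptions under which `BESIDE` is analyzed. -/
structure MainSetup (𝒳 𝒵 : Finset (Vec d)) (θ : Vec d) (μ : Fin m → Vec d) (γ ε δ : ℝ)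
    (zstar : Vec d) : Prop where
  design : ∃ lam, IsDesign 𝒳 lam
  one_le : 1 ≤ m
  norm_param : ‖θ‖ ≤ 1
  norm_safety : ∀ i, ‖μ i‖ ≤ 1
  norm_arm : ∀ z ∈ 𝒵, ‖z‖ ≤ 1
  abs_threshold : |γ| ≤ 1
  eps_pos : 0 < ε
  delta_pos : 0 < δ
  delta_le : δ ≤ 1
  best : IsBestSafe 𝒵 θ μ γ zstar

/-- The width of the confidence interval for the safety gap of `z` in round `ℓ`. -/
def mainWidth (κ : Consts) (sol : Solver 𝒳 𝒵) (m : ℕ) (δ : ℝ) (ℓ : ℕ) (level : 𝒵 → ℝ) (z : 𝒵) : ℝ :=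
  √(invNormSq 𝒳 (mainLaw κ sol m δ ℓ level) z * mainLog 𝒵 m δ ℓ / mainLen κ 𝒳 m δ ℓ level)

/-- In round `n + 1` of `BESIDE` the estimates of the safety parameters are accurate. -/
def MainAccurate (κ : Consts) (sol : Solver 𝒳 𝒵) (μ : Fin m → Vec d) (γ δ : ℝ)
    (data : ℕ → Sample 𝒳 m) (n : ℕ) : Prop :=
  ∀ i, ∀ z : 𝒵, |inner ℝ (mainEst κ sol δ data (n + 1) (iter κ sol γ δ data n).trace.time
      (iter κ sol γ δ data n).level i) (z : Vec d) - inner ℝ (μ i) (z : Vec d)| ≤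
    8 * mainWidth κ sol m δ (n + 1) (iter κ sol γ δ data n).level z

lemma State.level_nonneg (st : State 𝒳 𝒵 m) (z : 𝒵) : 0 ≤ st.level z :=
  add_nonneg (add_nonneg (Real.iInf_nonneg fun _ => abs_nonneg _)
    (Real.iSup_nonneg fun _ => pp_nonneg _)) (pp_nonneg _)

lemma one_le_mainLog (h𝒵 : 𝒵.Nonempty) (hm : 1 ≤ m) {δ : ℝ} (hδ : 0 < δ) (hδ1 : δ ≤ 1) {ℓ : ℕ}
    (hℓ : 1 ≤ ℓ) : 1 ≤ mainLog 𝒵 m δ ℓ := by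
  refine one_le_log_of_four_le ?_
  have h1 : (1 : ℝ) ≤ 𝒵.card := by exact_mod_cast h𝒵.card_pos
  have h2 : (1 : ℝ) ≤ ℓ := by exact_mod_cast hℓ
  have h3 : (1 : ℝ) ≤ m := by exact_mod_cast hm
  rw [le_div_iff₀ hδ]
  have h4 : (1 : ℝ) ≤ (ℓ : ℝ) ^ 2 := one_le_pow₀ h2
  have h5 : (1 : ℝ) ≤ m * 𝒵.card := one_le_mul_of_one_le_of_one_le h3 h1
  have h6 : (1 : ℝ) ≤ m * 𝒵.card * (ℓ : ℝ) ^ 2 := one_le_mul_of_one_le_of_one_le h5 h4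
  nlinarith

lemma mainLen_spec (κ : Consts) (sol : Solver 𝒳 𝒵) (hd : ∃ lam, IsDesign 𝒳 lam)
    (h𝒵 : 𝒵.Nonempty) (hm : 1 ≤ m) {δ : ℝ} (hδ : 0 < δ) (hδ1 : δ ≤ 1) {ℓ : ℕ} (hℓ : 1 ≤ ℓ)
    {level : 𝒵 → ℝ} (hlevel : ∀ z, 0 ≤ level z) :
    4 * mainLog 𝒵 m δ ℓ ≤ mainLen κ 𝒳 m δ ℓ level ∧
      Feasible 𝒳 𝒵 Finset.univ (fun z => z) (mainLog 𝒵 m δ ℓ / mainLen κ 𝒳 m δ ℓ level)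
        (κ.ce * mainEps κ ℓ) (mainSlack κ ℓ level) (mainLaw κ sol m δ ℓ level) := by
  have hL := one_le_mainLog h𝒵 hm hδ hδ1 hℓ
  have h1 := mainEps_pos κ ℓ
  have hce := κ.ce_pos
  have hcd := κ.cd_pos
  obtain ⟨h2, h3⟩ := stageLen_spec (S := (Finset.univ : Finset 𝒵)) (v := fun z => (z : Vec d))
    (L := mainLog 𝒵 m δ ℓ) (thr := κ.ce * mainEps κ ℓ) (b := mainSlack κ ℓ level) hd
    (by linarith) fun z _ => by
      have := hlevel z
      unfold mainSlack
      positivity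
  exact ⟨h2, sol.design_spec _ _ _ _ _ h3⟩

lemma mainWidth_le (κ : Consts) (sol : Solver 𝒳 𝒵) (hd : ∃ lam, IsDesign 𝒳 lam)
    (h𝒵 : 𝒵.Nonempty) (hm : 1 ≤ m) {δ : ℝ} (hδ : 0 < δ) (hδ1 : δ ≤ 1) {ℓ : ℕ} (hℓ : 1 ≤ ℓ)
    {level : 𝒵 → ℝ} (hlevel : ∀ z, 0 ≤ level z) (z : 𝒵) :
    mainWidth κ sol m δ ℓ level z ≤
      κ.cd * (level z + mainEps κ ℓ) + κ.ce * mainEps κ ℓ := by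
  have h := (mainLen_spec κ sol hd h𝒵 hm hδ hδ1 hℓ hlevel).2.2 z (Finset.mem_univ _)
  have h2 : mainWidth κ sol m δ ℓ level z =
      √(mainLog 𝒵 m δ ℓ / mainLen κ 𝒳 m δ ℓ level *
        invNormSq 𝒳 (mainLaw κ sol m δ ℓ level) (z : Vec d)) := by
    unfold mainWidth
    congr 1
    ring
  rw [h2]
  unfold mainSlack at h
  linarith

variable {θ : Vec d} {μ : Fin m → Vec d} {γ ε δ : ℝ} {zstar : Vec d}

/-- What `BESIDE` guarantees about its set of safe arms and its safety gap estimates at scale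
`e`. -/
structure SafeGuarantee (𝒵 : Finset (Vec d)) (θ : Vec d) (μ : Fin m → Vec d) (γ e : ℝ)
    (safe : Fin m → 𝒵 → ℝ) (Y : Finset 𝒵) : Prop where
  safe_mem : ∀ z ∈ Y, ∀ i, 0 ≤ safetyGap μ γ i (z : Vec d)
  dominates : ∀ e', e ≤ e' → ∀ z : Vec d, ppEpsGap 𝒵 θ μ γ e' z ≤ bestGap θ Y z
  accurate : ∀ i, ∀ z : 𝒵, |safe i z - safetyGap μ γ i z| ≤
    18 / 1000 * (minAbsSafety μ γ z + maxUnsafety μ γ z + bestGap θ Y z + 3 * e)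

/-- What `BESIDE` guarantees after a round of scale `e`. -/
structure MainGuarantee (θ : Vec d) (μ : Fin m → Vec d) (γ e : ℝ) (st : State 𝒳 𝒵 m) : Prop where
  safe_mem : ∀ z ∈ st.Y, ∀ i, 0 ≤ safetyGap μ γ i (z : Vec d)
  dominates : ∀ e', e ≤ e' → ∀ z : Vec d, ppEpsGap 𝒵 θ μ γ e' z ≤ bestGap θ st.Y z
  level : ∀ z : 𝒵, |st.level z - (minAbsSafety μ γ z + maxUnsafety μ γ z + bestGap θ st.Y z)| ≤
    1 / 2 * (minAbsSafety μ γ z + maxUnsafety μ γ z + bestGap θ st.Y z + e)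

lemma MainSetup.nonempty (h : MainSetup 𝒳 𝒵 θ μ γ ε δ zstar) : 𝒵.Nonempty := ⟨_, h.best.1⟩

/-- Nine widths (eight of estimation, one of added bonus) bound the safety error by `9 / 1000` of
level + `2 e`. The test threshold is four times larger, so only safe arms pass. An arm of margin `e`
can fail only when its level is large relative to that margin, hence because of its reward gap to an
arm already in the set. -/
lemma MainSetup.safeGuarantee (h : MainSetup 𝒳 𝒵 θ μ γ ε δ zstar) {data : ℕ → Sample 𝒳 m} {n : ℕ}
    (hacc : MainAccurate consts sol μ γ δ data n)
    (hn : MainGuarantee θ μ γ (mainEps consts n) (iter consts sol γ δ data n)) :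
    SafeGuarantee 𝒵 θ μ γ (mainEps consts (n + 1))
      (context consts sol γ δ data (n + 1) (iter consts sol γ δ data n)).safe
      (context consts sol γ δ data (n + 1) (iter consts sol γ δ data n)).Y := by
  set st := iter consts sol γ δ data n with hst
  set e := mainEps consts (n + 1) with he
  have hek : mainEps consts n = 2 * e := by rw [he, mainEps_succ]; ring
  have he0 : 0 < e := mainEps_pos _ _
  rw [hek] at hn
  set c := context consts sol γ δ data (n + 1) st with hc
  have hYsub : st.Y ⊆ c.Y := Finset.subset_union_right
  have hacc1 : ∀ i, ∀ z : 𝒵, |c.safe i z - safetyGap μ γ i z| ≤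
      9 / 1000 * (st.level z + 2 * e) := by
    intro i z
    have h1 := hacc i z
    have h2 := mainWidth_le consts sol h.design h.nonempty h.one_le h.delta_pos h.delta_le
      (Nat.le_add_left 1 n) st.level_nonneg z
    change _ ≤ 1 / 1000 * (st.level z + e) + 1 / 1000 * e at h2
    have h3 : c.safe i z - safetyGap μ γ i z = mainWidth consts sol m δ (n + 1) st.level z -
        (inner ℝ (mainEst consts sol δ data (n + 1) st.trace.time st.level i) (z : Vec d) -
          inner ℝ (μ i) (z : Vec d)) := by
      change γ - inner ℝ (mainEst consts sol δ data (n + 1) st.trace.time st.level i) (z : Vec d) +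
        mainWidth consts sol m δ (n + 1) st.level z - (γ - inner ℝ (μ i) (z : Vec d)) = _
      ring
    have h4 : 0 ≤ mainWidth consts sol m δ (n + 1) st.level z := Real.sqrt_nonneg _
    have h5 := abs_le.1 h1
    rw [h3, abs_le]
    constructor <;> linarith [h5.1, h5.2]
  have hlevel : ∀ z : 𝒵, st.level z ≤
      3 / 2 * (minAbsSafety μ γ z + maxUnsafety μ γ z + bestGap θ st.Y z) + e := by
    intro z
    have := (abs_le.1 (hn.level z)).2
    linarith
  refine ⟨?_, ?_, ?_⟩
  · intro z hz i
    rcases Finset.mem_union.1 hz with hz | hz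
    · have h1 : 36 * (1 / 1000 * st.level z + (1 / 1000 + 1 / 1000) * e) ≤ c.safe i z := by
        unfold mainSet at hz
        exact (Finset.mem_filter.1 hz).2 i
      have h2 := (abs_le.1 (hacc1 i z)).2
      have h3 := st.level_nonneg z
      linarith
    · exact hn.safe_mem z hz i
  · intro e' he' z
    refine ppEpsGap_le bestGap_nonneg fun z' hz' hsafe => ?_
    by_cases hmem : (⟨z', hz'⟩ : 𝒵) ∈ c.Y
    · exact inner_le_bestGap hmem
    have hnot : ¬ ∀ i, 36 * (1 / 1000 * st.level ⟨z', hz'⟩ + (1 / 1000 + 1 / 1000) * e) ≤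
        c.safe i ⟨z', hz'⟩ := by
      intro hall
      refine hmem (Finset.mem_union_left _ ?_)
      unfold mainSet
      exact Finset.mem_filter.2 ⟨Finset.mem_univ _, hall⟩
    push Not at hnot
    obtain ⟨i, hi⟩ := hnot
    have h1 := (abs_le.1 (hacc1 i ⟨z', hz'⟩)).1
    have h2 := hlevel ⟨z', hz'⟩
    have h3 : ∀ i, 0 ≤ safetyGap μ γ i z' := fun i => by linarith [hsafe i]
    have h4 := minAbsSafety_le (μ := μ) (γ := γ) (z := z') i
    rw [abs_of_nonneg (h3 i)] at h4
    have h5 := hsafe i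
    have h6 : maxUnsafety μ γ z' = 0 := maxUnsafety_of_safe h3
    simp only [h6] at h2
    -- The failing constraint has gap at most `45 / 1000` of level + `2 e`, while level is at most
    -- `3 / 2` of gap + `bestGap`, plus `e`. Since the gap is at least `e`, the term `bestGap`
    -- cannot vanish.
    have hpos : 0 < bestGap θ st.Y z' := by
      simp only at h1 h2
      linarith
    obtain ⟨y, hy, hy'⟩ := exists_inner_pos_of_bestGap_pos hpos
    refine le_trans ?_ (inner_le_bestGap (hYsub hy))
    simp only [inner_sub_right] at hy' ⊢
    linarith
  · intro i z
    refine (hacc1 i z).trans ?_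
    have h1 := hlevel z
    have h2 : bestGap θ st.Y z ≤ bestGap θ c.Y z := bestGap_mono hYsub
    have h3 := minAbsSafety_nonneg (μ := μ) (γ := γ) (z := (z : Vec d))
    have h4 := maxUnsafety_nonneg (μ := μ) (γ := γ) (z := (z : Vec d))
    have h5 := bestGap_nonneg (θ := θ) (Y := st.Y) (z := (z : Vec d))
    linarith

section SafeConsequences

variable {e : ℝ} {safe : Fin m → 𝒵 → ℝ} {Y : Finset 𝒵}

lemma abs_unsafety_sub_le [Nonempty (Fin m)] {z : 𝒵} {B : ℝ}
    (h : ∀ i, |safe i z - safetyGap μ γ i z| ≤ B) :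
    |(⨆ j, pp (-safe j z)) - maxUnsafety μ γ z| ≤ B := by
  refine abs_iSup_sub_iSup_le fun j => (abs_pp_sub_pp_le _ _).trans ?_
  rw [neg_sub_neg, abs_sub_comm]
  exact h j

lemma abs_minAbs_sub_le [Nonempty (Fin m)] {z : 𝒵} {B : ℝ}
    (h : ∀ i, |safe i z - safetyGap μ γ i z| ≤ B) :
    |(⨅ j, |safe j z|) - minAbsSafety μ γ z| ≤ B :=
  abs_iInf_sub_iInf_le fun j => (abs_abs_sub_abs_le _ _).trans (h j)

/-- At a safe arm an estimated violation is pure error, whose share proportional to the smallest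
safety gap is absorbed by the gap itself. This yields the slack assumption of `RageSetup`. -/
lemma SafeGuarantee.unsafety_le_of_mem (hs : SafeGuarantee 𝒵 θ μ γ e safe Y) (he : 0 < e)
    {z : 𝒵} (hz : z ∈ Y) : (⨆ j, pp (-safe j z)) ≤ bestGap θ Y z + e := by
  have hG := bestGap_nonneg (θ := θ) (Y := Y) (z := (z : Vec d))
  have hu : maxUnsafety μ γ z = 0 := maxUnsafety_of_safe (hs.safe_mem z hz)
  refine Real.iSup_le (fun i => pp_le ?_ (by linarith)) (by linarith)
  have h1 := (abs_le.1 (hs.accurate i z)).1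
  have h2 := minAbsSafety_le (μ := μ) (γ := γ) (z := (z : Vec d)) i
  rw [abs_of_nonneg (hs.safe_mem z hz i)] at h2
  have h3 := minAbsSafety_nonneg (μ := μ) (γ := γ) (z := (z : Vec d))
  rw [hu] at h1
  linarith

/-- Passes from the estimated violations in the design to the true ones in the complexity. Where the
violation is positive it dominates the smallest safety gap, so most of the error moves to the left
side. -/
lemma SafeGuarantee.maxUnsafety_le [Nonempty (Fin m)] (hs : SafeGuarantee 𝒵 θ μ γ e safe Y)
    (he : 0 < e) (z : 𝒵) :
    maxUnsafety μ γ z ≤ 2 * ((⨆ j, pp (-safe j z)) + bestGap θ Y z + e) := by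
  have hG := bestGap_nonneg (θ := θ) (Y := Y) (z := (z : Vec d))
  have hh : 0 ≤ ⨆ j, pp (-safe j z) := Real.iSup_nonneg fun _ => pp_nonneg _
  have hu := maxUnsafety_nonneg (μ := μ) (γ := γ) (z := (z : Vec d))
  rcases hu.eq_or_lt with h0 | h0
  · rw [← h0]; linarith
  · have h1 := minAbsSafety_le_maxUnsafety h0
    have h2 := (abs_le.1 (abs_unsafety_sub_le (z := z) fun i => hs.accurate i z)).1
    linarith

end SafeConsequences

lemma MainSetup.rageSetup (h : MainSetup 𝒳 𝒵 θ μ γ ε δ zstar) {n : ℕ} {c : Context 𝒳 𝒵 m}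
    (hs : SafeGuarantee 𝒵 θ μ γ (mainEps consts (n + 1)) c.safe c.Y) {ystar : 𝒵}
    (h1 : ystar ∈ c.Y) (h2 : ∀ y ∈ c.Y, inner ℝ θ (y : Vec d) ≤ inner ℝ θ (ystar : Vec d)) :
    RageSetup (𝒳 := 𝒳) θ Finset.univ c.Y (mainEps consts (n + 1))
      (δ / (4 * ((n + 1 : ℕ) : ℝ) ^ 2)) c.sg ystar where
  design := h.design
  norm_param := h.norm_param
  norm_arm := h.norm_arm
  subset := Finset.subset_univ _
  mem := h1
  le_best := h2
  tol_pos := mainEps_pos _ _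
  delta_pos := by have := h.delta_pos; positivity
  delta_le := by
    have h3 : (1 : ℝ) ≤ ((n + 1 : ℕ) : ℝ) ^ 2 := one_le_pow₀ (by simp)
    rw [div_le_one (by linarith)]
    linarith [h.delta_le]
  slack := fun y hy => by
    rw [← bestGap_eq_pp h1 h2]
    refine pp_le ?_ (add_nonneg bestGap_nonneg (mainEps_pos _ _).le)
    simpa [Context.sg] using hs.unsafety_le_of_mem (mainEps_pos _ _) hy

/-- The event that all estimates of `BESIDE` are accurate. -/
structure AllAccurate (κ : Consts) (sol : Solver 𝒳 𝒵) (θ : Vec d) (μ : Fin m → Vec d) (γ ε δ : ℝ)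
    (data : ℕ → Sample 𝒳 m) : Prop where
  main : ∀ n < rounds κ ε, MainAccurate κ sol μ γ δ data n
  inner : ∀ n < rounds κ ε,
    (context κ sol γ δ data (n + 1) (iter κ sol γ δ data n)).Y.Nonempty →
    ∀ k < epochs κ (mainEps κ (n + 1)), RageAccurate κ sol θ Finset.univ
      (context κ sol γ δ data (n + 1) (iter κ sol γ δ data n)).Y (δ / (4 * ((n + 1 : ℕ) : ℝ) ^ 2))
      (context κ sol γ δ data (n + 1) (iter κ sol γ δ data n)).sg data
      (context κ sol γ δ data (n + 1) (iter κ sol γ δ data n)).trace k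
  final : (endSet κ ε (iter κ sol γ δ data (rounds κ ε))).Nonempty →
    ∀ k < epochs κ ε, RageAccurate κ sol θ (endSet κ ε (iter κ sol γ δ data (rounds κ ε)))
      (endSet κ ε (iter κ sol γ δ data (rounds κ ε))) δ
      (fun z => -(iter κ sol γ δ data (rounds κ ε)).unsafety z) data
      (iter κ sol γ δ data (rounds κ ε)).trace k

lemma MainSetup.pp_gap (h : MainSetup 𝒳 𝒵 θ μ γ ε δ zstar) {data : ℕ → Sample 𝒳 m} {n : ℕ}
    {c : Context 𝒳 𝒵 m} (hs : SafeGuarantee 𝒵 θ μ γ (mainEps consts (n + 1)) c.safe c.Y)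
    (hacc : c.Y.Nonempty → ∀ k < epochs consts (mainEps consts (n + 1)),
      RageAccurate consts sol θ Finset.univ c.Y (δ / (4 * ((n + 1 : ℕ) : ℝ) ^ 2)) c.sg data
        c.trace k) (z : 𝒵) :
    |pp ((innerRage consts sol δ data (n + 1) c).2 z) - bestGap θ c.Y z| ≤
      1 / 10 * ((⨆ j, pp (-c.safe j z)) + bestGap θ c.Y z + mainEps consts (n + 1)) := by
  have he := mainEps_pos consts (n + 1)
  have hh : 0 ≤ ⨆ j, pp (-c.safe j z) := Real.iSup_nonneg fun _ => pp_nonneg _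
  rcases c.Y.eq_empty_or_nonempty with hY | hY
  · rw [innerRage, hY, rage_of_empty, bestGap_empty, pp_of_nonneg le_rfl]
    simp only [sub_zero, abs_zero, add_zero]
    linarith
  · obtain ⟨ystar, h1, h2⟩ := exists_best θ hY
    have h3 := (h.rageSetup hs h1 h2).abs_gap_sub_le (sol := sol) (hacc hY) (Finset.mem_univ z)
    rw [← bestGap_eq_pp h1 h2] at h3
    have h4 : pp (-c.sg z) = ⨆ j, pp (-c.safe j z) := by
      rw [Context.sg, neg_neg, pp_of_nonneg hh]
    rw [h4] at h3
    have h5 := abs_pp_sub_pp_le ((innerRage consts sol δ data (n + 1) c).2 z)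
      (inner ℝ θ ((ystar : Vec d) - z))
    rw [← bestGap_eq_pp h1 h2] at h5
    exact h5.trans h3

/-- The level has three summands: two err by `18 / 1000` of the true level + `3 e`, the third by a
tenth of unsafety + gap + `e`. The total is below the allowed half. -/
lemma MainSetup.mainGuarantee_succ (h : MainSetup 𝒳 𝒵 θ μ γ ε δ zstar)
    {data : ℕ → Sample 𝒳 m} (hacc : AllAccurate consts sol θ μ γ ε δ data) {n : ℕ}
    (hnι : n < rounds consts ε)
    (hn : MainGuarantee θ μ γ (mainEps consts n) (iter consts sol γ δ data n)) :
    MainGuarantee θ μ γ (mainEps consts (n + 1)) (iter consts sol γ δ data (n + 1)) := by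
  have : Nonempty (Fin m) := ⟨⟨0, h.one_le⟩⟩
  have hs := h.safeGuarantee (hacc.main n hnι) hn
  have hgap := h.pp_gap hs (hacc.inner n hnι)
  have hiter : iter consts sol γ δ data (n + 1) =
      step consts sol γ δ data (n + 1) (iter consts sol γ δ data n) := rfl
  rw [hiter, step_eq]
  set c := context consts sol γ δ data (n + 1) (iter consts sol γ δ data n) with hc
  set e := mainEps consts (n + 1) with he
  have he0 : 0 < e := mainEps_pos _ _
  refine ⟨hs.safe_mem, hs.dominates, fun z => ?_⟩
  have h1 := abs_le.1 (abs_unsafety_sub_le (z := z) fun i => hs.accurate i z)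
  have h2 := abs_le.1 (abs_minAbs_sub_le (z := z) fun i => hs.accurate i z)
  have h3 := abs_le.1 (hgap z)
  have hG := bestGap_nonneg (θ := θ) (Y := c.Y) (z := (z : Vec d))
  have h5 := minAbsSafety_nonneg (μ := μ) (γ := γ) (z := (z : Vec d))
  have h6 := maxUnsafety_nonneg (μ := μ) (γ := γ) (z := (z : Vec d))
  change |(⨅ j, |c.safe j z|) + (⨆ j, pp (-c.safe j z)) +
    pp ((innerRage consts sol δ data (n + 1) c).2 z) -
    (minAbsSafety μ γ z + maxUnsafety μ γ z + bestGap θ c.Y z)| ≤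
    1 / 2 * (minAbsSafety μ γ z + maxUnsafety μ γ z + bestGap θ c.Y z + e)
  rw [abs_le]
  constructor <;> linarith [h1.1, h1.2, h2.1, h2.2, h3.1, h3.2]

lemma MainSetup.mainGuarantee (h : MainSetup 𝒳 𝒵 θ μ γ ε δ zstar)
    {data : ℕ → Sample 𝒳 m} (hacc : AllAccurate consts sol θ μ γ ε δ data) {n : ℕ}
    (hn : n ≤ rounds consts ε) :
    MainGuarantee θ μ γ (mainEps consts n) (iter consts sol γ δ data n) := by
  induction n with
  | zero =>
    have : Nonempty (Fin m) := ⟨⟨0, h.one_le⟩⟩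
    -- Safety gaps are at most `2` in absolute value: no arm has margin `4`, and the initial level
    -- `0` replaces a true level of at most `4`.
    have he : mainEps consts 0 = 4 := by simp [mainEps, consts]; norm_num
    rw [he]
    have hY : (iter consts sol γ δ data 0).Y = ∅ := rfl
    refine ⟨fun z hz => by simp [hY] at hz, fun e' he' z => ?_, fun z => ?_⟩
    · refine ppEpsGap_le bestGap_nonneg fun z' hz' hsafe => ?_
      have h1 := hsafe ⟨0, h.one_le⟩
      have h2 := (abs_le.1 (abs_safetyGap_le_two h.norm_safety h.abs_threshold
        (h.norm_arm z' hz') ⟨0, h.one_le⟩)).2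
      linarith
    · have h1 : (iter consts sol γ δ data 0).level z = 0 := by
        simp [iter, State.level, State.unsafety, pp]
      have h2 := fun i => abs_safetyGap_le_two h.norm_safety h.abs_threshold
        (h.norm_arm z z.2) i
      have h3 : minAbsSafety μ γ z ≤ 2 := (minAbsSafety_le ⟨0, h.one_le⟩).trans (h2 _)
      have h4 : maxUnsafety μ γ z ≤ 2 := maxUnsafety_le (by norm_num) fun i => (abs_le.1 (h2 i)).1
      have h5 := minAbsSafety_nonneg (μ := μ) (γ := γ) (z := (z : Vec d))
      have h6 := maxUnsafety_nonneg (μ := μ) (γ := γ) (z := (z : Vec d))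
      rw [h1, hY, bestGap_empty, zero_sub, abs_neg, abs_of_nonneg (by linarith)]
      linarith
  | succ n ih => exact h.mainGuarantee_succ hacc hn (ih (Nat.le_of_succ_le hn))

/-- What holds for the candidates for the returned arm. -/
structure EndGuarantee (𝒵 : Finset (Vec d)) (μ : Fin m → Vec d) (γ ε : ℝ) (zstar : Vec d)
    (Yend : Finset 𝒵) (st : State 𝒳 𝒵 m) : Prop where
  best_mem : ∃ z ∈ Yend, (z : Vec d) = zstar
  safe : ∀ z ∈ Yend, ∀ i, -ε ≤ safetyGap μ γ i (z : Vec d)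
  unsafety : ∀ z ∈ Yend, st.unsafety z ≤ ε

/-- The true level is at most twice the estimated one plus the scale, so the safety error is at most
the `cy` part of the threshold; passing the test leaves a gap of at least `-ε`. For `z_*` unsafety
and gap to the safe set vanish, so the threshold and the error are small multiples of its smallest
safety gap, up to terms that `cg * ε` forgives. -/
lemma MainSetup.endGuarantee (h : MainSetup 𝒳 𝒵 θ μ γ ε δ zstar)
    {data : ℕ → Sample 𝒳 m} (hacc : AllAccurate consts sol θ μ γ ε δ data) :
    EndGuarantee 𝒵 μ γ ε zstar (endSet consts ε (iter consts sol γ δ data (rounds consts ε)))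
      (iter consts sol γ δ data (rounds consts ε)) := by
  have hε := h.eps_pos
  have hle := mainEps_rounds_le (κ := consts) hε
  set st := iter consts sol γ δ data (rounds consts ε) with hst
  have hmem : ∀ z : 𝒵, z ∈ endSet consts ε st ↔
      ∀ i, 36 * (1 / 1000 * st.level z + (1 / 1000 + 1 / 1000) * ε) - 1 * ε ≤ st.safe i z := by
    intro z
    unfold endSet
    rw [Finset.mem_filter]
    exact ⟨fun hz => hz.2, fun hz => ⟨Finset.mem_univ _, hz⟩⟩
  have hun : ∀ z ∈ endSet consts ε st, st.unsafety z ≤ ε := by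
    intro z hz
    refine Real.iSup_le (fun i => pp_le ?_ hε.le) hε.le
    have h1 := (hmem z).1 hz i
    have h2 := st.level_nonneg z
    linarith
  -- Without any round `ε ≥ 4`: all estimates are `0`, `z_*` passes the test, and every safety gap
  -- is at least `-2`.
  rcases Nat.eq_zero_or_pos (rounds consts ε) with h0 | h0
  · have he : mainEps consts 0 = 4 := by simp [mainEps, consts]; norm_num
    rw [h0, he] at hle
    have hsafe0 : ∀ i z, st.safe i z = 0 := by intro i z; rw [hst, h0]; rfl
    have hlevel0 : ∀ z, st.level z = 0 := by
      intro z
      rw [hst, h0]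
      simp [iter, State.level, State.unsafety, pp]
    refine ⟨⟨⟨zstar, h.best.1⟩, (hmem _).2 fun i => ?_, rfl⟩, fun z _ i => ?_, hun⟩
    · rw [hsafe0, hlevel0]; linarith
    · have := (abs_le.1 (abs_safetyGap_le_two h.norm_safety h.abs_threshold (h.norm_arm z z.2) i)).1
      linarith
  · obtain ⟨n, hn⟩ := Nat.exists_eq_succ_of_ne_zero h0.ne'
    have hnι : n < rounds consts ε := by omega
    have hs := h.safeGuarantee (hacc.main n hnι) (h.mainGuarantee hacc hnι.le)
    have hg := h.mainGuarantee hacc le_rfl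
    rw [← hst] at hg
    have hsafe : (context consts sol γ δ data (n + 1) (iter consts sol γ δ data n)).safe = st.safe :=
      by rw [hst, hn]; rfl
    have hY : (context consts sol γ δ data (n + 1) (iter consts sol γ δ data n)).Y = st.Y := by
      rw [hst, hn]; rfl
    have hn' : rounds consts ε = n + 1 := hn
    rw [hsafe, hY, ← hn'] at hs
    set e := mainEps consts (rounds consts ε) with he
    have he0 : 0 < e := mainEps_pos _ _
    refine ⟨⟨⟨zstar, h.best.1⟩, (hmem _).2 fun i => ?_, rfl⟩, fun z hz i => ?_, hun⟩
    · have h1 := (abs_le.1 (hs.accurate i ⟨zstar, h.best.1⟩)).1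
      have h2 := (abs_le.1 (hg.level ⟨zstar, h.best.1⟩)).2
      have h3 : maxUnsafety μ γ zstar = 0 := maxUnsafety_of_safe h.best.2.1
      have h4 : bestGap θ st.Y zstar = 0 := by
        refine le_antisymm (bestGap_le le_rfl fun y hy => ?_) bestGap_nonneg
        have := h.best.2.2 y y.2 (hs.safe_mem y hy)
        rw [inner_sub_right]; linarith
      have h5 := minAbsSafety_le (μ := μ) (γ := γ) (z := zstar) i
      rw [abs_of_nonneg (h.best.2.1 i)] at h5
      have h6 := minAbsSafety_nonneg (μ := μ) (γ := γ) (z := zstar)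
      simp only [h3, h4] at h1 h2
      linarith
    · have h1 := (hmem z).1 hz i
      have h2 := (abs_le.1 (hs.accurate i z)).2
      have h3 := (abs_le.1 (hg.level z)).1
      linarith

lemma EndGuarantee.rageSetup (h : MainSetup 𝒳 𝒵 θ μ γ ε δ zstar) {Yend : Finset 𝒵}
    {st : State 𝒳 𝒵 m} (hend : EndGuarantee 𝒵 μ γ ε zstar Yend st) {ystar : 𝒵}
    (h1 : ystar ∈ Yend) (h2 : ∀ y ∈ Yend, inner ℝ θ (y : Vec d) ≤ inner ℝ θ (ystar : Vec d)) :
    RageSetup (𝒳 := 𝒳) θ Yend Yend ε δ (fun z => -st.unsafety z) ystar where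
  design := h.design
  norm_param := h.norm_param
  norm_arm := h.norm_arm
  subset := subset_rfl
  mem := h1
  le_best := h2
  tol_pos := h.eps_pos
  delta_pos := h.delta_pos
  delta_le := h.delta_le
  slack := fun y hy => by
    have h3 := hend.unsafety y hy
    have h4 := pp_nonneg (inner ℝ θ ((ystar : Vec d) - y))
    have h5 := h.eps_pos
    simp only [neg_neg]
    exact pp_le (by linarith) (by linarith)

/-- `BESIDE` returns a nearly optimal and nearly safe arm. -/
lemma MainSetup.beside_correct (h : MainSetup 𝒳 𝒵 θ μ γ ε δ zstar)
    {data : ℕ → Sample 𝒳 m} (hacc : AllAccurate consts sol θ μ γ ε δ data) :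
    inner ℝ θ zstar - ε ≤ inner ℝ θ ((beside consts sol γ ε δ data).2 : Vec d) ∧
      ∀ i, -ε ≤ safetyGap μ γ i ((beside consts sol γ ε δ data).2 : Vec d) := by
  have hend := h.endGuarantee hacc
  have hε := h.eps_pos
  rw [beside_eq]
  set st := iter consts sol γ δ data (rounds consts ε) with hst
  set Y := endSet consts ε st with hY
  obtain ⟨z0, hz0, hz0'⟩ := hend.best_mem
  have hne : Y.Nonempty := ⟨z0, hz0⟩
  obtain ⟨ystar, h1, h2⟩ := exists_best θ hne
  have hset := hend.rageSetup h h1 h2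
  have hgap : ∀ z ∈ Y, |(endRage consts sol ε δ data st).2 z - inner ℝ θ ((ystar : Vec d) - z)| ≤
      1 / 10 * (inner ℝ θ ((ystar : Vec d) - z) + 2 * ε) := by
    intro z hz
    have h3 := hset.abs_gap_sub_le (sol := sol) (hacc.final hne) hz
    refine h3.trans ?_
    have h4 : pp (- -st.unsafety z) ≤ ε := by
      rw [neg_neg]; exact pp_le (hend.unsafety z hz) hε.le
    have h5 : pp (inner ℝ θ ((ystar : Vec d) - z)) = inner ℝ θ ((ystar : Vec d) - z) := by
      refine pp_of_nonneg ?_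
      have := h2 z hz
      rw [inner_sub_right]; linarith
    rw [h5]
    linarith
  obtain ⟨hz, hmin⟩ := sol.argmax_spec Y (fun z => -(endRage consts sol ε δ data st).2 z) hne
  set zhat := sol.argmax Y fun z => -(endRage consts sol ε δ data st).2 z with hzhat
  refine ⟨?_, fun i => hend.safe zhat hz i⟩
  -- The estimated gap of the returned arm is at most that of `ystar`, hence at most `ε / 5`; its
  -- true gap `g` satisfies `9 g / 10 ≤ 2 ε / 5`. As `z_*` is a candidate, `ystar` is at least as
  -- good.
  have e1 := (abs_le.1 (hgap zhat hz)).1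
  have e2 := (abs_le.1 (hgap ystar h1)).2
  have e3 := hmin ystar h1
  have e4 := h2 z0 hz0
  rw [hz0'] at e4
  change -(endRage consts sol ε δ data st).2 ystar ≤ -(endRage consts sol ε δ data st).2 zhat at e3
  simp only [inner_sub_right] at e1 e2
  change inner ℝ θ zstar - ε ≤ inner ℝ θ (zhat : Vec d)
  linarith

end Main

/-! ### Comparison designs extracted from the complexity terms -/

section DesignTerms

variable {d m : ℕ} {𝒳 𝒵 : Finset (Vec d)}

/-- A supremum over scales of optimal design values is attained up to `1` by some design at every
scale. -/
lemma exists_design_le {N : (𝒳 → ℝ) → 𝒵 → ℝ} {D : ℝ → 𝒵 → ℝ} (hd : ∃ lam, IsDesign 𝒳 lam)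
    (hN : ∀ lam, IsDesign 𝒳 lam → ∀ z, 0 ≤ N lam z) {ε : ℝ} (hε : 0 < ε)
    (hD : ∀ e z, e ≤ D e z) {e : ℝ} (he : ε ≤ e) :
    ∃ lam, IsDesign 𝒳 lam ∧ ∀ z, N lam z ≤
      ((⨆ e : {e : ℝ // ε ≤ e}, ⨅ lam : {lam : 𝒳 → ℝ // IsDesign 𝒳 lam}, ⨆ z : 𝒵,
        N lam z / (D e z) ^ 2) + 1) * (D e z) ^ 2 := by
  obtain ⟨lam₀, h₀⟩ := hd
  have : Nonempty {lam : 𝒳 → ℝ // IsDesign 𝒳 lam} := ⟨⟨lam₀, h₀⟩⟩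
  have hbelow : ∀ e : {e : ℝ // ε ≤ e}, BddBelow (Set.range fun lam : {lam // IsDesign 𝒳 lam} =>
      ⨆ z : 𝒵, N lam z / (D e z) ^ 2) := fun e =>
    ⟨0, by
      rintro _ ⟨lam, rfl⟩
      exact Real.iSup_nonneg fun z => div_nonneg (hN _ lam.2 z) (sq_nonneg _)⟩
  -- An unbounded real supremum would default to `0`; the additive `ε` in the denominators gives a
  -- bound uniform in the scale.
  have habove : BddAbove (Set.range fun e : {e : ℝ // ε ≤ e} =>
      ⨅ lam : {lam : 𝒳 → ℝ // IsDesign 𝒳 lam}, ⨆ z : 𝒵, N lam z / (D e z) ^ 2) := by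
    refine ⟨∑ z, N lam₀ z / ε ^ 2, ?_⟩
    rintro _ ⟨e, rfl⟩
    have hnn : ∀ z ∈ Finset.univ, 0 ≤ N lam₀ z / ε ^ 2 := fun z _ =>
      div_nonneg (hN _ h₀ z) (sq_nonneg _)
    refine (ciInf_le (hbelow e) ⟨lam₀, h₀⟩).trans
      (Real.iSup_le (fun z => ?_) (Finset.sum_nonneg hnn))
    refine le_trans ?_ (Finset.single_le_sum hnn (Finset.mem_univ z))
    have h1 : ε ≤ D e z := e.2.trans (hD e z)
    have h2 := hN _ h₀ z
    gcongr
  have h1 := le_ciSup habove ⟨e, he⟩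
  obtain ⟨lam, hlam⟩ := exists_lt_of_ciInf_lt (lt_of_le_of_lt h1 (lt_add_one _))
  refine ⟨lam, lam.2, fun z => ?_⟩
  have h2 := (le_ciSup (f := fun z : 𝒵 => N lam z / (D e z) ^ 2) (Finite.bddAbove_range _) z).trans
    hlam.le
  have h3 : 0 < D e z := hε.trans_le (he.trans (hD e z))
  rwa [div_le_iff₀ (by positivity)] at h2

variable {θ : Vec d} {μ : Fin m → Vec d} {γ ε δ : ℝ} {zstar : Vec d}

lemma safetyTerm_nonneg (hL : 0 ≤ Real.log (2 * m * 𝒵.card / δ)) :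
    0 ≤ safetyTerm 𝒵 θ μ γ 𝒳 ε δ :=
  Real.iSup_nonneg fun _ => Real.iInf_nonneg fun lam => Real.iSup_nonneg fun _ =>
    div_nonneg (mul_nonneg (lam.2.invNormSq_nonneg _) hL) (sq_nonneg _)

lemma optimalityTerm_nonneg (hL : 0 ≤ Real.log (2 * 𝒵.card / δ)) :
    0 ≤ optimalityTerm 𝒵 θ μ γ 𝒳 zstar ε δ :=
  Real.iSup_nonneg fun _ => Real.iInf_nonneg fun lam => Real.iSup_nonneg fun _ =>
    div_nonneg (mul_nonneg (lam.2.invNormSq_nonneg _) hL) (sq_nonneg _)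

lemma exists_design_safety (hd : ∃ lam, IsDesign 𝒳 lam) (hε : 0 < ε)
    (hL : 0 ≤ Real.log (2 * m * 𝒵.card / δ)) {e : ℝ} (he : ε ≤ e) :
    ∃ lam, IsDesign 𝒳 lam ∧ ∀ z : 𝒵, invNormSq 𝒳 lam z * Real.log (2 * m * 𝒵.card / δ) ≤
      (safetyTerm 𝒵 θ μ γ 𝒳 ε δ + 1) *
        (minAbsSafety μ γ z + maxUnsafety μ γ z + ppEpsGap 𝒵 θ μ γ e z + e) ^ 2 :=
  exists_design_le (N := fun lam z => invNormSq 𝒳 lam z * Real.log (2 * m * 𝒵.card / δ))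
    (D := fun e z => minAbsSafety μ γ z + maxUnsafety μ γ z + ppEpsGap 𝒵 θ μ γ e z + e) hd
    (fun _ h _ => mul_nonneg (h.invNormSq_nonneg _) hL) hε
    (fun e z => by
      have h1 := minAbsSafety_nonneg (μ := μ) (γ := γ) (z := (z : Vec d))
      have h2 := maxUnsafety_nonneg (μ := μ) (γ := γ) (z := (z : Vec d))
      have h3 := ppEpsGap_nonneg (𝒵 := 𝒵) (θ := θ) (μ := μ) (γ := γ) (z := (z : Vec d)) (e := e)
      linarith) he

lemma exists_design_optimality (hd : ∃ lam, IsDesign 𝒳 lam) (hε : 0 < ε)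
    (hL : 0 ≤ Real.log (2 * 𝒵.card / δ)) {e : ℝ} (he : ε ≤ e) :
    ∃ lam, IsDesign 𝒳 lam ∧ ∀ z : 𝒵, invNormSq 𝒳 lam (z - zstar) * Real.log (2 * 𝒵.card / δ) ≤
      (optimalityTerm 𝒵 θ μ γ 𝒳 zstar ε δ + 1) *
        (maxUnsafety μ γ z + ppEpsGap 𝒵 θ μ γ e z + e) ^ 2 :=
  exists_design_le (N := fun lam z => invNormSq 𝒳 lam (z - zstar) * Real.log (2 * 𝒵.card / δ))
    (D := fun e z => maxUnsafety μ γ z + ppEpsGap 𝒵 θ μ γ e z + e) hd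
    (fun _ h _ => mul_nonneg (h.invNormSq_nonneg _) hL) hε
    (fun e z => by
      have h2 := maxUnsafety_nonneg (μ := μ) (γ := γ) (z := (z : Vec d))
      have h3 := ppEpsGap_nonneg (𝒵 := 𝒵) (θ := θ) (μ := μ) (γ := γ) (z := (z : Vec d)) (e := e)
      linarith) he

end DesignTerms

/-! ### Logarithmic factors and numbers of rounds -/

section Logarithms

lemma natCast_le_pow {a : ℝ} (ha : 2 ≤ a) {k : ℕ} (hk : 1 ≤ k) : (k : ℝ) ≤ a ^ (k - 1) := by
  obtain ⟨j, rfl⟩ := Nat.exists_eq_add_of_le' hk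
  have h : ((j + 1 : ℕ) : ℝ) ≤ 2 ^ j := by exact_mod_cast Nat.succ_le_of_lt j.lt_two_pow_self
  exact h.trans (pow_le_pow_left₀ (by norm_num) ha _)

lemma sq_natCast_le_pow {a : ℝ} (ha : 2 ≤ a) {k : ℕ} (hk : 1 ≤ k) :
    (k : ℝ) ^ 2 ≤ a ^ (2 * k - 2) := by
  refine (pow_le_pow_left₀ (Nat.cast_nonneg k) (natCast_le_pow ha hk) 2).trans (le_of_eq ?_)
  rw [← pow_mul]
  congr 1
  omega

lemma log_le_mul_log_of_le_pow {x a : ℝ} (hx : 0 < x) {n : ℕ} (h : x ≤ a ^ n) :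
    Real.log x ≤ n * Real.log a := by
  rw [← Real.log_pow]
  exact Real.log_le_log hx h

variable {d m : ℕ} {𝒵 : Finset (Vec d)} {δ : ℝ}

lemma two_le_div (hδ : 0 < δ) (hδ1 : δ ≤ 1) {c : ℝ} (hc : 1 ≤ c) : 2 ≤ 2 * c / δ := by
  rw [le_div_iff₀ hδ]; linarith

/-- The crude bound `ℓ² ≤ a ^ (2 ℓ - 2)` replaces `log ℓ²` by a factor linear in `ℓ`, which is
harmless since `ℓ` is of order `log (1 / ε)`. -/
lemma mainLog_le (h𝒵 : 𝒵.Nonempty) (hm : 1 ≤ m) (hδ : 0 < δ) (hδ1 : δ ≤ 1) {ℓ : ℕ} (hℓ : 1 ≤ ℓ) :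
    mainLog 𝒵 m (δ / 2) ℓ ≤ 4 * ℓ * Real.log (2 * m * 𝒵.card / δ) := by
  have h1 : (1 : ℝ) ≤ 𝒵.card := by exact_mod_cast h𝒵.card_pos
  have h3 : (1 : ℝ) ≤ m := by exact_mod_cast hm
  have ha : 2 ≤ 2 * m * 𝒵.card / δ := by
    rw [mul_assoc]; exact two_le_div hδ hδ1 (one_le_mul_of_one_le_of_one_le h3 h1)
  set a := 2 * m * 𝒵.card / δ with ha'
  have hℓ' : (1 : ℝ) ≤ ℓ := by exact_mod_cast hℓ
  have h4 : 4 * m * 𝒵.card * (ℓ : ℝ) ^ 2 / (δ / 2) = 2 ^ 2 * ((ℓ : ℝ) ^ 2) * a := by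
    rw [ha']; field_simp; ring
  have h5 : 4 * m * 𝒵.card * (ℓ : ℝ) ^ 2 / (δ / 2) ≤ a ^ (4 * ℓ) := by
    rw [h4]
    calc 2 ^ 2 * ((ℓ : ℝ) ^ 2) * a ≤ a ^ 2 * a ^ (2 * ℓ - 2) * a := by
          gcongr
          exact sq_natCast_le_pow ha hℓ
      _ = a ^ (2 + (2 * ℓ - 2) + 1) := by rw [pow_add, pow_add, pow_one]
      _ ≤ a ^ (4 * ℓ) := pow_le_pow_right₀ (by linarith) (by omega)
  have h6 := log_le_mul_log_of_le_pow (by rw [h4]; positivity) h5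
  push_cast at h6
  exact h6

/-- The lower bound on `δ'` is an equality for the call in round `ℓ` of a run with confidence `δ /
2`; the final call is covered by `ℓ = 1`. -/
lemma rageLog_le (h𝒵 : 𝒵.Nonempty) {S : Finset 𝒵} (hS : S.Nonempty) (hδ : 0 < δ) (hδ1 : δ ≤ 1)
    {k ℓ : ℕ} (hk : 1 ≤ k) (hℓ : 1 ≤ ℓ) {δ' : ℝ} (hδ' : δ / (8 * (ℓ : ℝ) ^ 2) ≤ δ') :
    rageLog S δ' k ≤ 4 * (k + ℓ) * Real.log (2 * 𝒵.card / δ) := by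
  have h1 : (1 : ℝ) ≤ 𝒵.card := by exact_mod_cast h𝒵.card_pos
  have hb : 2 ≤ 2 * 𝒵.card / δ := two_le_div hδ hδ1 h1
  set b := 2 * 𝒵.card / δ with hb'
  have hS1 : (1 : ℝ) ≤ S.card := by exact_mod_cast hS.card_pos
  have hS2 : (S.card : ℝ) ≤ 𝒵.card := by
    have := Finset.card_le_univ S
    rw [Fintype.card_coe] at this
    exact_mod_cast this
  have hℓ' : (1 : ℝ) ≤ ℓ := by exact_mod_cast hℓ
  have hk' : (1 : ℝ) ≤ k := by exact_mod_cast hk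
  have hδ0 : 0 < δ / (8 * (ℓ : ℝ) ^ 2) := by positivity
  have h5 : 4 * (S.card : ℝ) ^ 2 * (k : ℝ) ^ 2 / δ' ≤ b ^ (4 * (k + ℓ)) := by
    calc 4 * (S.card : ℝ) ^ 2 * (k : ℝ) ^ 2 / δ'
        ≤ 4 * (𝒵.card : ℝ) ^ 2 * (k : ℝ) ^ 2 / (δ / (8 * (ℓ : ℝ) ^ 2)) := by gcongr
      _ = 2 ^ 3 * (k : ℝ) ^ 2 * (ℓ : ℝ) ^ 2 * b ^ 2 * δ := by rw [hb']; field_simp; ring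
      _ ≤ 2 ^ 3 * (k : ℝ) ^ 2 * (ℓ : ℝ) ^ 2 * b ^ 2 * 1 := by gcongr
      _ ≤ b ^ 3 * b ^ (2 * k - 2) * b ^ (2 * ℓ - 2) * b ^ 2 * 1 := by
          gcongr
          · exact sq_natCast_le_pow hb hk
          · exact sq_natCast_le_pow hb hℓ
      _ = b ^ (3 + (2 * k - 2) + (2 * ℓ - 2) + 2) := by rw [pow_add, pow_add, pow_add, mul_one]
      _ ≤ b ^ (4 * (k + ℓ)) := pow_le_pow_right₀ (by linarith) (by omega)
  have h6 := log_le_mul_log_of_le_pow (by have := hδ0.trans_le hδ'; positivity) h5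
  push_cast at h6
  exact h6

lemma log_two_le_log_scale {ε : ℝ} (hε : 0 < ε) : Real.log 2 ≤ Real.log (2 + 1 / ε) :=
  Real.log_le_log (by norm_num) (by have := one_div_pos.2 hε; linarith)

lemma ceil_logb_le {ε x : ℝ} (hε : 0 < ε) (hx : 0 < x) {j : ℕ} (h : x ≤ 2 ^ j / ε) :
    (⌈Real.logb 2 x⌉₊ : ℝ) ≤ 3 / 2 * (j + 2) * Real.log (2 + 1 / ε) := by
  have h2 := log_two_le_log_scale hε
  have h3 := Real.log_two_gt_d9
  have hpos : 0 < 1 / ε := one_div_pos.2 hε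
  have hle : Real.logb 2 x ≤ j + Real.log (2 + 1 / ε) / Real.log 2 := by
    have : x ≤ 2 ^ j * (2 + 1 / ε) := by
      refine h.trans ?_
      rw [mul_add, mul_one_div]
      have : (0 : ℝ) < 2 ^ j := by positivity
      linarith
    have h5 : Real.log x ≤ j * Real.log 2 + Real.log (2 + 1 / ε) := by
      refine (Real.log_le_log hx this).trans (le_of_eq ?_)
      rw [Real.log_mul (by positivity) (by positivity), Real.log_pow]
    rw [Real.logb, div_le_iff₀ (by linarith), add_mul, div_mul_cancel₀ _ (by linarith)]
    exact h5
  have h6 : Real.log (2 + 1 / ε) / Real.log 2 ≤ 3 / 2 * Real.log (2 + 1 / ε) := by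
    rw [div_le_iff₀ (by linarith)]; nlinarith
  have h7 : (⌈Real.logb 2 x⌉₊ : ℝ) ≤ j + 3 / 2 * Real.log (2 + 1 / ε) + 1 := by
    have h8 := Nat.ceil_mono (hle.trans (add_le_add_right h6 _))
    have h9 := (Nat.ceil_lt_add_one (a := (j : ℝ) + 3 / 2 * Real.log (2 + 1 / ε))
      (add_nonneg (Nat.cast_nonneg _) (by linarith))).le
    exact (Nat.cast_le.2 h8).trans h9
  have h8 : (0 : ℝ) ≤ j := Nat.cast_nonneg j
  have h9 : 1 ≤ 3 / 2 * Real.log (2 + 1 / ε) := by linarith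
  nlinarith

lemma rounds_le {ε : ℝ} (hε : 0 < ε) : (rounds consts ε : ℝ) ≤ 12 * Real.log (2 + 1 / ε) := by
  have h : (2 : ℝ) / (consts.c0 * ε) ≤ 2 ^ 2 / ε := by
    refine le_of_eq ?_
    simp only [consts]; field_simp
  have h1 := ceil_logb_le hε (by have := consts.c0_pos; positivity) h
  have h2 := log_two_le_log_scale hε
  have h3 := Real.log_two_gt_d9
  refine h1.trans ?_
  push_cast
  nlinarith

/-- The tolerance is allowed down to `ε / 2` because the scale of the last round can undershoot `ε`
by a factor `2`. -/
lemma epochs_le {ε tol : ℝ} (hε : 0 < ε) (htol : ε / 2 ≤ tol) :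
    (epochs consts tol : ℝ) ≤ 12 * Real.log (2 + 1 / ε) := by
  have h0 : 0 < tol := by linarith
  have h : (2 : ℝ) / (consts.cf * tol) ≤ 2 ^ 6 / ε := by
    simp only [consts]
    rw [div_le_div_iff₀ (by positivity) hε]
    nlinarith
  have h1 := ceil_logb_le hε (by have := consts.cf_pos; positivity) h
  refine h1.trans (le_of_eq ?_)
  push_cast
  ring

end Logarithms

/-! ### Sample complexity on the good event -/

section SampleCount

variable {d m : ℕ} {𝒳 𝒵 : Finset (Vec d)} {sol : Solver 𝒳 𝒵} {θ : Vec d} {μ : Fin m → Vec d}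
  {γ ε δ : ℝ} {zstar : Vec d}

/-- The number of samples a round of `BESIDE` devotes to safety. -/
lemma MainSetup.mainLen_le (h : MainSetup 𝒳 𝒵 θ μ γ ε δ zstar) {n : ℕ} {st : State 𝒳 𝒵 m}
    (hg : MainGuarantee θ μ γ (mainEps consts n) st) {Lm M Λ : ℝ} (hLm : 0 < Lm) (hM : 0 ≤ M)
    (hΛ : mainLog 𝒵 m δ (n + 1) ≤ Λ * Lm)
    (hterm : ∃ lam, IsDesign 𝒳 lam ∧ ∀ z : 𝒵, invNormSq 𝒳 lam z * Lm ≤ M *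
      (minAbsSafety μ γ z + maxUnsafety μ γ z + ppEpsGap 𝒵 θ μ γ (mainEps consts n) z +
        mainEps consts n) ^ 2) :
    (mainLen consts 𝒳 m δ (n + 1) st.level : ℝ) ≤ 8 * (Λ * Lm) + 8000000 * (Λ * M) := by
  obtain ⟨lam, hlam, ht⟩ := hterm
  have hL := one_le_mainLog h.nonempty h.one_le h.delta_pos h.delta_le (Nat.le_add_left 1 n)
  set L := mainLog 𝒵 m δ (n + 1) with hLdef
  have he : 0 < mainEps consts (n + 1) := mainEps_pos _ _
  have hek : mainEps consts n = 2 * mainEps consts (n + 1) := by rw [mainEps_succ]; ring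
  rw [hek] at hg ht
  set e := mainEps consts (n + 1) with hedef
  have hslack : ∀ z : 𝒵, mainSlack consts (n + 1) st.level z + consts.ce * e =
      1 / 1000 * (st.level z + 2 * e) := by
    intro z
    change 1 / 1000 * (st.level z + e) + 1 / 1000 * e = _
    ring
  -- `4000000 = 2² · 1000²`: the denominator is at most twice level + `2 e`, of which the algorithm
  -- grants a thousandth.
  have hX : 0 ≤ L / Lm * M * 4000000 := by positivity
  have h1 := stageLen_le (S := (Finset.univ : Finset 𝒵)) (v := fun z => (z : Vec d)) (L := L)
    (thr := consts.ce * e) (b := mainSlack consts (n + 1) st.level) hlam hX (by linarith)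
    (fun z _ => by rw [hslack]; have := st.level_nonneg z; positivity) fun z _ => by
      rw [hslack]
      set D := minAbsSafety μ γ z + maxUnsafety μ γ z + ppEpsGap 𝒵 θ μ γ (2 * e) z + 2 * e
        with hD
      have hl := st.level_nonneg z
      have hD0 : 0 ≤ D := by
        have h1 := minAbsSafety_nonneg (μ := μ) (γ := γ) (z := (z : Vec d))
        have h2 := maxUnsafety_nonneg (μ := μ) (γ := γ) (z := (z : Vec d))
        have h3 := ppEpsGap_nonneg (𝒵 := 𝒵) (θ := θ) (μ := μ) (γ := γ) (z := (z : Vec d))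
          (e := 2 * e)
        linarith
      have hD1 : D ≤ 2 * (st.level z + 2 * e) := by
        have h1 := (abs_le.1 (hg.level z)).1
        have h2 := hg.dominates (2 * e) le_rfl z
        linarith
      calc invNormSq 𝒳 lam z * L = L / Lm * (invNormSq 𝒳 lam z * Lm) := by field_simp
        _ ≤ L / Lm * (M * D ^ 2) := by
            refine mul_le_mul_of_nonneg_left (ht z) (by positivity)
        _ ≤ L / Lm * (M * (2 * (st.level z + 2 * e)) ^ 2) := by gcongr
        _ = _ := by ring
  have h5 : L / Lm ≤ Λ := by rwa [div_le_iff₀ hLm]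
  have h6 : L / Lm * M ≤ Λ * M := mul_le_mul_of_nonneg_right h5 hM
  change (stageLen 𝒳 𝒵 Finset.univ (fun z => (z : Vec d)) L (consts.ce * e)
    (mainSlack consts (n + 1) st.level) : ℝ) ≤ _
  linarith

/-- The number of samples of the call of `RAGE^ε` in a round of `BESIDE`. -/
lemma MainSetup.innerRage_time_le (h : MainSetup 𝒳 𝒵 θ μ γ ε δ zstar) {data : ℕ → Sample 𝒳 m}
    {n : ℕ} {c : Context 𝒳 𝒵 m}
    (hs : SafeGuarantee 𝒵 θ μ γ (mainEps consts (n + 1)) c.safe c.Y)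
    (hacc : c.Y.Nonempty → ∀ k < epochs consts (mainEps consts (n + 1)),
      RageAccurate consts sol θ Finset.univ c.Y (δ / (4 * ((n + 1 : ℕ) : ℝ) ^ 2)) c.sg data
        c.trace k)
    {Lz M Λ : ℝ} (hLz : 0 < Lz) (hM : 0 ≤ M) (hΛ0 : 0 ≤ Λ)
    (hΛ : ∀ k < epochs consts (mainEps consts (n + 1)),
      rageLog (Finset.univ : Finset 𝒵) (δ / (4 * ((n + 1 : ℕ) : ℝ) ^ 2)) (k + 1) ≤ Λ * Lz)
    (hterm : ∀ e, mainEps consts n ≤ e → ∃ lam, IsDesign 𝒳 lam ∧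
      ∀ z : 𝒵, invNormSq 𝒳 lam (z - zstar) * Lz ≤
        M * (maxUnsafety μ γ z + ppEpsGap 𝒵 θ μ γ e z + e) ^ 2) :
    ((innerRage consts sol δ data (n + 1) c).1.time : ℝ) ≤ c.trace.time +
      epochs consts (mainEps consts (n + 1)) * (8 * (Λ * Lz) + 5400000000 * (Λ * M)) := by
  have : Nonempty (Fin m) := ⟨⟨0, h.one_le⟩⟩
  have he := mainEps_pos consts (n + 1)
  rcases c.Y.eq_empty_or_nonempty with hY | hY
  · rw [innerRage, hY, rage_of_empty]
    have : 0 ≤ epochs consts (mainEps consts (n + 1)) *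
      (8 * (Λ * Lz) + 5400000000 * (Λ * M)) := by positivity
    linarith
  · obtain ⟨ystar, h1, h2⟩ := exists_best θ hY
    refine (h.rageSetup hs h1 h2).rage_time_le (sol := sol) (zstar := zstar) (hacc hY) hLz hM hΛ fun e hle => ?_
    -- The tolerance of this call may be below `ε`, where the complexity terms say nothing; the
    -- previous scale, its double, is above `ε`.
    have hek : mainEps consts n = 2 * mainEps consts (n + 1) := by rw [mainEps_succ]; ring
    obtain ⟨lam, hlam, ht⟩ := hterm e (by rw [hek]; exact hle)
    refine ⟨lam, hlam, fun z => maxUnsafety μ γ z + ppEpsGap 𝒵 θ μ γ e z + e, fun z => ?_,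
      fun z _ => ?_, fun z _ => ht z⟩
    · have h4 := maxUnsafety_nonneg (μ := μ) (γ := γ) (z := (z : Vec d))
      have h3 := ppEpsGap_nonneg (𝒵 := 𝒵) (θ := θ) (μ := μ) (γ := γ) (z := (z : Vec d)) (e := e)
      linarith
    · have h3 := hs.maxUnsafety_le he z
      have h4 := hs.dominates e (by linarith) z
      have h5 : pp (-c.sg z) = ⨆ j, pp (-c.safe j z) := by
        rw [Context.sg, neg_neg, pp_of_nonneg (Real.iSup_nonneg fun _ => pp_nonneg _)]
      rw [h5, ← bestGap_eq_pp h1 h2]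
      linarith

/-- The number of samples of the final call of `RAGE^ε`. -/
lemma EndGuarantee.endRage_time_le (h : MainSetup 𝒳 𝒵 θ μ γ ε δ zstar) {data : ℕ → Sample 𝒳 m}
    {st : State 𝒳 𝒵 m} (hend : EndGuarantee 𝒵 μ γ ε zstar (endSet consts ε st) st)
    (hacc : (endSet consts ε st).Nonempty → ∀ k < epochs consts ε,
      RageAccurate consts sol θ (endSet consts ε st) (endSet consts ε st) δ
        (fun z => -st.unsafety z) data st.trace k)
    {Lz M Λ : ℝ} (hLz : 0 < Lz) (hM : 0 ≤ M)
    (hΛ : ∀ k < epochs consts ε, rageLog (endSet consts ε st) δ (k + 1) ≤ Λ * Lz)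
    (hterm : ∀ e, ε ≤ e → ∃ lam, IsDesign 𝒳 lam ∧
      ∀ z : 𝒵, invNormSq 𝒳 lam (z - zstar) * Lz ≤
        M * (maxUnsafety μ γ z + ppEpsGap 𝒵 θ μ γ e z + e) ^ 2) :
    ((endRage consts sol ε δ data st).1.time : ℝ) ≤ st.trace.time +
      epochs consts ε * (8 * (Λ * Lz) + 5400000000 * (Λ * M)) := by
  have hε := h.eps_pos
  obtain ⟨z0, hz0, hz0'⟩ := hend.best_mem
  obtain ⟨ystar, h1, h2⟩ := exists_best θ ⟨z0, hz0⟩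
  refine (hend.rageSetup h h1 h2).rage_time_le (sol := sol) (zstar := zstar) (hacc ⟨z0, hz0⟩) hLz hM hΛ
    fun e hle => ?_
  obtain ⟨lam, hlam, ht⟩ := hterm e (by linarith)
  refine ⟨lam, hlam, fun z => maxUnsafety μ γ z + ppEpsGap 𝒵 θ μ γ e z + e, fun z => ?_,
    fun z hz => ?_, fun z _ => ht z⟩
  · have h4 := maxUnsafety_nonneg (μ := μ) (γ := γ) (z := (z : Vec d))
    have h3 := ppEpsGap_nonneg (𝒵 := 𝒵) (θ := θ) (μ := μ) (γ := γ) (z := (z : Vec d)) (e := e)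
    linarith
  · have h3 : maxUnsafety μ γ z ≤ ε := maxUnsafety_le hε.le (hend.safe z hz)
    -- Arms of margin `e ≥ ε` are safe, hence no better than `z_*`, which is itself a candidate.
    have h4 : ppEpsGap 𝒵 θ μ γ e z ≤ pp (inner ℝ θ ((ystar : Vec d) - z)) := by
      refine ppEpsGap_le (pp_nonneg _) fun z' hz' hsafe => le_trans ?_ (le_pp _)
      have h5 := h.best.2.2 z' hz' fun i => by linarith [hsafe i]
      have h6 := h2 z0 hz0
      rw [hz0'] at h6
      simp only [inner_sub_right]
      linarith
    have h5 := pp_nonneg (- -st.unsafety z)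
    have h6 := pp_nonneg (inner ℝ θ ((ystar : Vec d) - z))
    linarith

/-- The number of samples of `BESIDE`, in terms of the number `N` of rounds and epochs. -/
lemma MainSetup.beside_time_le (h : MainSetup 𝒳 𝒵 θ μ γ ε δ zstar)
    {data : ℕ → Sample 𝒳 m} (hacc : AllAccurate consts sol θ μ γ ε δ data)
    {Lm Lz M M' Λ N : ℝ} (hLm : 0 < Lm) (hLz : 0 < Lz) (hM : 0 ≤ M) (hM' : 0 ≤ M') (hΛ0 : 0 ≤ Λ)
    (hΛm : ∀ n < rounds consts ε, mainLog 𝒵 m δ (n + 1) ≤ Λ * Lm)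
    (hΛi : ∀ n < rounds consts ε, ∀ k < epochs consts (mainEps consts (n + 1)),
      rageLog (Finset.univ : Finset 𝒵) (δ / (4 * ((n + 1 : ℕ) : ℝ) ^ 2)) (k + 1) ≤ Λ * Lz)
    (hΛe : ∀ S : Finset 𝒵, S.Nonempty → ∀ k < epochs consts ε, rageLog S δ (k + 1) ≤ Λ * Lz)
    (hNr : (rounds consts ε : ℝ) ≤ N)
    (hNe : ∀ tol, ε / 2 ≤ tol → (epochs consts tol : ℝ) ≤ N)
    (hsafety : ∀ e, ε ≤ e → ∃ lam, IsDesign 𝒳 lam ∧ ∀ z : 𝒵, invNormSq 𝒳 lam z * Lm ≤ M *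
      (minAbsSafety μ γ z + maxUnsafety μ γ z + ppEpsGap 𝒵 θ μ γ e z + e) ^ 2)
    (hopt : ∀ e, ε ≤ e → ∃ lam, IsDesign 𝒳 lam ∧ ∀ z : 𝒵, invNormSq 𝒳 lam (z - zstar) * Lz ≤
      M' * (maxUnsafety μ γ z + ppEpsGap 𝒵 θ μ γ e z + e) ^ 2) :
    ((beside consts sol γ ε δ data).1.time : ℝ) ≤
      N * (8 * (Λ * Lm) + 8000000 * (Λ * M)) +
        (N + 1) * (N * (8 * (Λ * Lz) + 5400000000 * (Λ * M'))) := by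
  have hε := h.eps_pos
  set A := 8 * (Λ * Lm) + 8000000 * (Λ * M) with hA
  set B := 8 * (Λ * Lz) + 5400000000 * (Λ * M') with hB
  have hA0 : 0 ≤ A := by positivity
  have hB0 : 0 ≤ B := by positivity
  have hN0 : 0 ≤ N := (Nat.cast_nonneg _).trans hNr
  -- A round costs one safety block, at most `A`, and at most `N` epochs, each at most `B`.
  have key : ∀ n ≤ rounds consts ε,
      ((iter consts sol γ δ data n).trace.time : ℝ) ≤ n * (A + N * B) := by
    intro n
    induction n with
    | zero => intro _; simp [iter]
    | succ n ih =>
      intro hn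
      have h1 := ih (Nat.le_of_succ_le hn)
      have hg := h.mainGuarantee hacc (Nat.le_of_succ_le hn)
      have hs := h.safeGuarantee (hacc.main n hn) hg
      have hlt := lt_mainEps hε hn
      have h2 := h.mainLen_le hg hLm hM (hΛm n hn) (hsafety _ hlt.le)
      have h3 := h.innerRage_time_le hs (hacc.inner n hn) hLz hM' hΛ0 (hΛi n hn)
        fun e he => hopt e (hlt.le.trans he)
      have h4 : (epochs consts (mainEps consts (n + 1)) : ℝ) ≤ N :=
        hNe _ (by rw [mainEps_succ]; linarith)
      have h5 := mul_le_mul_of_nonneg_right h4 hB0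
      have h6 : ((context consts sol γ δ data (n + 1) (iter consts sol γ δ data n)).trace.time : ℝ)
          = (iter consts sol γ δ data n).trace.time +
            mainLen consts 𝒳 m δ (n + 1) (iter consts sol γ δ data n).level := by
        rw [← Nat.cast_add]; rfl
      have h7 : (iter consts sol γ δ data (n + 1)).trace = (innerRage consts sol δ data (n + 1)
        (context consts sol γ δ data (n + 1) (iter consts sol γ δ data n))).1 := rfl
      rw [h7]
      push_cast
      linarith
  have h1 := key _ le_rfl
  have h2 := (h.endGuarantee hacc).endRage_time_le h hacc.final hLz hM'
    (hΛe _ (by obtain ⟨z, hz, -⟩ := (h.endGuarantee hacc).best_mem; exact ⟨z, hz⟩)) hopt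
  have h3 := mul_le_mul_of_nonneg_right (hNe ε (by linarith)) hB0
  have h4 := mul_le_mul_of_nonneg_right hNr (add_nonneg hA0 (mul_nonneg hN0 hB0))
  rw [beside_eq]
  change ((endRage consts sol ε δ data (iter consts sol γ δ data (rounds consts ε))).1.time : ℝ) ≤ _
  linarith

/-- With `N = 12 Lg ≥ 8` everything is `N³` times an affine function of `T`, `T'`, `Lm`. Constants
and `Lm` are absorbed into `Lc³ Ld`, because `Lc ≥ 1` and `2 Ld ≥ 1`. The final constant uses `12³ ·
2 · 10¹¹ < 10¹⁵`. -/
lemma sample_count_le {Lg Lc Ld Lz Lm T T' : ℝ} (hLg : Real.log 2 ≤ Lg) (hLc : 1 ≤ Lc)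
    (hLd : Real.log 2 ≤ Ld) (hLz : 0 ≤ Lz) (hLzm : Lz ≤ Lm) (hLm : Lm ≤ Lc + Ld) (hT : 0 ≤ T)
    (hT' : 0 ≤ T') :
    12 * Lg * (8 * (8 * (12 * Lg) * Lm) + 8000000 * (8 * (12 * Lg) * (T + 1))) +
      (12 * Lg + 1) * (12 * Lg * (8 * (8 * (12 * Lg) * Lz) +
        5400000000 * (8 * (12 * Lg) * (T' + 1)))) ≤
      10 ^ 15 * Lg ^ 3 * T + 10 ^ 15 * Lg ^ 3 * T' + 10 ^ 15 * (Lg * Lc) ^ 3 * Ld := by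
  have hlog2 := Real.log_two_gt_d9
  obtain ⟨N, hN⟩ : ∃ N, N = 12 * Lg := ⟨_, rfl⟩
  rw [← hN]
  have hN8 : 8 ≤ N := by linarith
  have hLc3 : 1 ≤ Lc ^ 3 := one_le_pow₀ hLc
  have hP : 1 ≤ 2 * (Lc ^ 3 * Ld) := by nlinarith
  have hP2 : Lm ≤ 3 * (Lc ^ 3 * Ld) := by
    have h5 : Lc ≤ Lc ^ 3 := le_self_pow₀ hLc (by norm_num)
    have h6 : Lc ≤ 2 * (Lc ^ 3 * Ld) := by nlinarith
    have h7 : Ld ≤ Lc ^ 3 * Ld := le_mul_of_one_le_left (by linarith) hLc3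
    linarith
  have hX : 8 * (8 * N * Lm) + 8000000 * (8 * N * (T + 1)) ≤
      N ^ 2 * (8 * Lm + 8000000 * (T + 1)) := by
    have : 8 * N ≤ N ^ 2 := by nlinarith
    calc _ = 8 * N * (8 * Lm + 8000000 * (T + 1)) := by ring
      _ ≤ _ := mul_le_mul_of_nonneg_right this (by linarith)
  have hY : (N + 1) * (N * (8 * (8 * N * Lz) + 5400000000 * (8 * N * (T' + 1)))) ≤
      N ^ 3 * (128 * Lm + 86400000000 * (T' + 1)) := by
    calc (N + 1) * (N * (8 * (8 * N * Lz) + 5400000000 * (8 * N * (T' + 1))))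
        ≤ (N + N) * (N * (8 * (8 * N * Lm) + 5400000000 * (8 * N * (T' + 1)))) := by
          gcongr
          linarith
      _ = _ := by ring
  calc _ ≤ N * (N ^ 2 * (8 * Lm + 8000000 * (T + 1))) +
        N ^ 3 * (128 * Lm + 86400000000 * (T' + 1)) :=
        add_le_add (mul_le_mul_of_nonneg_left hX (by linarith)) hY
    _ = N ^ 3 * (136 * Lm + 8000000 * T + 86400000000 * T' + 86408000000) := by ring
    _ ≤ N ^ 3 * (200000000000 * (T + T' + Lc ^ 3 * Ld)) := by
        refine mul_le_mul_of_nonneg_left ?_ (by positivity)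
        linarith
    _ = 345600000000000 * (Lg ^ 3 * (T + T' + Lc ^ 3 * Ld)) := by rw [hN]; ring
    _ ≤ 10 ^ 15 * (Lg ^ 3 * (T + T' + Lc ^ 3 * Ld)) := by
        refine mul_le_mul_of_nonneg_right (by norm_num) ?_
        have : 0 ≤ Lg := by linarith
        have : 0 ≤ Lc ^ 3 * Ld := by linarith
        positivity
    _ = _ := by ring

/-- The sample complexity of `BESIDE`. -/
lemma MainSetup.beside_time_le_terms (h : MainSetup 𝒳 𝒵 θ μ γ ε (δ / 2) zstar) (hδ1 : δ < 1)
    {data : ℕ → Sample 𝒳 m} (hacc : AllAccurate consts sol θ μ γ ε (δ / 2) data) :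
    ((beside consts sol γ ε (δ / 2) data).1.time : ℝ) ≤
      10 ^ 15 * Real.log (2 + 1 / ε) ^ 3 * safetyTerm 𝒵 θ μ γ 𝒳 ε δ +
      10 ^ 15 * Real.log (2 + 1 / ε) ^ 3 * optimalityTerm 𝒵 θ μ γ 𝒳 zstar ε δ +
      10 ^ 15 * (Real.log (2 + 1 / ε) * Real.log (2 + m * 𝒵.card)) ^ 3 * Real.log (2 / δ) := by
  have hε := h.eps_pos
  have hδ : 0 < δ := by linarith [h.delta_pos]
  have h1 : (1 : ℝ) ≤ 𝒵.card := by exact_mod_cast h.nonempty.card_pos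
  have h3 : (1 : ℝ) ≤ m := by exact_mod_cast h.one_le
  have hmz : (1 : ℝ) ≤ m * 𝒵.card := one_le_mul_of_one_le_of_one_le h3 h1
  have hlog2 := Real.log_two_gt_d9
  set Lg := Real.log (2 + 1 / ε) with hLg
  have hLg0 : Real.log 2 ≤ Lg := log_two_le_log_scale hε
  set Lm := Real.log (2 * m * 𝒵.card / δ) with hLm
  set Lz := Real.log (2 * 𝒵.card / δ) with hLz
  set Ld := Real.log (2 / δ) with hLd
  set Lc := Real.log (2 + m * 𝒵.card) with hLc
  have hLd0 : Real.log 2 ≤ Ld :=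
    Real.log_le_log (by norm_num) (by rw [le_div_iff₀ hδ]; linarith)
  have hLc1 : 1 ≤ Lc := by
    rw [hLc, Real.le_log_iff_exp_le (by linarith)]
    linarith [Real.exp_one_lt_d9]
  have hLz0 : 0 < Lz := by
    refine lt_of_lt_of_le (by linarith) (hLd0.trans (Real.log_le_log (by positivity) ?_))
    gcongr
    linarith
  have hLzm : Lz ≤ Lm := Real.log_le_log (by positivity) (by
    gcongr
    nlinarith)
  have hLm' : Lm ≤ Lc + Ld := by
    rw [hLm, hLc, hLd, ← Real.log_mul (by positivity) (by positivity)]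
    refine Real.log_le_log (by positivity) ?_
    rw [← mul_div_assoc]
    exact div_le_div_of_nonneg_right (by linarith) hδ.le
  have hsafe0 : 0 ≤ safetyTerm 𝒵 θ μ γ 𝒳 ε δ := safetyTerm_nonneg (by linarith)
  have hopt0 : 0 ≤ optimalityTerm 𝒵 θ μ γ 𝒳 zstar ε δ := optimalityTerm_nonneg hLz0.le
  set N := 12 * Lg with hN
  have hN8 : 8 ≤ N := by linarith
  have hr := rounds_le hε
  have htime := h.beside_time_le hacc (Lm := Lm) (Lz := Lz)
    (M := safetyTerm 𝒵 θ μ γ 𝒳 ε δ + 1) (M' := optimalityTerm 𝒵 θ μ γ 𝒳 zstar ε δ + 1)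
    (Λ := 8 * N) (N := N) (by linarith) hLz0 (by linarith) (by linarith) (by linarith)
    (fun n hn => by
      refine (mainLog_le h.nonempty h.one_le hδ hδ1.le (Nat.le_add_left 1 n)).trans ?_
      have h5 : ((n + 1 : ℕ) : ℝ) ≤ N := (Nat.cast_le.2 hn).trans hr
      gcongr
      · linarith
      · linarith)
    (fun n hn k hk => by
      refine (rageLog_le h.nonempty (Finset.univ_nonempty_iff.2 h.nonempty.to_subtype) hδ hδ1.le
        (Nat.le_add_left 1 k) (Nat.le_add_left 1 n) (le_of_eq (by field_simp; ring))).trans ?_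
      have h5 : ((n + 1 : ℕ) : ℝ) ≤ N := (Nat.cast_le.2 hn).trans hr
      have h6 : ((k + 1 : ℕ) : ℝ) ≤ N := (Nat.cast_le.2 hk).trans
        (epochs_le hε (by have := lt_mainEps hε hn; rw [mainEps_succ]; linarith))
      have h7 : 4 * (((k + 1 : ℕ) : ℝ) + ((n + 1 : ℕ) : ℝ)) ≤ 8 * N := by linarith
      exact mul_le_mul_of_nonneg_right h7 hLz0.le)
    (fun S hS k hk => by
      refine (rageLog_le h.nonempty hS hδ hδ1.le (Nat.le_add_left 1 k) le_rfl (by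
        rw [Nat.cast_one]; linarith)).trans ?_
      have h6 : ((k + 1 : ℕ) : ℝ) ≤ N := (Nat.cast_le.2 hk).trans (epochs_le hε (by linarith))
      have h7 : 4 * (((k + 1 : ℕ) : ℝ) + ((1 : ℕ) : ℝ)) ≤ 8 * N := by push_cast at h6 ⊢; linarith
      exact mul_le_mul_of_nonneg_right h7 hLz0.le)
    hr (fun tol htol => epochs_le hε htol)
    (fun e he => exists_design_safety h.design hε (by linarith) he)
    (fun e he => exists_design_optimality h.design hε hLz0.le he)
  exact htime.trans (sample_count_le hLg0 hLc1 hLd0 (by linarith) hLzm hLm' hsafe0 hopt0)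

end SampleCount

/-! ### Tools for the union bound -/

section UnionBound

/-- The value `π² / 6` is needed rather closely: the cruder bound `2` would exceed the budget `2 δ`
of the final union bound. -/
lemma sum_inv_sq_le (R : ℕ) : ∑ n ∈ Finset.range R, 1 / ((n + 1 : ℕ) : ℝ) ^ 2 ≤ 33 / 20 := by
  have h1 := sum_le_hasSum (Finset.range (R + 1)) (fun n _ => by positivity) hasSum_zeta_two
  rw [Finset.sum_range_succ'] at h1
  have h2 := Real.pi_lt_d4
  have h3 := Real.pi_pos
  have h4 : Real.pi ^ 2 / 6 ≤ 33 / 20 := by nlinarith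
  simp only [Nat.cast_zero, ne_eq, OfNat.ofNat_ne_zero, not_false_eq_true, zero_pow, div_zero,
    add_zero] at h1
  exact h1.trans h4

/-- A conditional bound on each fiber of a finite-valued map gives an unconditional one. -/
lemma measure_fiber_le {Ω β : Type*} [Fintype β] [MeasurableSpace β] [MeasurableSingletonClass β]
    [mΩ : MeasurableSpace Ω] {P : Measure Ω} [IsProbabilityMeasure P] {c : Ω → β}
    (hc : Measurable c) {B : β → Set Ω} {a : ENNReal}
    (h : ∀ b, P {ω | c ω = b ∧ ω ∈ B b} ≤ a * P {ω | c ω = b}) : P {ω | ω ∈ B (c ω)} ≤ a := by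
  have h1 : {ω | ω ∈ B (c ω)} ⊆ ⋃ b ∈ (Finset.univ : Finset β), {ω | c ω = b ∧ ω ∈ B b} :=
    fun ω hω => Set.mem_biUnion (Finset.mem_univ (c ω)) ⟨rfl, hω⟩
  have h2 : ∑ b, P {ω | c ω = b} = 1 := by
    have h3 := sum_measure_preimage_singleton (μ := P) (f := c) Finset.univ
      fun b _ => hc (measurableSet_singleton b)
    rw [Finset.coe_univ, Set.preimage_univ, measure_univ] at h3
    exact h3
  calc P {ω | ω ∈ B (c ω)} ≤ ∑ b, P {ω | c ω = b ∧ ω ∈ B b} :=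
        (measure_mono h1).trans (measure_biUnion_finset_le _ _)
    _ ≤ ∑ b, a * P {ω | c ω = b} := Finset.sum_le_sum fun b _ => h b
    _ = a := by rw [← Finset.mul_sum, h2, mul_one]

end UnionBound

/-! ### Probability that some estimate is inaccurate -/

section StageFailures

variable {d m : ℕ} {𝒳 𝒵 : Finset (Vec d)} {Ω : Type*} [mΩ : MeasurableSpace Ω] {P : Measure Ω}
  [IsProbabilityMeasure P] {θ : Vec d} {μ : Fin m → Vec d} {ℱ : Filtration ℕ mΩ} {arm : ℕ → Ω → 𝒳}
  {wθ : ℕ → Ω → ℝ} {wμ : ℕ → Ω → Fin m → ℝ} {κ : Consts} {sol : Solver 𝒳 𝒵}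

lemma card_diffs_le (S : Finset 𝒵) : ((diffs S).card : ℝ) ≤ (S.card : ℝ) ^ 2 := by
  classical
  have h : (diffs S).card ≤ S.card * S.card := by
    unfold diffs
    exact Finset.card_image₂_le _ _ _
  rw [sq]
  exact_mod_cast h

lemma sub_mem_diffs {S : Finset 𝒵} {z z' : 𝒵} (hz : z ∈ S) (hz' : z' ∈ S) :
    (z : Vec d) - z' ∈ diffs S := by
  unfold diffs
  exact Finset.mem_image₂_of_mem hz hz'

/-- There are at most `|S|²` differences, which is the origin of `|S|²` in `rageLog`; the
algorithm's widths therefore dominate the estimator's. -/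
lemma log_diffs_le {S : Finset 𝒵} (hS : S.Nonempty) {δ : ℝ} (hδ : 0 < δ) {ℓ : ℕ} (hℓ : 1 ≤ ℓ) :
    Real.log (1 / (δ / (2 * (ℓ : ℝ) ^ 2) / (2 * (diffs S).card))) ≤ rageLog S δ ℓ := by
  have h1 := card_diffs_le S
  obtain ⟨z, hz⟩ := hS
  have h2 : (0 : ℝ) < (diffs S).card := by
    exact_mod_cast Finset.card_pos.2 ⟨_, sub_mem_diffs hz hz⟩
  have h3 : (0 : ℝ) < ℓ := by exact_mod_cast hℓ
  refine Real.log_le_log (by positivity) ?_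
  have h4 : 1 / (δ / (2 * (ℓ : ℝ) ^ 2) / (2 * (diffs S).card)) =
      4 * (diffs S).card * (ℓ : ℝ) ^ 2 / δ := by
    field_simp
    ring
  rw [h4]
  gcongr

/-- The union over differences needs a fixed active set, so the sets are frozen on an event `C`
decided before the call. The factor `P(C)` lets the bounds be summed over the possible values of the
sets. -/
lemma IsRun.measure_rage_failure_le {alg : (ℕ → Sample 𝒳 m) → Trace 𝒳}
    (h : IsRun P alg θ μ ℱ arm wθ wμ) (hθ : ‖θ‖ ≤ 1) (hx : ∀ x ∈ 𝒳, ‖x‖ ≤ 1)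
    (hd : ∃ lam, IsDesign 𝒳 lam) {S Y : Finset 𝒵} (hS : S.Nonempty) (hY : Y.Nonempty) {tol δ : ℝ}
    (hδ : 0 < δ) (hδ1 : δ ≤ 1) {C : Set (ℕ → Sample 𝒳 m)} (hC : MeasurableSet C)
    {sg : (ℕ → Sample 𝒳 m) → 𝒵 → ℝ} (hsg : Measurable sg) {tr : (ℕ → Sample 𝒳 m) → Trace 𝒳}
    (htr : Measurable fun data => (tr data).time)
    (hcausal : ∀ data ∈ C, ∀ data', (∀ t < (tr data).time, data t = data' t) →
      data' ∈ C ∧ sg data' = sg data ∧ tr data' = tr data)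
    (hstage : ∀ data ∈ C,
      (rage κ sol S Y tol δ (sg data) data (tr data)).1.stages ⊆ (alg data).stages)
    {k : ℕ} (hk : k < epochs κ tol) :
    P {ω | observations θ μ arm wθ wμ ω ∈ C ∧ ¬ RageAccurate κ sol θ S Y δ
        (sg (observations θ μ arm wθ wμ ω)) (observations θ μ arm wθ wμ ω)
        (tr (observations θ μ arm wθ wμ ω)) k} ≤
      ENNReal.ofReal (δ / (2 * ((k + 1 : ℕ) : ℝ) ^ 2)) *
        P {ω | observations θ μ arm wθ wμ ω ∈ C} := by
  let st : (ℕ → Sample 𝒳 m) → RageState 𝒳 𝒵 := fun data =>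
    rageIter κ sol S Y δ (sg data) data (tr data) k
  obtain ⟨m1, m2, m3⟩ := measurable_rageIter κ sol measurable_id S Y δ hsg htr k
  have hspec := fun data => rageLen_spec κ sol hd hS hδ hδ1 (sg data) (Nat.le_add_left 1 k)
    (st data).yhat (st data).gap
  have hlog := log_diffs_le (S := S) hS hδ (Nat.le_add_left 1 k)
  have hℓ : (1 : ℝ) ≤ ((k + 1 : ℕ) : ℝ) := by simp
  have hℓ2 : (1 : ℝ) ≤ ((k + 1 : ℕ) : ℝ) ^ 2 := one_le_pow₀ hℓ
  have key := h.measure_stage_failure_le (ϑ := θ) hθ hx (w := wθ) (g := fun s => s.2.1)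
    (fun _ _ => rfl) (fun t => measurable_fst.comp (h.noise_meas t))
    (fun t => indep_of_indep_of_le_left (h.noise_indep t) (by
      rintro _ ⟨A, hA, rfl⟩
      exact ⟨Prod.fst ⁻¹' A, measurable_fst hA, rfl⟩))
    h.noise_subG_reward (C := C) (σ := fun data => (st data).trace.time)
    (τ := fun data => rageLen κ 𝒳 S δ (sg data) (k + 1) (st data).yhat (st data).gap)
    (lam := fun data => rageLaw κ sol S δ (sg data) (k + 1) (st data).yhat (st data).gap)
    hC m1 (measurable_rageLen κ sol S δ hsg m3 m2 (k + 1))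
    (measurable_rageLaw κ sol S δ hsg m3 m2 (k + 1))
    (fun data hdata data' hagree => by
      obtain ⟨h1, h2, h3⟩ := hcausal data hdata data' fun t ht =>
        hagree t (ht.trans_le (rageIter_time_mono (k := 0) (Nat.zero_le k)))
      have h4 : st data' = st data := by
        simp only [st]
        rw [h2, h3]
        exact rageIter_congr hagree
      rw [h2, h4]
      exact ⟨h1, rfl, rfl, rfl⟩)
    (fun data hdata => hstage data hdata (rageIter_mem_stages hY hk))
    (fun data _ => (hspec data).2.1) sol (𝒴 := diffs S) (δ := δ / (2 * ((k + 1 : ℕ) : ℝ) ^ 2))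
    (by positivity) (by rw [div_lt_one (by positivity)]; linarith)
    (fun data _ => le_trans (by linarith) (hspec data).1)
  refine (measure_mono ?_).trans key
  rintro ω ⟨h1, h2⟩
  refine ⟨h1, fun hall => h2 fun z hz z' hz' => ?_⟩
  refine (hall _ (sub_mem_diffs hz hz')).trans ?_
  set data := observations θ μ arm wθ wμ ω
  have h3 : rageWidth κ sol S δ (sg data) (k + 1) (st data).yhat (st data).gap ((z : Vec d) - z') =
      √(invNormSq 𝒳 (rageLaw κ sol S δ (sg data) (k + 1) (st data).yhat (st data).gap)
        ((z : Vec d) - z')) * √(rageLog S δ (k + 1) /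
        rageLen κ 𝒳 S δ (sg data) (k + 1) (st data).yhat (st data).gap) := by
    unfold rageWidth
    rw [mul_div_assoc, Real.sqrt_mul ((hspec data).2.1.invNormSq_nonneg _)]
  change _ ≤ 8 * rageWidth κ sol S δ (sg data) (k + 1) (st data).yhat (st data).gap
    ((z : Vec d) - z')
  rw [h3, mul_assoc]
  gcongr

omit [IsProbabilityMeasure P] in
lemma IsRun.measurable_observations {alg : (ℕ → Sample 𝒳 m) → Trace 𝒳}
    (h : IsRun P alg θ μ ℱ arm wθ wμ) : Measurable (observations θ μ arm wθ wμ) :=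
  measurable_pi_lambda _ fun t => (h.measurable_observation t).mono (ℱ.le _) le_rfl

/-- Each of the `m` parameters receives an equal share of the round's confidence; the active set is
always `𝒵`, so no conditioning event is needed. -/
lemma IsRun.measure_main_failure_le {γ ε δ : ℝ}
    (h : IsRun P (fun data => (beside κ sol γ ε δ data).1) θ μ ℱ arm wθ wμ)
    (hμ : ∀ i, ‖μ i‖ ≤ 1) (hx : ∀ x ∈ 𝒳, ‖x‖ ≤ 1) (hd : ∃ lam, IsDesign 𝒳 lam)
    (h𝒵 : 𝒵.Nonempty) (hm : 1 ≤ m) (hδ : 0 < δ) (hδ1 : δ ≤ 1) {n : ℕ} (hn : n < rounds κ ε) :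
    P {ω | ¬ MainAccurate κ sol μ γ δ (observations θ μ arm wθ wμ ω) n} ≤
      ENNReal.ofReal (δ / (2 * ((n + 1 : ℕ) : ℝ) ^ 2)) := by
  let st : (ℕ → Sample 𝒳 m) → State 𝒳 𝒵 m := fun data => iter κ sol γ δ data n
  obtain ⟨m1, m2, m3, -⟩ := measurable_iter (m := m) κ sol measurable_id γ δ n
  have ml := measurable_level m2 m3
  have hspec := fun data => mainLen_spec κ sol hd h𝒵 hm hδ hδ1 (Nat.le_add_left 1 n)
    (st data).level_nonneg
  have hm' : (1 : ℝ) ≤ m := by exact_mod_cast hm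
  have hℓ : (1 : ℝ) ≤ ((n + 1 : ℕ) : ℝ) := by simp
  have hℓ2 : (1 : ℝ) ≤ ((n + 1 : ℕ) : ℝ) ^ 2 := one_le_pow₀ hℓ
  have hmℓ := one_le_mul_of_one_le_of_one_le hm' hℓ2
  have hc : (1 : ℝ) ≤ 𝒵.card := by exact_mod_cast h𝒵.card_pos
  have hlog : Real.log (1 / (δ / (2 * m * ((n + 1 : ℕ) : ℝ) ^ 2) / (2 * 𝒵.card))) =
      mainLog 𝒵 m δ (n + 1) := by
    unfold mainLog
    congr 1
    field_simp
    ring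
  have key := fun i : Fin m => h.measure_stage_failure_le (ϑ := μ i) (hμ i) hx (w := fun t ω => wμ t ω i)
    (g := fun s => s.2.2 i)
    (fun _ _ => rfl) (fun t => (measurable_pi_apply i).comp (measurable_snd.comp (h.noise_meas t)))
    (fun t => indep_of_indep_of_le_left (h.noise_indep t) (by
      rintro _ ⟨A, hA, rfl⟩
      exact ⟨(fun p : ℝ × (Fin m → ℝ) => p.2 i) ⁻¹' A,
        ((measurable_pi_apply i).comp measurable_snd) hA, rfl⟩))
    (fun t => h.noise_subG_safety t i) (C := Set.univ) (σ := fun data => (st data).trace.time)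
    (τ := fun data => mainLen κ 𝒳 m δ (n + 1) (st data).level)
    (lam := fun data => mainLaw κ sol m δ (n + 1) (st data).level)
    MeasurableSet.univ m1 (measurable_mainLen κ sol m δ ml (n + 1))
    (measurable_mainLaw κ sol m δ ml (n + 1))
    (fun data _ data' hagree => by
      have h4 : st data' = st data := iter_congr hagree
      rw [h4]
      exact ⟨Set.mem_univ _, rfl, rfl, rfl⟩)
    (fun data _ => iter_stages_subset_beside (n := n + 1) hn
      (rage_stages_subset (mem_stages_add _ _ _)))
    (fun data _ => (hspec data).2.1) sol (𝒴 := 𝒵)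
    (δ := δ / (2 * m * ((n + 1 : ℕ) : ℝ) ^ 2))
    (by positivity) (by rw [div_lt_one (by positivity)]; linarith)
    (fun data _ => by rw [hlog]; exact (hspec data).1)
  have hsub : {ω | ¬ MainAccurate κ sol μ γ δ (observations θ μ arm wθ wμ ω) n} ⊆
      ⋃ i, {ω | ¬ ∀ z : 𝒵, |inner ℝ (mainEst κ sol δ (observations θ μ arm wθ wμ ω) (n + 1)
        (st (observations θ μ arm wθ wμ ω)).trace.time (st (observations θ μ arm wθ wμ ω)).level i)
        (z : Vec d) - inner ℝ (μ i) (z : Vec d)| ≤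
        8 * mainWidth κ sol m δ (n + 1) (st (observations θ μ arm wθ wμ ω)).level z} := by
    intro ω hω
    by_contra hnot
    refine hω fun i => ?_
    by_contra hi
    exact hnot (Set.mem_iUnion.2 ⟨i, hi⟩)
  refine (measure_mono hsub).trans ((measure_iUnion_fintype_le _ _).trans ?_)
  have hi : ∀ i, P {ω | ¬ ∀ z : 𝒵, |inner ℝ (mainEst κ sol δ (observations θ μ arm wθ wμ ω) (n + 1)
        (st (observations θ μ arm wθ wμ ω)).trace.time (st (observations θ μ arm wθ wμ ω)).level i)
        (z : Vec d) - inner ℝ (μ i) (z : Vec d)| ≤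
        8 * mainWidth κ sol m δ (n + 1) (st (observations θ μ arm wθ wμ ω)).level z} ≤
      ENNReal.ofReal (δ / (2 * m * ((n + 1 : ℕ) : ℝ) ^ 2)) := by
    intro i
    refine ((measure_mono ?_).trans (key i)).trans (mul_le_of_le_one_right' prob_le_one)
    intro ω hω
    refine ⟨Set.mem_univ _, fun hall => hω fun z => (hall z z.2).trans (le_of_eq ?_)⟩
    rw [hlog]
    unfold mainWidth
    rw [mul_div_assoc, Real.sqrt_mul ((hspec _).2.1.invNormSq_nonneg _), mul_assoc]
  refine (Finset.sum_le_sum fun i _ => hi i).trans (le_of_eq ?_)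
  rw [Finset.sum_const, Finset.card_univ, Fintype.card_fin, nsmul_eq_mul, ← ENNReal.ofReal_natCast,
    ← ENNReal.ofReal_mul (Nat.cast_nonneg m)]
  congr 1
  field_simp

lemma sum_ofReal_div_le {δ : ℝ} (hδ : 0 ≤ δ) (R : ℕ) :
    ∑ n ∈ Finset.range R, ENNReal.ofReal (δ / (2 * ((n + 1 : ℕ) : ℝ) ^ 2)) ≤
      ENNReal.ofReal (33 / 40 * δ) := by
  rw [← ENNReal.ofReal_sum_of_nonneg fun n _ => by positivity]
  refine ENNReal.ofReal_le_ofReal ?_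
  have h := mul_le_mul_of_nonneg_left (sum_inv_sq_le R) (div_nonneg hδ zero_le_two)
  rw [Finset.mul_sum] at h
  calc _ = ∑ n ∈ Finset.range R, δ / 2 * (1 / ((n + 1 : ℕ) : ℝ) ^ 2) :=
        Finset.sum_congr rfl fun n _ => by field_simp
    _ ≤ _ := h.trans (by linarith)

/-- The failure probability of a call of `RAGE^ε` whose active and optimal sets are random. -/
lemma IsRun.measure_rage_failure_le_of_random {alg : (ℕ → Sample 𝒳 m) → Trace 𝒳}
    (h : IsRun P alg θ μ ℱ arm wθ wμ) (hθ : ‖θ‖ ≤ 1) (hx : ∀ x ∈ 𝒳, ‖x‖ ≤ 1)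
    (hd : ∃ lam, IsDesign 𝒳 lam) {S Y : (ℕ → Sample 𝒳 m) → Finset 𝒵} (hSm : Measurable S)
    (hYm : Measurable Y) (hYS : ∀ data, Y data ⊆ S data) {tol δ : ℝ}
    (hδ : 0 < δ) (hδ1 : δ ≤ 1)
    {sg : (ℕ → Sample 𝒳 m) → 𝒵 → ℝ} (hsg : Measurable sg) {tr : (ℕ → Sample 𝒳 m) → Trace 𝒳}
    (htr : Measurable fun data => (tr data).time)
    (hcausal : ∀ data data', (∀ t < (tr data).time, data t = data' t) →
      S data' = S data ∧ Y data' = Y data ∧ sg data' = sg data ∧ tr data' = tr data)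
    (hstage : ∀ data,
      (rage κ sol (S data) (Y data) tol δ (sg data) data (tr data)).1.stages ⊆ (alg data).stages) :
    P {ω | ¬ ((Y (observations θ μ arm wθ wμ ω)).Nonempty → ∀ k < epochs κ tol,
        RageAccurate κ sol θ (S (observations θ μ arm wθ wμ ω)) (Y (observations θ μ arm wθ wμ ω)) δ
        (sg (observations θ μ arm wθ wμ ω)) (observations θ μ arm wθ wμ ω)
        (tr (observations θ μ arm wθ wμ ω)) k)} ≤ ENNReal.ofReal (33 / 40 * δ) := by
  let B : ℕ → Finset 𝒵 × Finset 𝒵 → Set Ω := fun k SY => {ω | SY.2.Nonempty ∧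
    ¬ RageAccurate κ sol θ SY.1 SY.2 δ
        (sg (observations θ μ arm wθ wμ ω)) (observations θ μ arm wθ wμ ω)
        (tr (observations θ μ arm wθ wμ ω)) k}
  let c : Ω → Finset 𝒵 × Finset 𝒵 := fun ω =>
    (S (observations θ μ arm wθ wμ ω), Y (observations θ μ arm wθ wμ ω))
  have hc : Measurable c := (hSm.prodMk hYm).comp h.measurable_observations
  have hB : ∀ k < epochs κ tol, P {ω | ω ∈ B k (c ω)} ≤
      ENNReal.ofReal (δ / (2 * ((k + 1 : ℕ) : ℝ) ^ 2)) := by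
    intro k hk
    -- Conditioning on the pair of sets costs nothing: the relative bounds recombine with total
    -- weight `1`.
    refine measure_fiber_le hc fun SY => ?_
    rcases SY.2.eq_empty_or_nonempty with hY | hY
    · have : {ω | c ω = SY ∧ ω ∈ B k SY} = ∅ := by
        ext ω
        simp [B, hY]
      rw [this, measure_empty]
      exact zero_le
    by_cases hsub : SY.2 ⊆ SY.1
    · have hC : MeasurableSet {data | (S data, Y data) = SY} :=
        (hSm.prodMk hYm) (measurableSet_singleton SY)
      have key := h.measure_rage_failure_le (κ := κ) (sol := sol) hθ hx hd (hY.mono hsub) hY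
        (tol := tol) hδ hδ1 hC hsg htr
        (fun data hdata data' hagree => by
          obtain ⟨h1, h2, h3, h4⟩ := hcausal data data' hagree
          refine ⟨?_, h3, h4⟩
          change (S data', Y data') = SY
          rw [h1, h2]
          exact hdata)
        (fun data hdata => by
          have := hstage data
          have hdata' : (S data, Y data) = SY := hdata
          rw [← hdata']
          exact this) hk
      refine le_trans (measure_mono ?_) key
      exact fun ω hω => ⟨hω.1, hω.2.2⟩
    · have : {ω | c ω = SY ∧ ω ∈ B k SY} = ∅ := by
        refine Set.eq_empty_of_forall_notMem fun ω hω => hsub ?_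
        rw [← hω.1]
        exact hYS _
      rw [this, measure_empty]
      exact zero_le
  refine (measure_mono (t := ⋃ k ∈ Finset.range (epochs κ tol), {ω | ω ∈ B k (c ω)}) ?_).trans
    ((measure_biUnion_finset_le _ _).trans ((Finset.sum_le_sum fun k hk =>
      hB k (Finset.mem_range.1 hk)).trans (sum_ofReal_div_le hδ.le _)))
  intro ω hω
  by_contra hnot
  refine hω fun hY k hk => ?_
  by_contra hk'
  exact hnot (Set.mem_biUnion (Finset.mem_coe.2 (Finset.mem_range.2 hk)) ⟨hY, hk'⟩)

/-- With high probability all estimates of `BESIDE` are accurate. -/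
lemma IsRun.measure_not_allAccurate_le {γ ε δ : ℝ}
    (h : IsRun P (fun data => (beside κ sol γ ε δ data).1) θ μ ℱ arm wθ wμ)
    (hθ : ‖θ‖ ≤ 1) (hμ : ∀ i, ‖μ i‖ ≤ 1) (hx : ∀ x ∈ 𝒳, ‖x‖ ≤ 1) (hd : ∃ lam, IsDesign 𝒳 lam)
    (h𝒵 : 𝒵.Nonempty) (hm : 1 ≤ m) (hδ : 0 < δ) (hδ1 : δ ≤ 1) :
    P {ω | ¬ AllAccurate κ sol θ μ γ ε δ (observations θ μ arm wθ wμ ω)} ≤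
      ENNReal.ofReal (2 * δ) := by
  set obs := observations θ μ arm wθ wμ with hobs
  let ctx : ℕ → (ℕ → Sample 𝒳 m) → Context 𝒳 𝒵 m := fun n data =>
    context κ sol γ δ data (n + 1) (iter κ sol γ δ data n)
  have hctx : ∀ n data data', (∀ t < (ctx n data).trace.time, data t = data' t) →
      ctx n data' = ctx n data := by
    intro n data data' hagree
    have h1 : iter κ sol γ δ data' n = iter κ sol γ δ data n :=
      iter_congr fun t ht => hagree t (ht.trans_le time_le_context)
    simp only [ctx]
    rw [h1]
    exact context_congr hagree
  let I : ℕ → Set Ω := fun n => {ω | ¬ ((ctx n (obs ω)).Y.Nonempty →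
    ∀ k < epochs κ (mainEps κ (n + 1)), RageAccurate κ sol θ Finset.univ
      (ctx n (obs ω)).Y (δ / (4 * ((n + 1 : ℕ) : ℝ) ^ 2)) (ctx n (obs ω)).sg (obs ω)
      (ctx n (obs ω)).trace k)}
  have hI : ∀ n < rounds κ ε, P (I n) ≤
      ENNReal.ofReal (33 / 80 * δ / (2 * ((n + 1 : ℕ) : ℝ) ^ 2)) := by
    intro n hn
    obtain ⟨m1, m2, m3, m4⟩ := measurable_iter (m := m) κ sol measurable_id γ δ n
    obtain ⟨c1, c2, c3, c4⟩ := measurable_context κ sol measurable_id γ δ m1 m2 m3 m4 (n + 1)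
    have hℓ2 : (1 : ℝ) ≤ ((n + 1 : ℕ) : ℝ) ^ 2 := one_le_pow₀ (by simp)
    refine (h.measure_rage_failure_le_of_random (κ := κ) (sol := sol) hθ hx hd
      (S := fun _ => Finset.univ) (Y := fun data => (ctx n data).Y) measurable_const c4
      (fun _ => Finset.subset_univ _) (tol := mainEps κ (n + 1))
      (δ := δ / (4 * ((n + 1 : ℕ) : ℝ) ^ 2)) (by positivity)
      (by rw [div_le_one (by positivity)]; linarith) (sg := fun data => (ctx n data).sg) c3
      (tr := fun data => (ctx n data).trace) c1
      (fun data data' hagree => by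
        rw [hctx n data data' hagree]
        exact ⟨rfl, rfl, rfl, rfl⟩)
      (fun data => iter_stages_subset_beside (n := n + 1) hn)).trans (le_of_eq ?_)
    congr 1
    field_simp
    norm_num
  let F : Set Ω := {ω | ¬ ((endSet κ ε (iter κ sol γ δ (obs ω) (rounds κ ε))).Nonempty →
    ∀ k < epochs κ ε, RageAccurate κ sol θ (endSet κ ε (iter κ sol γ δ (obs ω) (rounds κ ε)))
      (endSet κ ε (iter κ sol γ δ (obs ω) (rounds κ ε))) δ
      (fun z => -(iter κ sol γ δ (obs ω) (rounds κ ε)).unsafety z) (obs ω)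
      (iter κ sol γ δ (obs ω) (rounds κ ε)).trace k)}
  have hF : P F ≤ ENNReal.ofReal (33 / 40 * δ) := by
    have hE := measurable_endSet (m := m) κ sol measurable_id γ δ ε (rounds κ ε)
    exact h.measure_rage_failure_le_of_random (κ := κ) (sol := sol) hθ hx hd
      (S := fun data => endSet κ ε (iter κ sol γ δ data (rounds κ ε)))
      (Y := fun data => endSet κ ε (iter κ sol γ δ data (rounds κ ε))) hE hE
      (fun _ => subset_rfl) (tol := ε) hδ hδ1
      (sg := fun data => fun z => -(iter κ sol γ δ data (rounds κ ε)).unsafety z)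
      (measurable_unsafety (m := m) κ sol measurable_id γ δ (rounds κ ε))
      (tr := fun data => (iter κ sol γ δ data (rounds κ ε)).trace)
      (measurable_iter (m := m) κ sol measurable_id γ δ (rounds κ ε)).1
      (fun data data' hagree => by
        have h1 : iter κ sol γ δ data' (rounds κ ε) = iter κ sol γ δ data (rounds κ ε) :=
          iter_congr hagree
        rw [h1]
        exact ⟨rfl, rfl, rfl, rfl⟩)
      (fun data => List.Subset.refl _)
  let A : ℕ → Set Ω := fun n => {ω | ¬ MainAccurate κ sol μ γ δ (obs ω) n}
  have hA : ∀ n < rounds κ ε, P (A n) ≤ ENNReal.ofReal (δ / (2 * ((n + 1 : ℕ) : ℝ) ^ 2)) :=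
    fun n hn => h.measure_main_failure_le hμ hx hd h𝒵 hm hδ hδ1 hn
  have hsub : {ω | ¬ AllAccurate κ sol θ μ γ ε δ (obs ω)} ⊆
      (⋃ n ∈ Finset.range (rounds κ ε), A n) ∪ (⋃ n ∈ Finset.range (rounds κ ε), I n) ∪ F := by
    intro ω hω
    by_contra hnot
    refine hω ⟨fun n hn => ?_, fun n hn => ?_, ?_⟩
    · by_contra h1
      exact hnot (Or.inl (Or.inl (Set.mem_biUnion (Finset.mem_coe.2 (Finset.mem_range.2 hn)) h1)))
    · by_contra h1
      exact hnot (Or.inl (Or.inr (Set.mem_biUnion (Finset.mem_coe.2 (Finset.mem_range.2 hn)) h1)))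
    · by_contra h1
      exact hnot (Or.inr h1)
  have hA' : P (⋃ n ∈ Finset.range (rounds κ ε), A n) ≤ ENNReal.ofReal (33 / 40 * δ) :=
    (measure_biUnion_finset_le _ _).trans ((Finset.sum_le_sum fun n hn =>
      hA n (Finset.mem_range.1 hn)).trans (sum_ofReal_div_le hδ.le _))
  have hI' : P (⋃ n ∈ Finset.range (rounds κ ε), I n) ≤ ENNReal.ofReal (33 / 40 * (33 / 80 * δ)) :=
    (measure_biUnion_finset_le _ _).trans ((Finset.sum_le_sum fun n hn =>
      hI n (Finset.mem_range.1 hn)).trans (sum_ofReal_div_le (by positivity) _))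
  calc _ ≤ _ := measure_mono hsub
    _ ≤ P (⋃ n ∈ Finset.range (rounds κ ε), A n) + P (⋃ n ∈ Finset.range (rounds κ ε), I n) + P F :=
        (measure_union_le _ _).trans (add_le_add_left (measure_union_le _ _) _)
    _ ≤ ENNReal.ofReal (33 / 40 * δ) + ENNReal.ofReal (33 / 40 * (33 / 80 * δ)) +
        ENNReal.ofReal (33 / 40 * δ) := add_le_add (add_le_add hA' hI') hF
    -- `33/40 + (33/40)(33/80) + 33/40` is about `1.99`.
    _ ≤ ENNReal.ofReal (2 * δ) := by
        rw [← ENNReal.ofReal_add (by positivity) (by positivity),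
          ← ENNReal.ofReal_add (by positivity) (by positivity)]
        exact ENNReal.ofReal_le_ofReal (by linarith)

end StageFailures

end Beside

end

/-! ### The theorem -/

theorem theorem1 :
    ∃ (κ : Beside.Consts) (K : ℝ) (p : ℕ), 0 < K ∧
      ∀ (d m : ℕ) (𝒳 𝒵 : Finset (Beside.Vec d)) (θ : Beside.Vec d) (μ : Fin m → Beside.Vec d)
        (γ ε δ : ℝ) (zstar : Beside.Vec d) (sol : Beside.Solver 𝒳 𝒵),
        1 ≤ m → Submodule.span ℝ (𝒳 : Set (Beside.Vec d)) = ⊤ →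
        ‖θ‖ ≤ 1 → (∀ i, ‖μ i‖ ≤ 1) → (∀ x ∈ 𝒳, ‖x‖ ≤ 1) → (∀ z ∈ 𝒵, ‖z‖ ≤ 1) →
        |γ| ≤ 1 → 0 < ε → 0 < δ → δ < 1 →
        Beside.IsBestSafe 𝒵 θ μ γ zstar →
        ∀ (Ω : Type*) (mΩ : MeasurableSpace Ω) (P : MeasureTheory.Measure Ω)
          (_ : MeasureTheory.IsProbabilityMeasure P) (ℱ : MeasureTheory.Filtration ℕ mΩ)
          (arm : ℕ → Ω → 𝒳) (wθ : ℕ → Ω → ℝ) (wμ : ℕ → Ω → Fin m → ℝ),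
          Beside.IsRun P (fun data => (Beside.beside κ sol γ ε (δ / 2) data).1) θ μ
            ℱ arm wθ wμ →
          ENNReal.ofReal (1 - δ) ≤ P {ω |
            let out := Beside.beside κ sol γ ε (δ / 2)
              (Beside.observations θ μ arm wθ wμ ω)
            inner ℝ θ zstar - ε ≤ inner ℝ θ (out.2 : Beside.Vec d) ∧
            (∀ i, -ε ≤ Beside.safetyGap μ γ i (out.2 : Beside.Vec d)) ∧
            (out.1.time : ℝ) ≤
              K * Real.log (2 + 1 / ε) ^ p * Beside.safetyTerm 𝒵 θ μ γ 𝒳 ε δ +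
              K * Real.log (2 + 1 / ε) ^ p * Beside.optimalityTerm 𝒵 θ μ γ 𝒳 zstar ε δ +
              K * (Real.log (2 + 1 / ε) * Real.log (2 + m * 𝒵.card)) ^ p *
                Real.log (2 / δ)} := by
  refine ⟨Beside.consts, 10 ^ 15, 3, by norm_num, ?_⟩
  intro d m 𝒳 𝒵 θ μ γ ε δ zstar sol hm hspan hθ hμ hx hz hγ hε hδ hδ1 hbest Ω mΩ P hP ℱ arm wθ wμ
    hrun
  -- An arm is drawn at some sample point, so `𝒳` is nonempty; the spanning hypothesis alone does
  -- not give this when `d = 0`.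
  obtain ⟨ω₀⟩ := MeasureTheory.nonempty_of_isProbabilityMeasure P
  have hd := Beside.exists_isDesign hspan ⟨_, (arm 0 ω₀).2⟩
  have h : Beside.MainSetup 𝒳 𝒵 θ μ γ ε (δ / 2) zstar :=
    { design := hd
      one_le := hm
      norm_param := hθ
      norm_safety := hμ
      norm_arm := hz
      abs_threshold := hγ
      eps_pos := hε
      delta_pos := by linarith
      delta_le := by linarith
      best := hbest }
  have hfail := hrun.measure_not_allAccurate_le hθ hμ hx hd ⟨_, hbest.1⟩ hm (half_pos hδ)
    (by linarith)
  rw [mul_div_cancel₀ δ two_ne_zero] at hfail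
  set bad := {ω | ¬ Beside.AllAccurate Beside.consts sol θ μ γ ε (δ / 2)
    (Beside.observations θ μ arm wθ wμ ω)} with hbad
  rw [ENNReal.ofReal_sub _ hδ.le, ENNReal.ofReal_one, tsub_le_iff_right]
  -- Subadditivity of the outer measure suffices; the success event need not be shown measurable.
  calc (1 : ENNReal) = P Set.univ := MeasureTheory.measure_univ.symm
    _ ≤ P (_ ∪ bad) := MeasureTheory.measure_mono fun ω _ => ?_
    _ ≤ _ + P bad := MeasureTheory.measure_union_le _ _
    _ ≤ _ := add_le_add le_rfl hfail
  by_cases hω : ω ∈ bad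
  · exact Or.inr hω
  · have hacc := not_not.1 hω
    obtain ⟨h1, h2⟩ := h.beside_correct hacc
    exact Or.inl ⟨h1, h2, h.beside_time_le_terms hδ1 hacc⟩
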